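/- Let $N$ be a nonnegative integer and let $\mathrm{Y}^+(\mathfrak{gl}_N)$ be the dual Yangian over $\mathbb{C}[[h]]$, that is, the associative $\mathbb{C}[[h]]$-algebra with generators $t_{ij}^{(-r)}$, where $1\le i,j\le N$ and $r=1,2,\dots$, subject to the defining relations $$[t^{(-r)}_{ij}, t^{(-s)}_{kl}] =\delta_{kj}\, t^{(-r-s)}_{il}- \delta_{il}\, t^{(-r-s)}_{kj}+h\sum_{a=1}^{\min\{r,s\}}\Big(t^{(-r-s+a-1)}_{kj} t^{(-a)}_{il}-t^{(-a)}_{kj} t^{(-r-s+a-1)}_{il}\Big).$$ (Up to the common factor $h^2$, these are the coefficients of the relation $R(u-v)\,T^+_1(u)\,T^+_2(v)=T^+_2(v)\,T^+_1(u)\,R(u-v)$ with the Yang $R$-matrix $R(u)=1-Phu^{-1}$.) Here $T^+(u)=\sum_{i,j} e_{ij}\otimes t^+_{ij}(u)$ with $t^+_{ij}(u)=\delta_{ij}-h\sum_{r\ge1}t_{ij}^{(-r)}u^{r-1}$, and a subscript $a$ indicates the copy of $\mathrm{End}\,\mathbb{C}^N$ in which the matrix is placed. Let $\widehat{\mathrm{Y}}=\varprojlim_n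 \mathrm{Y}^+(\mathfrak{gl}_N)/h^n\,\mathrm{Y}^+(\mathfrak{gl}_N)$ be the $h$-adic completion. For a Young diagram $\mu$ with $m$ boxes and at most $N$ rows, and a standard tableau $\mathcal{U}$ of shape $\mu$ with entries $1,\dots,m$, let $c_a=c_a(\mathcal{U})=j-i$ be the content of the box $(i,j)$ occupied by $a$. Let $e_{\mathcal{U}}\in\mathbb{C}[\mathfrak{S}_m]$ be the primitive idempotent associated with $\mathcal{U}$: it acts in the irreducible representation of shape $\mu$ as the orthogonal projection onto the vector of the orthonormal Young basis labelled by $\mathcal{U}$, and by zero in all other irreducible representations. Explicitly, $$e_{\mathcal{U}}=\prod_{a=1}^m\ \prod_{\substack{c\in\mathbb{Z},\ |c|<m\\ c\ne c_a}}\frac{x_a-c}{c_a-c},\qquad x_a=\sum_{b<a}(b\ a).$$ Let $\mathcal{E}_{\mathcal{U}}$ be the image of $e_{\mathcal{U}}$ in $(\mathrm{End}\,\mathbb{C}^N)^{\otimes m}$ under the action of $\mathfrak{S}_m$ by permutations of the tensor factors, and set $$\mathbb{T}^+_{\mu}(u)=\mathrm{tr}_{1,\dots,m}\ \mathcal{E}_{\mathcal{U}}\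 T^+_1(u+hc_1)\cdots T^+_m(u+hc_m)\ \in\ \widehat{\mathrm{Y}}[[u]].$$ Then the coefficients of all the series $\mathbb{T}^+_\mu(u)$, for all Young diagrams $\mu$ with at most $N$ rows and all choices of the standard tableau $\mathcal{U}$ of shape $\mu$ used to write them, generate a commutative $\mathbb{C}[[h]]$-subalgebra of $\widehat{\mathrm{Y}}$. -/

import Mathlib

open scoped PowerSeries

noncomputable section

/-! ## The dual Yangian over `ℂ⟦h⟧`

The formal parameter `h` is the variable `PowerSeries.X` of `ℂ⟦X⟧`. -/

/-- The free generator standing for `t_{ij}^{(-(r+1))}`, `r = 0, 1, 2, …`. -/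
def dualYangianGen {N : ℕ} (i j : Fin N) (r : ℕ) :
    FreeAlgebra ℂ⟦X⟧ (Fin N × Fin N × ℕ) :=
  FreeAlgebra.ι ℂ⟦X⟧ (i, j, r)

/-- The defining relations of the dual Yangian `Y⁺(gl_N)` over `ℂ⟦h⟧`:
for `p, q ≥ 1` (here `p = r + 1`, `q = s + 1`)
`[t_{ij}^{(-p)}, t_{kl}^{(-q)}] = δ_{kj} t_{il}^{(-p-q)} - δ_{il} t_{kj}^{(-p-q)}
  + h ∑_{b=1}^{min(p,q)} (t_{kj}^{(-p-q+b-1)} t_{il}^{(-b)} - t_{kj}^{(-b)} t_{il}^{(-p-q+b-1)})`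
(here `b = a + 1`). With `t⁺_{ij}(u) = δ_{ij} - h ∑_{p ≥ 1} t_{ij}^{(-p)} u^{p-1}` they are the
coefficients, after cancelling the common factor `h²`, of
`(u - v) [t⁺_{ij}(u), t⁺_{kl}(v)] = h (t⁺_{kj}(u) t⁺_{il}(v) - t⁺_{kj}(v) t⁺_{il}(u))`, that is, of
`R(u - v) T⁺₁(u) T⁺₂(v) = T⁺₂(v) T⁺₁(u) R(u - v)` with `R(u) = 1 - P h u⁻¹`. -/
inductive DualYangianRel (N : ℕ) :
    FreeAlgebra ℂ⟦X⟧ (Fin N × Fin N × ℕ) → FreeAlgebra ℂ⟦X⟧ (Fin N × Fin N × ℕ) → Prop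
  | comm (i j k l : Fin N) (r s : ℕ) :
      DualYangianRel N
        (dualYangianGen i j r * dualYangianGen k l s
          - dualYangianGen k l s * dualYangianGen i j r)
        ((if k = j then dualYangianGen i l (r + s + 1) else 0)
          - (if i = l then dualYangianGen k j (r + s + 1) else 0)
          + (PowerSeries.X : ℂ⟦X⟧) • ∑ a ∈ Finset.range (min r s + 1),
              (dualYangianGen k j (r + s + 1 - a) * dualYangianGen i l a
                - dualYangianGen k j a * dualYangianGen i l (r + s + 1 - a)))

/-- The dual Yangian `Y⁺(gl_N)`, an associative algebra over `ℂ⟦h⟧`. -/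
abbrev DualYangian (N : ℕ) : Type := RingQuot (DualYangianRel N)

/-- The generator `t_{ij}^{(-(r+1))}` of the dual Yangian. -/
def DualYangian.t {N : ℕ} (i j : Fin N) (r : ℕ) : DualYangian N :=
  RingQuot.mkAlgHom ℂ⟦X⟧ (DualYangianRel N) (dualYangianGen i j r)

/-! ## The `h`-adic completion of an associative `ℂ⟦h⟧`-algebra -/

section Completion

variable (A : Type) [Ring A] [Algebra ℂ⟦X⟧ A]

/-- The two-sided ideal `hⁿ A`. -/
def hIdeal (n : ℕ) : Ideal A :=
  Ideal.span {algebraMap ℂ⟦X⟧ A ((PowerSeries.X : ℂ⟦X⟧) ^ n)}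

instance hIdeal_isTwoSided (n : ℕ) : (hIdeal A n).IsTwoSided where
  mul_mem_of_left := by
    intro a b ha
    obtain ⟨c, rfl⟩ := Ideal.mem_span_singleton'.1 ha
    refine Ideal.mem_span_singleton'.2 ⟨c * b, ?_⟩
    rw [mul_assoc, mul_assoc, Algebra.commutes]

theorem hIdeal_le {m n : ℕ} (hmn : m ≤ n) : hIdeal A n ≤ hIdeal A m := by
  refine (Ideal.span_singleton_le_iff_mem _).2 (Ideal.mem_span_singleton'.2
    ⟨algebraMap ℂ⟦X⟧ A ((PowerSeries.X : ℂ⟦X⟧) ^ (n - m)), ?_⟩)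
  rw [← map_mul, ← pow_add, Nat.sub_add_cancel hmn]

/-- The `h`-adic completion of `A`: the inverse limit of the algebras `A / hⁿ A`, realized as the
subalgebra of compatible sequences in their product. -/
def HAdicCompletion : Subalgebra ℂ⟦X⟧ (∀ n : ℕ, A ⧸ hIdeal A n) where
  carrier := {x | ∀ (m n : ℕ) (hmn : m ≤ n),
    Ideal.Quotient.factor (hIdeal_le A hmn) (x n) = x m}
  mul_mem' := by
    intro x y hx hy m n hmn
    simp only [Pi.mul_apply, map_mul, hx m n hmn, hy m n hmn]
  add_mem' := by
    intro x y hx hy m n hmn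
    simp only [Pi.add_apply, map_add, hx m n hmn, hy m n hmn]
  algebraMap_mem' := by
    intro r m n hmn
    rfl

variable {A}

/-- The element `∑_{d ≥ 0} h^d f_d` of the `h`-adic completion of `A`; modulo `hⁿ` it is the finite
sum over `d < n`. -/
def hSeries (f : ℕ → A) : HAdicCompletion A :=
  ⟨fun n => Ideal.Quotient.mk (hIdeal A n)
      (∑ d ∈ Finset.range n, ((PowerSeries.X : ℂ⟦X⟧) ^ d) • f d), by
    intro m n hmn
    change Ideal.Quotient.factor (hIdeal_le A hmn) (Ideal.Quotient.mk (hIdeal A n) _) = _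
    rw [Ideal.Quotient.factor_mk, Ideal.Quotient.eq, Finset.sum_range_sub_sum_range hmn]
    refine Ideal.sum_mem _ fun d hd => ?_
    have hd' : m ≤ d := by simpa using (Finset.mem_filter.1 hd).2
    refine Ideal.mem_span_singleton'.2 ⟨((PowerSeries.X : ℂ⟦X⟧) ^ (d - m)) • f d, ?_⟩
    rw [← Algebra.commutes, ← Algebra.smul_def, smul_smul, ← pow_add, Nat.add_sub_cancel' hd']⟩

end Completion

/-! ## Standard tableaux and primitive idempotents of the symmetric group -/

/-- A standard tableau of shape `μ`: the boxes of `μ` are filled bijectively with the numbers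
`0, …, m - 1`, where `m` is the number of boxes (so `a : Fin m` stands for the entry `a + 1`),
increasing along rows and down columns. A box `(i, j)` lies in row `i` and column `j`. -/
structure StandardTableau (μ : YoungDiagram) where
  entry : {x : ℕ × ℕ // x ∈ μ.cells} ≃ Fin μ.card
  row_lt : ∀ x y : {x : ℕ × ℕ // x ∈ μ.cells},
    x.1.1 = y.1.1 → x.1.2 < y.1.2 → entry x < entry y
  col_lt : ∀ x y : {x : ℕ × ℕ // x ∈ μ.cells},
    x.1.2 = y.1.2 → x.1.1 < y.1.1 → entry x < entry y

/-- The content `j - i` of the box `(i, j)` occupied by the entry `a`. -/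
def StandardTableau.content {μ : YoungDiagram} (U : StandardTableau μ) (a : Fin μ.card) : ℤ :=
  ((U.entry.symm a).1.2 : ℤ) - ((U.entry.symm a).1.1 : ℤ)

/-- The Jucys–Murphy element `∑_{b < a} (b a)` of the group algebra of the symmetric group. -/
def jucysMurphy {m : ℕ} (a : Fin m) : MonoidAlgebra ℂ (Equiv.Perm (Fin m)) :=
  ∑ b ∈ Finset.Iio a, MonoidAlgebra.of ℂ (Equiv.Perm (Fin m)) (Equiv.swap b a)

/-- The primitive idempotent `e_U ∈ ℂ[S_m]` of a standard tableau `U`. The Young basis of the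
irreducible representation of shape `μ` is the (orthonormal) basis of joint eigenvectors `v_V` of
the Jucys–Murphy elements `x_a`, indexed by the standard tableaux `V` of shape `μ`, with
`x_a v_V = c_a(V) v_V`; all eigenvalues are integers of absolute value less than `m`, and `V` is
determined by its sequence of contents. The idempotent `e_U` acts as the projection onto `ℂ v_U`
along the other vectors of this basis and by zero in the other irreducible representations, so it
is the joint spectral projection
`e_U = ∏_a ∏_{|c| < m, c ≠ c_a(U)} (x_a - c) / (c_a(U) - c)`. -/
def StandardTableau.idempotent {μ : YoungDiagram} (U : StandardTableau μ) :
    MonoidAlgebra ℂ (Equiv.Perm (Fin μ.card)) :=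
  (List.ofFn fun a : Fin μ.card =>
    Polynomial.aeval (jucysMurphy a)
      (Lagrange.basis (Finset.Ioo (-(μ.card : ℤ)) (μ.card : ℤ)) (fun c : ℤ => (c : ℂ))
        (U.content a))).prod

/-! ## The series `T⁺_μ(u)`

Elements of `(End ℂ^N)^{⊗ m} ⊗ B` are matrices over `B` whose rows and columns are indexed by
`Fin m → Fin N`, the standard basis of `(ℂ^N)^{⊗ m}`. -/

/-- The operator on `(ℂ^N)^{⊗ m}` by which an element of `ℂ[S_m]` acts; a permutation `s` permutes
the tensor factors and sends the basis vector labelled `J` to the one labelled `J ∘ s⁻¹`. -/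
def permOperator (N : ℕ) {m : ℕ} (e : MonoidAlgebra ℂ (Equiv.Perm (Fin m))) :
    Matrix (Fin m → Fin N) (Fin m → Fin N) ℂ :=
  Matrix.of fun I J => ∑ s : Equiv.Perm (Fin m), if I = J ∘ ⇑s⁻¹ then e.coeff s else 0

/-- `X_a`: the matrix `X = ∑ e_{ij} ⊗ x_{ij}` placed in the `a`-th copy of `End ℂ^N`. -/
def tensorCopy {N m : ℕ} {B : Type} [Zero B] (a : Fin m) (X : Matrix (Fin N) (Fin N) B) :
    Matrix (Fin m → Fin N) (Fin m → Fin N) B :=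
  Matrix.of fun I J => if ∀ b, b ≠ a → I b = J b then X (I a) (J a) else 0

/-- The matrix `T⁺(u + h c) = [t⁺_{ij}(u + h c)]`, where
`t⁺_{ij}(u) = δ_{ij} - h ∑_{r ≥ 0} t_{ij}^{(-(r+1))} u^r`. It is a matrix of power series in `u`
over the completed dual Yangian: expanding `(u + h c)^r`, the coefficient of `u^k` is
`δ_{ij} δ_{k0} - h ∑_{d ≥ 0} h^d binom(k+d, k) c^d t_{ij}^{(-(k+d+1))}`. -/
def DualYangian.T (N : ℕ) (c : ℤ) :
    Matrix (Fin N) (Fin N) (PowerSeries (HAdicCompletion (DualYangian N))) :=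
  Matrix.of fun i j => PowerSeries.mk fun k =>
    (if i = j ∧ k = 0 then 1 else 0)
      - (PowerSeries.X : ℂ⟦X⟧) • hSeries fun d =>
          PowerSeries.C (((k + d).choose k : ℂ) * (c : ℂ) ^ d) • DualYangian.t i j (k + d)

/-- The series `T⁺_μ(u) = tr_{1,…,m} E_U T⁺_1(u + h c_1) ⋯ T⁺_m(u + h c_m)` written with the
standard tableau `U` of shape `μ`, where `E_U` is the image of `e_U` and `c_a = c_a(U)`. -/
def DualYangian.TSeries (N : ℕ) {μ : YoungDiagram} (U : StandardTableau μ) :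
    PowerSeries (HAdicCompletion (DualYangian N)) :=
  Matrix.trace
    ((permOperator N U.idempotent).map (fun z : ℂ =>
        PowerSeries.C (algebraMap ℂ⟦X⟧ (HAdicCompletion (DualYangian N)) (PowerSeries.C z)))
      * (List.ofFn fun a : Fin μ.card =>
          tensorCopy a (DualYangian.T N (U.content a))).prod)

/-- The coefficients of all series `T⁺_μ(u)`, for all Young diagrams `μ` with at most `N` rows
(and all standard tableaux of shape `μ` that can be used to write the series). -/
def DualYangian.TCoefficients (N : ℕ) : Set (HAdicCompletion (DualYangian N)) :=
  {x | ∃ (μ : YoungDiagram) (_ : μ.colLen 0 ≤ N) (U : StandardTableau μ) (k : ℕ),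
    x = PowerSeries.coeff k (DualYangian.TSeries N U)}

end

/-! Reduction. Equality in the `h`-adic completion is tested in every quotient by `hⁿ`. It is
therefore enough to work over a ring `B` in which the Yangian relations hold and `h` is central with
`hⁿ = 0`; there the shift `u ↦ u + hc` is a finite sum. Products of a series in `u` and a series in
`v` are compared in `Two B`, that is, `B⟦u⟧⟦v⟧`.

Two traces. Let `E_U`, `E_V` be idempotents with contents `c`, `c'` acting on complementary groups
of tensor factors, and let `T`, `T'` be the ordered products of the matrices `T⁺(u + hc_a)` and
`T⁺(v + hc'_b)`. The two products of traces are `tr(E T T')` and `tr(E T' T)` with `E = E_U E_V`.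
Multiplying the `RTT` relations over all pairs gives `R T T' = T' T R`, where `R` is an ordered
product of the factors `u - v + h(c_a - c'_b) - h (a b)`. Changing the sign of the scalar part of
each factor gives `S` with `R S = S R = s`, where `s` is a product of terms `h² - (u - v + …)²`.
Such a scalar is not a zero divisor, since `u - v` is regular and `h` is nilpotent. Without `E` this
would suffice: `s tr(T T') = tr(S T' T R) = tr(R S T' T) = s tr(T' T)`, the cyclic move being
legitimate because `R` has central entries. With `E` the same computation works as soon as `E Q = E
Q E` for `Q = T, T', R, S` (`Corner`); this is `trace_mul_comm_of_intertwine`, assembled in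
`trace_fused_comm`.

Fusion. The corner property comes from `E_U T_1 ⋯ T_m = T_m ⋯ T_1 E_U`, valid both for the Yangian
series and for the Yang `R`-matrices (`FusionData.fusion`). It is proved by adding one factor at a
time with a free parameter `w` in place of the last content. The factors `w - c_a - (a k)` move
`T_k(w)` past its predecessors, and next to the idempotent of the first `k` labels their product
collapses to a multiple of `w - x_k`, with `x_k` the Jucys–Murphy element (`jointProj_chain`).
Specializing `w` at the eigenvalue `c_k` then produces the spectral projection of `x_k` (`ev_proj`).

Spectrum. All this needs `x_k` to be diagonalizable with integer eigenvalues of absolute value less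
than `m`. That is `aeval_jm`, which rests on the relation between consecutive Jucys–Murphy elements
and on positivity of the canonical trace of the group algebra. -/

noncomputable section

namespace YangianFusion

section

open Polynomial

/-! ### Jucys–Murphy elements -/

section GroupAlgebra

variable {m : ℕ} (g : ℕ → Fin m)

/-- The transposition of the labels `g a` and `g b` in the group algebra. -/
def swapElt (a b : ℕ) : MonoidAlgebra ℂ (Equiv.Perm (Fin m)) :=
  MonoidAlgebra.of ℂ (Equiv.Perm (Fin m)) (Equiv.swap (g a) (g b))

/-- The sum of the transpositions `(a j)` over `a < k`. -/
def swapSum (k j : ℕ) : MonoidAlgebra ℂ (Equiv.Perm (Fin m)) :=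
  ∑ a ∈ Finset.range k, swapElt g a j

theorem swapElt_mul_self (a b : ℕ) : swapElt g a b * swapElt g a b = 1 := by
  rw [swapElt, ← map_mul, Equiv.swap_mul_self, map_one]

theorem swapSum_succ (k j : ℕ) : swapSum g (k + 1) j = swapSum g k j + swapElt g k j :=
  Finset.sum_range_succ _ _

variable {g}

theorem label_ne (hg : ∀ a < m, (g a).val = a) {a b : ℕ} (ha : a < m) (hb : b < m) (hab : a ≠ b) :
    g a ≠ g b := fun h => hab (by rw [← hg a ha, ← hg b hb, h])

theorem swapElt_mul_swapElt (hg : ∀ a < m, (g a).val = a) {a b c : ℕ} (ha : a < m) (hb : b < m)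
    (hc : c < m) (hab : a ≠ b) (hac : a ≠ c) (hbc : b ≠ c) :
    swapElt g b c * swapElt g a c = swapElt g a b * swapElt g b c := by
  have h1 := label_ne hg ha hb hab
  have h2 := label_ne hg ha hc hac
  have h3 := label_ne hg hb hc hbc
  simp only [swapElt, ← map_mul]
  congr 1
  rw [Equiv.swap_comm (g a) (g c), Equiv.mul_swap_eq_swap_mul]
  simp [Equiv.swap_apply_of_ne_of_ne h1 h2, Equiv.swap_comm]

theorem swapElt_commute (hg : ∀ a < m, (g a).val = a) {a b c d : ℕ} (ha : a < m) (hb : b < m)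
    (hc : c < m) (hd : d < m) (hac : a ≠ c) (had : a ≠ d) (hbc : b ≠ c) (hbd : b ≠ d) :
    Commute (swapElt g a b) (swapElt g c d) := by
  have h1 := label_ne hg ha hc hac
  have h2 := label_ne hg ha hd had
  have h3 := label_ne hg hb hc hbc
  have h4 := label_ne hg hb hd hbd
  simp only [Commute, SemiconjBy, swapElt, ← map_mul]
  congr 1
  rw [Equiv.mul_swap_eq_swap_mul, Equiv.swap_apply_of_ne_of_ne h1.symm h3.symm,
    Equiv.swap_apply_of_ne_of_ne h2.symm h4.symm]

/-- Conjugation by `(a b)` with `a, b < k` only permutes the summands `(c j)`, `c < k`. -/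
theorem swapElt_commute_swapSum (hg : ∀ a < m, (g a).val = a) {a b k j : ℕ} (hab : a < b)
    (hb : b < k) (hk : k ≤ j) (hj : j < m) : Commute (swapElt g a b) (swapSum g k j) := by
  have key : ∀ c ∈ Finset.range k,
      swapElt g a b * swapElt g c j = swapElt g (Equiv.swap a b c) j * swapElt g a b := by
    intro c hc
    have hc := Finset.mem_range.1 hc
    have e : g (Equiv.swap a b c) = Equiv.swap (g a) (g b) (g c) := by
      rcases eq_or_ne c a with rfl | h
      · simp
      rcases eq_or_ne c b with rfl | h'
      · simp
      rw [Equiv.swap_apply_of_ne_of_ne h h', Equiv.swap_apply_of_ne_of_ne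
        (label_ne hg (by omega) (by omega) h) (label_ne hg (by omega) (by omega) h')]
    simp only [swapElt, ← map_mul]
    congr 1
    rw [Equiv.mul_swap_eq_swap_mul, e, Equiv.swap_apply_of_ne_of_ne (a := g a) (x := g j)
      (label_ne hg (by omega) (by omega) (by omega)) (label_ne hg (by omega) (by omega) (by omega))]
  simp only [Commute, SemiconjBy, swapSum]
  rw [Finset.mul_sum, Finset.sum_mul, Finset.sum_congr rfl key]
  refine Finset.sum_equiv (Equiv.swap a b) (fun c => ?_) (fun c _ => rfl)
  simp only [Finset.mem_range]
  rcases eq_or_ne c a with rfl | h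
  · simp; omega
  rcases eq_or_ne c b with rfl | h'
  · simp; omega
  rw [Equiv.swap_apply_of_ne_of_ne h h']

/-- The Jucys–Murphy element `∑_{a < k} (a k)`. -/
abbrev jm (g : ℕ → Fin m) (k : ℕ) : MonoidAlgebra ℂ (Equiv.Perm (Fin m)) := swapSum g k k

theorem jm_commute_of_lt (hg : ∀ a < m, (g a).val = a) {i j : ℕ} (hij : i < j) (hj : j < m) :
    Commute (jm g i) (jm g j) :=
  Commute.sum_left _ _ _ fun _ ha =>
    swapElt_commute_swapSum hg (Finset.mem_range.1 ha) hij le_rfl hj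

theorem jm_commute (hg : ∀ a < m, (g a).val = a) {i j : ℕ} (hi : i < m) (hj : j < m) :
    Commute (jm g i) (jm g j) := by
  rcases lt_trichotomy i j with h | rfl | h
  · exact jm_commute_of_lt hg h hj
  · exact Commute.refl _
  · exact (jm_commute_of_lt hg h hi).symm

theorem swapElt_mul_swapSum (hg : ∀ a < m, (g a).val = a) {k j : ℕ} (hk : k < j) (hj : j < m) :
    swapElt g k j * swapSum g k j = jm g k * swapElt g k j := by
  rw [swapSum, jm, swapSum, Finset.mul_sum, Finset.sum_mul]
  refine Finset.sum_congr rfl fun a ha => ?_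
  have := Finset.mem_range.1 ha
  exact swapElt_mul_swapElt hg (by omega) (by omega) hj (by omega) (by omega) (by omega)

/-- The relation of the degenerate affine Hecke algebra: conjugating `x_k` by `(k k+1)` gives every
summand of `x_{k+1}` except that transposition itself. -/
theorem jm_succ (hg : ∀ a < m, (g a).val = a) {k : ℕ} (hk : k + 1 < m) :
    jm g (k + 1) * swapElt g k (k + 1) = swapElt g k (k + 1) * jm g k + 1 := by
  have h := swapElt_mul_swapSum hg (Nat.lt_succ_self k) hk
  have h1 := swapElt_mul_self g k (k + 1)
  have h2 : swapSum g k (k + 1) * swapElt g k (k + 1) = swapElt g k (k + 1) * jm g k := by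
    calc _ = swapElt g k (k+1) * (swapElt g k (k+1) * swapSum g k (k + 1)) * swapElt g k (k + 1) := by
            rw [← mul_assoc (swapElt g k (k+1)), h1, one_mul]
      _ = _ := by rw [h, mul_assoc, mul_assoc (jm g k), h1, mul_one]
  rw [jm, swapSum_succ, add_mul, h2, h1]

/-! ### Self-adjoint elements -/

/-- Self-adjointness for the involution `∑ a_s s ↦ ∑ conj(a_s) s⁻¹`. -/
def IsSelfAdj (A : MonoidAlgebra ℂ (Equiv.Perm (Fin m))) : Prop :=
  ∀ s, A.coeff s⁻¹ = starRingEnd ℂ (A.coeff s)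

theorem coeff_mul_eq_sum (A B : MonoidAlgebra ℂ (Equiv.Perm (Fin m))) (s : Equiv.Perm (Fin m)) :
    (A * B).coeff s = ∑ x, A.coeff x * B.coeff (x⁻¹ * s) := by
  rw [MonoidAlgebra.coeff_mul_apply_left, Finsupp.sum_fintype]
  simp

theorem IsSelfAdj.mul {A B : MonoidAlgebra ℂ (Equiv.Perm (Fin m))} (hA : IsSelfAdj A)
    (hB : IsSelfAdj B) (h : Commute A B) : IsSelfAdj (A * B) := by
  intro s
  nth_rewrite 2 [h.eq]
  rw [coeff_mul_eq_sum, coeff_mul_eq_sum, map_sum]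
  refine Fintype.sum_equiv (Equiv.mulLeft s) _ _ fun x => ?_
  have h1 := hA x⁻¹
  have h2 := hB (s * x)
  rw [inv_inv] at h1
  rw [mul_inv_rev] at h2
  simp only [Equiv.coe_mulLeft, map_mul]
  rw [h1, h2, mul_inv_rev, inv_mul_cancel_right, mul_comm]

theorem IsSelfAdj.add {A B : MonoidAlgebra ℂ (Equiv.Perm (Fin m))} (hA : IsSelfAdj A)
    (hB : IsSelfAdj B) : IsSelfAdj (A + B) := fun s => by simp [hA s, hB s]

theorem isSelfAdj_swapSum (k j : ℕ) : IsSelfAdj (swapSum g k j) := by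
  unfold swapSum
  refine Finset.sum_induction _ IsSelfAdj (fun _ _ => IsSelfAdj.add) (fun s => by simp) ?_
  intro a _ s
  simp only [swapElt, MonoidAlgebra.of_apply, MonoidAlgebra.coeff_single, Finsupp.single_apply]
  have : (Equiv.swap (g a) (g j) = s⁻¹) ↔ (Equiv.swap (g a) (g j) = s) := by
    rw [eq_comm, inv_eq_iff_eq_inv, Equiv.swap_inv, eq_comm]
  simp [this]

theorem isSelfAdj_algebraMap (c : ℤ) :
    IsSelfAdj (algebraMap ℂ (MonoidAlgebra ℂ (Equiv.Perm (Fin m))) (c : ℂ)) := by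
  intro s
  simp only [MonoidAlgebra.coe_algebraMap, Function.comp, MonoidAlgebra.coeff_single,
    Finsupp.single_apply]
  have : (1 = s⁻¹) ↔ (1 = s) := by rw [eq_comm, inv_eq_one, eq_comm]
  simp only [this]
  split_ifs <;> simp

/-- For self-adjoint `A` the coefficient of the identity in `A²` is the sum of the squared moduli of
the coefficients of `A`. -/
theorem eq_zero_of_isSelfAdj {A : MonoidAlgebra ℂ (Equiv.Perm (Fin m))} (hA : IsSelfAdj A)
    (h : A * A = 0) : A = 0 := by
  have h1 : (A * A).coeff 1 = 0 := by rw [h]; rfl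
  rw [coeff_mul_eq_sum] at h1
  have h2 : ∑ x, Complex.normSq (A.coeff x) = 0 := by
    have : ((∑ x, Complex.normSq (A.coeff x) : ℝ) : ℂ) = 0 := by
      rw [← h1, Complex.ofReal_sum]
      refine Finset.sum_congr rfl fun x _ => ?_
      rw [mul_one, hA, Complex.mul_conj]
    exact_mod_cast this
  rw [Finset.sum_eq_zero_iff_of_nonneg fun _ _ => Complex.normSq_nonneg _] at h2
  ext s
  simpa using h2 s (Finset.mem_univ s)

/-! ### The spectrum of the Jucys–Murphy elements -/

/-- The polynomial with simple roots at the integers of `s`. -/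
abbrev rootPoly (s : Finset ℤ) : ℂ[X] := Lagrange.nodal s (fun c : ℤ => (c : ℂ))

theorem isSelfAdj_aeval_rootPoly {x : MonoidAlgebra ℂ (Equiv.Perm (Fin m))} (hx : IsSelfAdj x)
    (s : Finset ℤ) : IsSelfAdj (aeval x (rootPoly s)) := by
  classical
  induction s using Finset.induction_on with
  | empty =>
    have := isSelfAdj_algebraMap (m := m) 1
    rw [Int.cast_one, map_one] at this
    rwa [rootPoly, Lagrange.nodal_empty, map_one]
  | insert c s hc ih =>
    rw [rootPoly, Lagrange.nodal_insert_eq_nodal hc, map_mul]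
    refine IsSelfAdj.mul ?_ ih ?_
    · rw [map_sub, aeval_X, aeval_C, sub_eq_add_neg, ← map_neg]
      have := isSelfAdj_algebraMap (m := m) (-c)
      rw [Int.cast_neg] at this
      exact hx.add this
    · rw [Commute, SemiconjBy, ← map_mul, ← map_mul, mul_comm]

/-! ### Spectral projections of an element annihilated by a polynomial with simple integer roots -/

section Projections

variable {A : Type*} [Ring A] [Algebra ℂ A] {s : Finset ℤ} {x : A}

/-- The spectral projection of `x` for the eigenvalue `c`, given that the spectrum of `x` lies
in `s`. -/
abbrev proj (s : Finset ℤ) (x : A) (c : ℤ) : A :=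
  aeval x (Lagrange.basis s (fun c : ℤ => (c : ℂ)) c)

theorem proj_eq (s : Finset ℤ) (c : ℤ) : ∃ z : ℂ,
    Lagrange.basis s (fun c : ℤ => (c : ℂ)) c = C z * rootPoly (s.erase c) := by
  refine ⟨∏ d ∈ s.erase c, ((c : ℂ) - d)⁻¹, ?_⟩
  simp only [Lagrange.basis, Lagrange.basisDivisor, Lagrange.nodal, Finset.prod_mul_distrib,
    map_prod]

/-- Outside `s` the Lagrange product runs over all of `s`, hence is a multiple of the annihilating
polynomial. Thanks to this default value the lemmas below hold for every integer `c`, and no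
admissibility of contents has to be carried along. -/
theorem proj_eq_zero (hx : aeval x (rootPoly s) = 0) {c : ℤ} (hc : c ∉ s) : proj s x c = 0 := by
  obtain ⟨z, hz⟩ := proj_eq s c
  rw [proj, hz, Finset.erase_eq_of_notMem hc, map_mul, hx, mul_zero]

theorem mul_proj (hx : aeval x (rootPoly s) = 0) (c : ℤ) :
    x * proj s x c = algebraMap ℂ A c * proj s x c := by
  by_cases hc : c ∈ s
  · obtain ⟨z, hz⟩ := proj_eq s c
    have h : (X - C (c : ℂ)) * Lagrange.basis s (fun c : ℤ => (c : ℂ)) c = C z * rootPoly s := by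
      rw [hz, rootPoly, rootPoly, Lagrange.nodal_eq_mul_nodal_erase hc]
      ring
    have := congrArg (aeval x) h
    rw [map_mul, map_mul, hx, mul_zero, map_sub, aeval_X, aeval_C, sub_mul, sub_eq_zero] at this
    exact this
  · rw [proj_eq_zero hx hc, mul_zero, mul_zero]

theorem proj_mul (hx : aeval x (rootPoly s) = 0) (c : ℤ) :
    proj s x c * x = algebraMap ℂ A c * proj s x c := by
  rw [← mul_proj hx]
  nth_rewrite 2 [← aeval_X (R := ℂ) x]
  nth_rewrite 3 [← aeval_X (R := ℂ) x]
  rw [proj, ← map_mul, ← map_mul, mul_comm]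

theorem aeval_mul_proj (hx : aeval x (rootPoly s) = 0) (c : ℤ) (f : ℂ[X]) :
    aeval x f * proj s x c = algebraMap ℂ A (f.eval (c : ℂ)) * proj s x c := by
  induction f using Polynomial.induction_on' with
  | add p q hp hq => simp only [map_add, add_mul, hp, hq, eval_add]
  | monomial n z =>
    rw [← C_mul_X_pow_eq_monomial, map_mul, aeval_C, eval_mul, eval_C, map_mul, mul_assoc,
      mul_assoc]
    congr 1
    rw [map_pow, aeval_X, eval_pow, eval_X]
    induction n with
    | zero => simp
    | succ n ih =>
      rw [pow_succ, mul_assoc, mul_proj hx, ← mul_assoc, ← Algebra.commutes, mul_assoc, ih,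
        ← mul_assoc, ← map_mul, pow_succ']

theorem proj_mul_self (hx : aeval x (rootPoly s) = 0) (c : ℤ) :
    proj s x c * proj s x c = proj s x c := by
  by_cases hc : c ∈ s
  · rw [proj, aeval_mul_proj hx, Lagrange.eval_basis_self (v := fun c : ℤ => (c : ℂ))
      (fun _ _ _ _ h => Int.cast_injective h) hc, map_one, one_mul]
  · rw [proj_eq_zero hx hc, mul_zero]

theorem sum_proj (hs : s.Nonempty) (x : A) : ∑ c ∈ s, proj s x c = 1 := by
  rw [← map_sum, Lagrange.sum_basis (fun _ _ _ _ h => Int.cast_injective h) hs, map_one]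

end Projections

theorem aeval_mul_of_semiconj {A : Type*} [Ring A] [Algebra ℂ A] {φ x y : A}
    (h : φ * x = y * φ) (f : ℂ[X]) : φ * aeval x f = aeval y f * φ := by
  induction f using Polynomial.induction_on' with
  | add p q hp hq => simp only [map_add, mul_add, add_mul, hp, hq]
  | monomial n z =>
    rw [← C_mul_X_pow_eq_monomial]
    simp only [map_mul, map_pow, aeval_X, aeval_C]
    rw [← mul_assoc, ← Algebra.commutes, mul_assoc, mul_assoc]
    congr 1
    exact (show SemiconjBy φ x y from h).pow_right n

/-- The transposition `t` carries `x` to `y` only up to the inhomogeneous term 1; the correction `t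
(x - y) + 1` absorbs it and intertwines exactly. Its square is a polynomial in `x - y`, which limits
how far the eigenvalues of `y` can be from those of `x`. -/
theorem intertwiner {A : Type*} [Ring A] {t x y : A} (htt : t * t = 1) (h1 : y * t = t * x + 1)
    (hxy : x * y = y * x) :
    (t * (x - y) + 1) * x = y * (t * (x - y) + 1) ∧
      (t * (x - y) + 1) * (t * (x - y) + 1) = 1 - (x - y) * (x - y) := by
  have h2 : t * y = x * t + 1 := by
    calc t * y = t * (y * t) * t := by rw [mul_assoc, mul_assoc, htt, mul_one]
      _ = _ := by rw [h1, mul_add, ← mul_assoc, htt, one_mul, mul_one, add_mul, htt]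
  have e1 : t * x = y * t - 1 := by rw [h1, add_sub_cancel_right]
  have e2 : t * (x - y) = (y - x) * t - 1 - 1 := by rw [mul_sub, e1, h2]; noncomm_ring
  constructor
  · have : t * (x - y) * x = t * x * (x - y) := by
      rw [mul_assoc, sub_mul, ← hxy, ← mul_sub, ← mul_assoc]
    rw [add_mul, this, e1]
    noncomm_ring
  · calc _ = ((y - x) * t - 1) * (t * (x - y) + 1) := by
          nth_rewrite 1 [e2]; noncomm_ring
      _ = (y - x) * (t * t) * (x - y) + ((y - x) * t - 1 - 1) - t * (x - y) + 1 := by noncomm_ring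
      _ = _ := by rw [← e2, htt]; noncomm_ring

/-- Induction on `k`: by the intertwiner, on the eigenspace of `x_k` for `c` the eigenvalues of
`x_{k+1}` are eigenvalues allowed for `x_k`, or `c + 1`, or `c - 1`. The bound on the absolute value
thus grows by one. -/
theorem aeval_jm (hg : ∀ a < m, (g a).val = a) (k : ℕ) (hk : k < m) :
    aeval (jm g k) (rootPoly (Finset.Ioo (-(k + 1 : ℤ)) (k + 1))) = 0 := by
  induction k with
  | zero =>
    have : Finset.Ioo (-((0 : ℕ) + 1 : ℤ)) ((0 : ℕ) + 1) = {0} := by decide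
    rw [this]
    simp [rootPoly, Lagrange.nodal, jm, swapSum]
  | succ k ih =>
    have ih := ih (by omega)
    set q := rootPoly (Finset.Ioo (-(k + 1 : ℤ)) (k + 1))
    set r := rootPoly (Finset.Ioo (-((k + 1 : ℕ) + 1 : ℤ)) ((k + 1 : ℕ) + 1))
    set x := jm g k with hx
    set y := jm g (k + 1) with hy
    set t := swapElt g k (k + 1)
    have htt : t * t = 1 := swapElt_mul_self g _ _
    have h1 : y * t = t * x + 1 := jm_succ hg hk
    have hxy : x * y = y * x := jm_commute hg (by omega) hk
    obtain ⟨h3, h4⟩ := intertwiner htt h1 hxy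
    have h5 : aeval y q * (1 - (x - y) * (x - y)) = 0 := by
      rw [← h4, ← mul_assoc, ← aeval_mul_of_semiconj h3, ih, mul_zero, zero_mul]
    -- On the eigenspace of `x` for `c`, `h5` reads `q(y) (y - c - 1)(y - c + 1) = 0`. Both `q` and
    -- the quadratic factor divide `r`, but they may share roots, so only `r²` is seen to annihilate
    -- `y`. Self-adjointness of `r(y)` removes the square.
    have hr : aeval y (r * r) = 0 := by
      rw [← mul_one (aeval y (r * r)), ← sum_proj (s := Finset.Ioo (-(k + 1 : ℤ)) (k + 1))
        ⟨0, by simp; omega⟩ x, Finset.mul_sum]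
      refine Finset.sum_eq_zero fun c hc => ?_
      rw [Finset.mem_Ioo] at hc
      set p := proj (Finset.Ioo (-(k + 1 : ℤ)) (k + 1)) x c
      have hxp : x * p = algebraMap ℂ _ (c : ℂ) * p := mul_proj ih c
      have hd : ((X - C ((c + 1 : ℤ) : ℂ)) * (X - C ((c - 1 : ℤ) : ℂ))) ∣ r := by
        rw [← Finset.prod_pair (f := fun d : ℤ => (X - C (d : ℂ))) (by omega)]
        refine Finset.prod_dvd_prod_of_subset _ _ _ fun d hd => ?_
        simp only [Finset.mem_insert, Finset.mem_singleton] at hd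
        rw [Finset.mem_Ioo]
        push_cast
        omega
      have hd' : q ∣ r := by
        refine Finset.prod_dvd_prod_of_subset _ _ _ fun d hd => ?_
        rw [Finset.mem_Ioo] at hd ⊢
        push_cast
        omega
      obtain ⟨f, hf⟩ := mul_dvd_mul hd' hd
      rw [hf, mul_comm, map_mul, mul_assoc]
      have : aeval y (q * ((X - C ((c + 1 : ℤ) : ℂ)) * (X - C ((c - 1 : ℤ) : ℂ)))) * p = 0 := by
        have e2 : (1 - (x - y) * (x - y)) * p
            = - (aeval y ((X - C ((c + 1 : ℤ) : ℂ)) * (X - C ((c - 1 : ℤ) : ℂ)))) * p := by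
          have e3 : (x - y) * p = (algebraMap ℂ _ (c : ℂ) - y) * p := by rw [sub_mul, hxp, sub_mul]
          have e4 : Commute (x - y) (algebraMap ℂ _ (c : ℂ) - y) :=
            (show Commute (x - y) _ from (Algebra.commutes (c : ℂ) (x - y)).symm).sub_right
              ((show Commute x y from hxy).sub_left (Commute.refl _))
          rw [sub_mul, mul_assoc, e3, ← mul_assoc, e4.eq, mul_assoc, e3]
          have : (algebraMap ℂ (MonoidAlgebra ℂ (Equiv.Perm (Fin m))) (c : ℂ) - y)
              = aeval y (C (c : ℂ) - X) := by simp
          rw [this, ← mul_assoc, ← map_mul, ← sub_mul, ← map_neg, ← map_one (aeval (R := ℂ) y), ← map_sub]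
          congr 2
          push_cast
          simp only [map_add, map_sub, map_one]
          ring
        rw [map_mul, mul_assoc, ← neg_neg (aeval y ((X - _) * _)), neg_mul, ← e2, mul_neg,
          ← mul_assoc, h5, zero_mul, neg_zero]
      rw [this, mul_zero]
    rw [map_mul] at hr
    exact eq_zero_of_isSelfAdj (isSelfAdj_aeval_rootPoly (isSelfAdj_swapSum _ _) _) hr

/-- The spectrum of every Jucys–Murphy element lies in `{-m+1, …, m-1}`. -/
theorem aeval_jm_eq_zero (hg : ∀ a < m, (g a).val = a) {k : ℕ} (hk : k < m) :
    aeval (jm g k) (rootPoly (Finset.Ioo (-(m : ℤ)) m)) = 0 := by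
  have h : rootPoly (Finset.Ioo (-(k + 1 : ℤ)) (k + 1)) ∣ rootPoly (Finset.Ioo (-(m : ℤ)) m) :=
    Finset.prod_dvd_prod_of_subset _ _ _ fun d hd => by
      rw [Finset.mem_Ioo] at hd ⊢
      omega
  obtain ⟨f, hf⟩ := h
  rw [hf, map_mul, aeval_jm hg k hk, zero_mul]

end GroupAlgebra

end

section

open Polynomial

/-! ### Ordered products -/

section OrderedProducts

variable {M : Type*} [Monoid M]

/-- The product `f 0 * f 1 * ⋯ * f (k - 1)`. -/
def prodUp (f : ℕ → M) : ℕ → M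
  | 0 => 1
  | k + 1 => prodUp f k * f k

/-- The product `f (k - 1) * ⋯ * f 1 * f 0`. -/
def prodDown (f : ℕ → M) : ℕ → M
  | 0 => 1
  | k + 1 => f k * prodDown f k

theorem prodUp_zero (f : ℕ → M) : prodUp f 0 = 1 := rfl

theorem prodDown_zero (f : ℕ → M) : prodDown f 0 = 1 := rfl

theorem prodUp_succ (f : ℕ → M) (k : ℕ) : prodUp f (k + 1) = prodUp f k * f k := rfl

theorem prodDown_succ (f : ℕ → M) (k : ℕ) : prodDown f (k + 1) = f k * prodDown f k := rfl

theorem prodUp_commute {f : ℕ → M} {k : ℕ} {z : M} (h : ∀ a < k, Commute (f a) z) :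
    Commute (prodUp f k) z := by
  induction k with
  | zero => exact Commute.one_left z
  | succ k ih => exact (ih fun a ha => h a (by omega)).mul_left (h k (by omega))

theorem prodDown_commute {f : ℕ → M} {k : ℕ} {z : M} (h : ∀ a < k, Commute (f a) z) :
    Commute (prodDown f k) z := by
  induction k with
  | zero => exact Commute.one_left z
  | succ k ih => exact (h k (by omega)).mul_left (ih fun a ha => h a (by omega))

theorem map_prodUp {M' F : Type*} [Monoid M'] [FunLike F M M'] [MonoidHomClass F M M'] (φ : F)
    (f : ℕ → M) (k : ℕ) : φ (prodUp f k) = prodUp (fun a => φ (f a)) k := by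
  induction k with
  | zero => exact map_one φ
  | succ k ih => rw [prodUp_succ, prodUp_succ, map_mul, ih]

theorem prod_ofFn_eq_prodUp {k : ℕ} (F : Fin k → M) (f : ℕ → M) (h : ∀ a, F a = f a) :
    (List.ofFn F).prod = prodUp f k := by
  induction k with
  | zero => simp [prodUp_zero]
  | succ k ih =>
    rw [List.ofFn_succ', List.concat_eq_append, List.prod_append, List.prod_singleton,
      ih _ fun a => h a.castSucc, prodUp_succ, h]
    rfl

end OrderedProducts

/-! ### Joint spectral projections -/

section Idempotents

variable {m : ℕ} {g : ℕ → Fin m}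

/-- The joint spectral projection for the eigenvalues `c 0, …, c (k - 1)` of the first `k`
Jucys–Murphy elements. -/
def jointProj (g : ℕ → Fin m) (c : ℕ → ℤ) (k : ℕ) : MonoidAlgebra ℂ (Equiv.Perm (Fin m)) :=
  prodUp (fun a => proj (Finset.Ioo (-(m : ℤ)) m) (jm g a) (c a)) k

theorem map_aeval_commute {A M : Type*} [Ring A] [Algebra ℂ A] [Ring M] (Φ : A →+* M)
    (hΦ : ∀ (a : ℂ) (y : M), Commute (Φ (algebraMap ℂ A a)) y) {x : A} {z : M}
    (h : Commute (Φ x) z) (f : ℂ[X]) : Commute (Φ (aeval x f)) z := by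
  induction f using Polynomial.induction_on' with
  | add p q hp hq => simpa only [map_add] using hp.add_left hq
  | monomial n a =>
    rw [← C_mul_X_pow_eq_monomial]
    simp only [map_mul, map_pow, aeval_X, aeval_C]
    exact (hΦ a z).mul_left (h.pow_left n)

/-- The projection is a polynomial in the transpositions of the first `k` labels, so commutation
need only be tested on those. The condition `hΦ` takes the place of linearity, since `Φ` is only a
ring homomorphism. -/
theorem map_jointProj_commute {M : Type*} [Ring M]
    (Φ : MonoidAlgebra ℂ (Equiv.Perm (Fin m)) →+* M)
    (hΦ : ∀ (a : ℂ) (y : M), Commute (Φ (algebraMap ℂ _ a)) y) (c : ℕ → ℤ) {k : ℕ} {z : M}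
    (h : ∀ a b, a < b → b < k → Commute (Φ (swapElt g a b)) z) :
    Commute (Φ (jointProj g c k)) z := by
  rw [jointProj, map_prodUp]
  refine prodUp_commute fun b hb => map_aeval_commute Φ hΦ ?_ _
  rw [jm, swapSum, map_sum]
  exact Commute.sum_left _ _ _ fun a ha => h a b (Finset.mem_range.1 ha) hb

theorem jointProj_commute (c : ℕ → ℤ) {k : ℕ} {z : MonoidAlgebra ℂ (Equiv.Perm (Fin m))}
    (h : ∀ a b, a < b → b < k → Commute (swapElt g a b) z) :
    Commute (jointProj g c k) z :=
  map_jointProj_commute (RingHom.id _) (fun a y => Algebra.commutes a y) c h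

theorem jointProj_succ (c : ℕ → ℤ) (k : ℕ) : jointProj g c (k + 1) =
    jointProj g c k * proj (Finset.Ioo (-(m : ℤ)) m) (jm g k) (c k) := rfl

theorem jointProj_commute_jm (hg : ∀ a < m, (g a).val = a) (c : ℕ → ℤ) {k : ℕ} (hk : k < m) :
    Commute (jointProj g c k) (jm g k) :=
  jointProj_commute c fun _ _ hab hb => swapElt_commute_swapSum hg hab hb le_rfl hk

theorem jointProj_commute_proj (hg : ∀ a < m, (g a).val = a) (c : ℕ → ℤ) {k : ℕ} (hk : k < m)
    (d : ℤ) : Commute (jointProj g c k) (proj (Finset.Ioo (-(m : ℤ)) m) (jm g k) d) :=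
  (map_aeval_commute (RingHom.id (MonoidAlgebra ℂ (Equiv.Perm (Fin m))))
    (fun a y => Algebra.commutes a y) (jointProj_commute_jm hg c hk).symm _).symm

theorem jointProj_mul_self (hg : ∀ a < m, (g a).val = a) (c : ℕ → ℤ) {k : ℕ} (hk : k ≤ m) :
    jointProj g c k * jointProj g c k = jointProj g c k := by
  induction k with
  | zero => exact one_mul 1
  | succ k ih =>
    have h := jointProj_commute_proj hg c hk (c k)
    rw [jointProj_succ, mul_assoc, ← mul_assoc _ (jointProj g c k), ← h.eq, mul_assoc,
      proj_mul_self (aeval_jm_eq_zero hg hk), ← mul_assoc, ih (by omega)]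

theorem jointProj_succ_mul (hg : ∀ a < m, (g a).val = a) (c : ℕ → ℤ) {k : ℕ} (hk : k < m) :
    jointProj g c (k + 1) * jointProj g c k = jointProj g c (k + 1) := by
  rw [jointProj_succ, mul_assoc, ← (jointProj_commute_proj hg c hk (c k)).eq, ← mul_assoc,
    jointProj_mul_self hg c hk.le]

theorem jointProj_succ_mul_jm (hg : ∀ a < m, (g a).val = a) (c : ℕ → ℤ) {k : ℕ} (hk : k < m) :
    jointProj g c (k + 1) * jm g k = c k • jointProj g c (k + 1) := by
  rw [jointProj_succ, mul_assoc, proj_mul (aeval_jm_eq_zero hg hk), map_intCast,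
    ← mul_assoc, ← (Int.cast_commute (c k) (jointProj g c k)).eq, mul_assoc, zsmul_eq_mul]

end Idempotents

/-! ### The fusion theorem -/

section Fusion

variable {m : ℕ} {g : ℕ → Fin m}

/-- A one-parameter family of intertwining matrices. The ring `M'` consists of functions of a
parameter `w` with values in the ring `M`, and `T a` is the matrix in the tensor factor `a`. -/
structure FusionData (g : ℕ → Fin m) (Z M M' : Type*) [CommRing Z] [Ring M] [Ring M'] [Algebra Z M']
    where
  perm : MonoidAlgebra ℂ (Equiv.Perm (Fin m)) →+* M
  perm' : MonoidAlgebra ℂ (Equiv.Perm (Fin m)) →+* M'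
  const : M →+* M'
  ev : ℤ → M' →+* M
  w : Z
  const_perm : ∀ x, const (perm x) = perm' x
  ev_const : ∀ c x, ev c (const x) = x
  ev_w : ∀ c, ev c (algebraMap Z M' w) = c
  reg : ∀ (c : ℤ) (y : M'), (w - c) • y = 0 → y = 0
  reg_int : ∀ (c : ℤ) (y : M), c ≠ 0 → c • y = 0 → y = 0
  perm_scalar : ∀ (a : ℂ) (y : M'), Commute (perm' (algebraMap ℂ _ a)) y
  T : ℕ → M'
  comm : ∀ a b d, a < m → b < m → d < m → a ≠ b → a ≠ d → b ≠ d →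
    Commute (perm' (swapElt g a b)) (T d)
  rel : ∀ a b, a < b → b < m → ∀ c : ℤ,
    const (ev c (T a)) * T b * ((w - c) • 1 - perm' (swapElt g a b))
      = ((w - c) • 1 - perm' (swapElt g a b)) * T b * const (ev c (T a))

namespace FusionData

variable {Z M M' : Type*} [CommRing Z] [Ring M] [Ring M'] [Algebra Z M'] (D : FusionData g Z M M')

theorem ev_perm' (c : ℤ) (x) : D.ev c (D.perm' x) = D.perm x := by
  rw [← D.const_perm, D.ev_const]

theorem ev_smul (c d : ℤ) (y : M') : D.ev c ((D.w - d) • y) = (c - d) • D.ev c y := by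
  rw [Algebra.smul_def, map_mul, map_sub, map_sub, D.ev_w, map_intCast, map_intCast, zsmul_eq_mul,
    Int.cast_sub]

/-- The product of the factors `w - c a - (a k)` for `a = j - 1, …, 0`. -/
def chain (c : ℕ → ℤ) (k j : ℕ) : M' :=
  prodDown (fun a => (D.w - c a) • (1 : M') - D.perm' (swapElt g a k)) j

theorem comm_const (c : ℤ) {a b d : ℕ} (ha : a < m) (hb : b < m)
    (hd : d < m) (hab : a ≠ b) (had : a ≠ d) (hbd : b ≠ d) :
    Commute (D.perm' (swapElt g a b)) (D.const (D.ev c (D.T d))) := by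
  have := ((D.comm a b d ha hb hd hab had hbd).map (D.ev c)).map D.const
  rwa [D.ev_perm', D.const_perm] at this

theorem smul_one_sub_commute (z : Z) {p y : M'} (h : Commute p y) :
    Commute (z • (1 : M') - p) y :=
  ((Commute.one_left y).smul_left z).sub_left h

/-- The matrix with free parameter is moved past its predecessors one at a time by `D.rel`; the
other factors act on disjoint tensor positions and commute out of the way. -/
theorem mul_chain (c : ℕ → ℤ) {k : ℕ} (hk : k < m) {j : ℕ}
    (hj : j ≤ k) :
    prodUp (fun a => D.const (D.ev (c a) (D.T a))) j * D.T k * D.chain c k j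
      = D.chain c k j * D.T k * prodUp (fun a => D.const (D.ev (c a) (D.T a))) j := by
  induction j with
  | zero => simp [chain, prodUp_zero, prodDown_zero]
  | succ j ih =>
    have ih := ih (by omega)
    have e : D.chain c k (j + 1)
        = ((D.w - c j) • (1 : M') - D.perm' (swapElt g j k)) * D.chain c k j := rfl
    rw [e, prodUp_succ]
    set f := (D.w - c j) • (1 : M') - D.perm' (swapElt g j k)
    set tj := D.const (D.ev (c j) (D.T j))
    set P := prodUp (fun a => D.const (D.ev (c a) (D.T a))) j
    have h1 : tj * D.T k * f = f * D.T k * tj := D.rel j k (by omega) hk (c j)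
    have h2 : Commute P f := prodUp_commute fun a ha =>
      (smul_one_sub_commute _ (D.comm_const _ (by omega) hk (by omega) (by omega) (by omega)
        (by omega))).symm
    have h3 : Commute (D.chain c k j) tj := prodDown_commute fun a ha =>
      smul_one_sub_commute _ (D.comm_const _ (by omega) hk (by omega) (by omega) (by omega)
        (by omega))
    calc P * tj * D.T k * (f * D.chain c k j)
        = P * (tj * D.T k * f) * D.chain c k j := by noncomm_ring
      _ = (P * f) * D.T k * (tj * D.chain c k j) := by rw [h1]; noncomm_ring
      _ = f * (P * D.T k * D.chain c k j) * tj := by rw [h2.eq, ← h3.eq]; noncomm_ring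
      _ = _ := by rw [ih]; noncomm_ring

/-- Formally, `E · chain = (∏ (w - c_a) / w) · E · (w - ∑ (a k))`, with the denominator cleared. The
induction step uses that `(j k) ∑_{a<j} (a k) = x_j (j k)` and that the enlarged projection turns
`x_j` into `c_j`, so the quadratic terms collapse. -/
theorem jointProj_chain (hg : ∀ a < m, (g a).val = a) (c : ℕ → ℤ) {k : ℕ} (hk : k < m) {j : ℕ}
    (hj : j ≤ k) :
    D.w • (D.perm' (jointProj g c j) * D.chain c k j)
      = (∏ a ∈ Finset.range j, (D.w - c a)) •
        (D.perm' (jointProj g c j) * (D.w • 1 - D.perm' (swapSum g j k))) := by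
  induction j with
  | zero => simp [chain, prodDown_zero, jointProj, prodUp_zero, swapSum]
  | succ j ih =>
    have ih := ih (by omega)
    have e : D.chain c k (j + 1)
        = ((D.w - c j) • (1 : M') - D.perm' (swapElt g j k)) * D.chain c k j := rfl
    set E := D.perm' (jointProj g c j)
    set E' := D.perm' (jointProj g c (j + 1))
    set P := D.perm' (swapElt g j k)
    set S := D.perm' (swapSum g j k)
    have hS : D.perm' (swapSum g (j + 1) k) = S + P := by rw [swapSum_succ, map_add]
    have h1 : E' * E = E' := by
      rw [← map_mul, jointProj_succ_mul hg c (by omega)]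
    have h2 : Commute E ((D.w - c j) • (1 : M') - P) := by
      refine (smul_one_sub_commute _ ?_).symm
      refine (Commute.map (jointProj_commute c fun a b hab hb => ?_) D.perm').symm
      exact swapElt_commute hg (by omega) (by omega) (by omega) (by omega) (by omega) (by omega)
        (by omega) (by omega)
    have h3 : E' * (P * S) = (c j : Z) • (E' * P) := by
      rw [← map_mul, swapElt_mul_swapSum hg (by omega) hk, map_mul, ← mul_assoc, ← map_mul,
        jointProj_succ_mul_jm hg c (by omega), map_zsmul, smul_mul_assoc, Int.cast_smul_eq_zsmul]
    have h4 : E' * (((D.w - c j) • (1 : M') - P) * (D.w • 1 - S))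
        = (D.w - c j) • (E' * (D.w • 1 - (S + P))) := by
      simp only [mul_sub, sub_mul, mul_add, smul_mul_assoc, mul_smul_comm, one_mul, mul_one, h3]
      module
    calc D.w • (E' * D.chain c k (j + 1))
        = D.w • (E' * E * ((D.w - c j) • (1 : M') - P) * D.chain c k j) := by
          rw [e, h1, mul_assoc]
      _ = E' * ((D.w - c j) • (1 : M') - P) * (D.w • (E * D.chain c k j)) := by
          rw [mul_assoc E', h2.eq, mul_smul_comm]; simp only [mul_assoc]
      _ = (∏ a ∈ Finset.range j, (D.w - c a)) •
            (E' * E * (((D.w - c j) • (1 : M') - P) * (D.w • 1 - S))) := by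
          rw [ih, mul_smul_comm, mul_assoc E' E, ← mul_assoc E, h2.eq]; simp only [mul_assoc]
      _ = _ := by
          rw [h1, h4, Finset.prod_range_succ, hS, smul_smul]

theorem reg_prod (c : ℕ → ℤ) (j : ℕ) {y : M'} (h : (∏ a ∈ Finset.range j, (D.w - c a)) • y = 0) :
    y = 0 := by
  induction j generalizing y with
  | zero => simpa using h
  | succ j ih =>
    rw [Finset.prod_range_succ, mul_smul] at h
    exact D.reg _ _ (ih h)

/-- If `(w - x)` intertwines `b` and `b'`, then so does the spectral projection of `x` after the
specialization of `w` at the eigenvalue. -/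
theorem ev_proj {x : MonoidAlgebra ℂ (Equiv.Perm (Fin m))} {s : Finset ℤ}
    (hx : aeval x (rootPoly s) = 0) {b b' : M'}
    (h : b * (D.w • 1 - D.perm' x) = (D.w • 1 - D.perm' x) * b') (c : ℤ) :
    D.perm (proj s x c) * D.ev c b = D.ev c b' * D.perm (proj s x c) := by
  by_cases hc : c ∈ s
  swap
  · rw [proj_eq_zero hx hc, map_zero, zero_mul, mul_zero]
  have hr : ∀ d, (D.w • 1 - D.perm' x) * D.perm' (proj s x d)
      = (D.w - d) • D.perm' (proj s x d) := by
    intro d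
    rw [sub_mul, ← map_mul, mul_proj hx, map_intCast, ← zsmul_eq_mul, map_zsmul, smul_mul_assoc,
      one_mul, sub_smul, Int.cast_smul_eq_zsmul]
  have hl : ∀ d, D.perm' (proj s x d) * (D.w • 1 - D.perm' x)
      = (D.w - d) • D.perm' (proj s x d) := by
    intro d
    rw [mul_sub, ← map_mul, proj_mul hx, map_intCast, ← zsmul_eq_mul, map_zsmul, mul_smul_comm,
      mul_one, sub_smul, Int.cast_smul_eq_zsmul]
  -- The hypothesis is sandwiched between spectral projections, on which `w - x` becomes the scalar
  -- `w - d` or `w - e`.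
  have key : ∀ d e : ℤ, (D.w - e) • (D.perm' (proj s x d) * b * D.perm' (proj s x e))
      = (D.w - d) • (D.perm' (proj s x d) * b' * D.perm' (proj s x e)) := by
    intro d e
    rw [← mul_smul_comm, ← hr, ← smul_mul_assoc, ← smul_mul_assoc, ← hl]
    simp only [mul_assoc]
    rw [← mul_assoc b, h, mul_assoc]
  -- At `w = c` one side of `key` vanishes, and the other carries a nonzero integer factor that
  -- cancels. This kills the off-diagonal blocks in the row of `c`, and in `h2` those in its column.
  have h1 : ∀ d, d ≠ c → D.perm (proj s x c) * D.ev c b * D.perm (proj s x d) = 0 := by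
    intro d hd
    have := congrArg (D.ev c) (key c d)
    rw [D.ev_smul, D.ev_smul, sub_self, zero_smul, map_mul, map_mul, D.ev_perm', D.ev_perm'] at this
    exact D.reg_int _ _ (sub_ne_zero.2 hd.symm) this
  have h2 : ∀ d, d ≠ c → D.perm (proj s x d) * D.ev c b' * D.perm (proj s x c) = 0 := by
    intro d hd
    have := congrArg (D.ev c) (key d c)
    rw [D.ev_smul, D.ev_smul, sub_self, zero_smul, map_mul, map_mul, D.ev_perm', D.ev_perm'] at this
    exact D.reg_int _ _ (sub_ne_zero.2 hd.symm) this.symm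
  -- In the diagonal block both sides carry `w - c`, which has to be cancelled before `w` is
  -- specialized.
  have h3 : D.perm (proj s x c) * D.ev c b * D.perm (proj s x c)
      = D.perm (proj s x c) * D.ev c b' * D.perm (proj s x c) := by
    have := D.reg c (D.perm' (proj s x c) * b * D.perm' (proj s x c)
      - D.perm' (proj s x c) * b' * D.perm' (proj s x c)) (by rw [smul_sub, key, sub_self])
    have := congrArg (D.ev c) (sub_eq_zero.1 this)
    simpa only [map_mul, D.ev_perm'] using this
  calc _ = D.perm (proj s x c) * D.ev c b * D.perm (∑ d ∈ s, proj s x d) := by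
        rw [sum_proj ⟨c, hc⟩, map_one, mul_one]
    _ = D.perm (proj s x c) * D.ev c b * D.perm (proj s x c) := by
        rw [map_sum, Finset.mul_sum, Finset.sum_eq_single_of_mem c hc fun d _ hd => h1 d hd]
    _ = D.perm (∑ d ∈ s, proj s x d) * D.ev c b' * D.perm (proj s x c) := by
        rw [h3, map_sum, Finset.sum_mul, Finset.sum_mul,
          Finset.sum_eq_single_of_mem c hc fun d _ hd => h2 d hd]
    _ = _ := by rw [sum_proj ⟨c, hc⟩, map_one, one_mul]

theorem fusion_prefix (hg : ∀ a < m, (g a).val = a) (c : ℕ → ℤ) {k : ℕ} (hk : k ≤ m) :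
    D.perm (jointProj g c k) * prodUp (fun a => D.ev (c a) (D.T a)) k
      = prodDown (fun a => D.ev (c a) (D.T a)) k * D.perm (jointProj g c k) := by
  induction k with
  | zero => simp [prodUp_zero, prodDown_zero]
  | succ k ih =>
    have ih := ih (by omega)
    set t := fun a => D.ev (c a) (D.T a)
    set E := D.perm' (jointProj g c k) with hE
    set X' := D.perm' (jm g k)
    set U := D.const (prodUp t k)
    set V := D.const (prodDown t k)
    have hEE : E * E = E := by rw [← map_mul, jointProj_mul_self hg c (by omega)]
    have hEX : Commute E X' := (jointProj_commute_jm hg c hk).map D.perm'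
    have hUV : E * U = V * E := by
      rw [hE, ← D.const_perm, ← map_mul, ih, map_mul]
    -- The induction hypothesis puts the projection `E` on the right of `V`, so another copy of `E`
    -- is free there.
    have hEU : E * U * E = E * U := by
      rw [hUV, mul_assoc, hEE]
    have hET : Commute E (D.T k) := map_jointProj_commute D.perm' D.perm_scalar c
      fun a b hab hb => D.comm a b k (by omega) (by omega) hk (by omega) (by omega) (by omega)
    have hU : U = prodUp (fun a => D.const (D.ev (c a) (D.T a))) k := map_prodUp _ _ _
    have h1 : U * D.T k * D.chain c k k = D.chain c k k * D.T k * U := by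
      rw [hU]; exact D.mul_chain c hk le_rfl
    have h2 := D.jointProj_chain hg c hk le_rfl
    set Ψ := ∏ a ∈ Finset.range k, (D.w - c a)
    set A := D.chain c k k
    have hEY : Commute E (D.w • 1 - X') := (smul_one_sub_commute _ hEX.symm).symm
    -- `jointProj_chain` is used once in each direction: the factor `w` introduced by the first use
    -- is absorbed by the second, and only `Ψ` remains to be cancelled.
    have h3 : Ψ • (E * U * D.T k * (D.w • 1 - X')) = Ψ • ((D.w • 1 - X') * (D.T k * V * E)) := by
      calc Ψ • (E * U * D.T k * (D.w • 1 - X'))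
          = E * U * D.T k * (Ψ • (E * (D.w • 1 - X'))) := by
            rw [mul_smul_comm, ← mul_assoc, mul_assoc _ _ E, ← hET.eq, ← mul_assoc, hEU]
        _ = D.w • (E * U * (E * D.T k) * A) := by
            rw [← h2, mul_smul_comm, hET.eq]; simp only [mul_assoc]; rfl
        _ = D.w • (E * A) * D.T k * U := by
            rw [← mul_assoc, hEU, mul_assoc E U, mul_assoc E, h1]
            simp only [mul_assoc, smul_mul_assoc]
        _ = Ψ • ((D.w • 1 - X') * (E * D.T k) * U) := by
            rw [h2, hEY.eq]; simp only [mul_assoc, smul_mul_assoc]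
        _ = _ := by rw [hET.eq]; simp only [mul_assoc, hUV]
    have h4 : E * U * D.T k * (D.w • 1 - X') = (D.w • 1 - X') * (D.T k * V * E) := by
      rw [← sub_eq_zero]
      refine D.reg_prod c k ?_
      rw [smul_sub, h3, sub_self]
    -- Specialization at `w = c k`, where `w - X'` leaves behind the projection that enlarges `E` to
    -- the next joint projection.
    have h5 := D.ev_proj (aeval_jm_eq_zero hg hk) h4 (c k)
    simp only [U, V, hE, map_mul, D.ev_const, D.ev_perm'] at h5
    rw [prodUp_succ, prodDown_succ, jointProj_succ, map_mul]
    nth_rewrite 1 [← map_mul]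
    rw [(jointProj_commute_proj hg c hk (c k)).eq, map_mul]
    simp only [mul_assoc] at h5 ⊢
    exact h5

/-- The fusion theorem: `E T_0(c_0) ⋯ T_{m-1}(c_{m-1}) = T_{m-1}(c_{m-1}) ⋯ T_0(c_0) E` for the joint
spectral projection `E` of the Jucys–Murphy elements with eigenvalues `c_0, …, c_{m-1}`. -/
theorem fusion (hg : ∀ a < m, (g a).val = a) (c : ℕ → ℤ) :
    D.perm (jointProj g c m) * prodUp (fun a => D.ev (c a) (D.T a)) m
      = prodDown (fun a => D.ev (c a) (D.T a)) m * D.perm (jointProj g c m) :=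
  D.fusion_prefix hg c le_rfl

end FusionData

end Fusion

end

/-! ### Corners and quasi-inverses -/

section Corner

variable {M : Type*} [Ring M]

/-- `Q` preserves the kernel of the idempotent `E`. -/
def Corner (E Q : M) : Prop := E * Q * E = E * Q

theorem Corner.one {E : M} (hE : E * E = E) : Corner E 1 := by
  simp [Corner, hE]

theorem Corner.mul {E P Q : M} (hP : Corner E P) (hQ : Corner E Q) : Corner E (P * Q) := by
  have hP' : E * P * E = E * P := hP
  have hQ' : E * Q * E = E * Q := hQ
  calc E * (P * Q) * E = (E * P * E) * Q * E := by rw [hP']; simp only [mul_assoc]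
    _ = E * P * (E * Q * E) := by simp only [mul_assoc]
    _ = (E * P * E) * Q := by rw [hQ']; simp only [mul_assoc]
    _ = _ := by rw [hP', mul_assoc]

theorem Corner.of_commute {E Q : M} (hE : E * E = E) (h : Commute E Q) : Corner E Q := by
  rw [Corner, mul_assoc, ← h.eq, ← mul_assoc, hE]

theorem Corner.of_intertwine {E Q Q' : M} (hE : E * E = E) (h : E * Q = Q' * E) : Corner E Q := by
  rw [Corner, h, mul_assoc, hE]

theorem Corner.mul_left {E F Q : M} (hEF : Commute E F) (hE : Corner E Q) (hF : Corner F Q) :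
    Corner (E * F) Q := by
  have hE' : E * Q * E = E * Q := hE
  have hF' : F * Q * F = F * Q := hF
  calc E * F * Q * (E * F) = F * E * Q * (E * F) := by rw [← hEF.eq]
    _ = F * (E * Q * E) * F := by simp only [mul_assoc]
    _ = E * (F * Q * F) := by rw [hE', ← mul_assoc F, ← hEF.eq]; simp only [mul_assoc]
    _ = _ := by rw [hF', mul_assoc]

theorem Corner.prodUp {E : M} (hE : E * E = E) {f : ℕ → M} {k : ℕ}
    (h : ∀ a < k, Corner E (f a)) : Corner E (prodUp f k) := by
  induction k with
  | zero => exact Corner.one hE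
  | succ k ih => exact (ih fun a ha => h a (by omega)).mul (h k (by omega))

theorem Corner.prodDown {E : M} (hE : E * E = E) {f : ℕ → M} {k : ℕ}
    (h : ∀ a < k, Corner E (f a)) : Corner E (prodDown f k) := by
  induction k with
  | zero => exact Corner.one hE
  | succ k ih => exact (h k (by omega)).mul (ih fun a ha => h a (by omega))

variable {Z : Type*} [CommRing Z] [Algebra Z M]

theorem prodUp_mul_prodDown {f f' : ℕ → M} {s : ℕ → Z} {k : ℕ}
    (h : ∀ a < k, f a * f' a = s a • 1) :
    prodUp f k * prodDown f' k = (∏ a ∈ Finset.range k, s a) • 1 := by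
  induction k with
  | zero => simp [prodUp_zero, prodDown_zero]
  | succ k ih =>
    rw [prodUp_succ, prodDown_succ, mul_assoc, ← mul_assoc (f k), h k (by omega), smul_mul_assoc,
      one_mul, mul_smul_comm, ih fun a ha => h a (by omega), Finset.prod_range_succ, smul_smul,
      mul_comm]

theorem prodDown_mul_prodUp {f f' : ℕ → M} {s : ℕ → Z} {k : ℕ}
    (h : ∀ a < k, f a * f' a = s a • 1) :
    prodDown f k * prodUp f' k = (∏ a ∈ Finset.range k, s a) • 1 := by
  induction k with
  | zero => simp [prodUp_zero, prodDown_zero]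
  | succ k ih =>
    rw [prodUp_succ, prodDown_succ, mul_assoc, ← mul_assoc _ (prodUp f' k),
      ih fun a ha => h a (by omega), smul_mul_assoc, one_mul, mul_smul_comm, h k (by omega),
      Finset.prod_range_succ, smul_smul]

/-- An intertwining relation passes to inverses; here the inverses exist only up to the scalar `s`,
which must be cancellable. -/
theorem intertwine_inverse {E Q Q' R R' : M} {s : Z} (hs : ∀ y : M, s • y = 0 → y = 0)
    (h : E * Q = Q' * E) (h1 : Q * R = s • 1) (h2 : R' * Q' = s • 1) : E * R = R' * E := by
  rw [← sub_eq_zero]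
  refine hs _ ?_
  rw [smul_sub, sub_eq_zero]
  calc s • (E * R) = R' * Q' * (E * R) := by rw [h2, smul_mul_assoc, one_mul]
    _ = R' * (Q' * E) * R := by noncomm_ring
    _ = R' * E * (Q * R) := by rw [← h]; noncomm_ring
    _ = _ := by rw [h1, mul_smul_comm, mul_one]

theorem prodUp_mul {p q : ℕ → M} {k : ℕ} (h : ∀ a b, a < b → b < k → Commute (q a) (p b)) :
    prodUp p k * prodUp q k = prodUp (fun a => p a * q a) k := by
  induction k with
  | zero => exact one_mul 1
  | succ k ih =>
    have hc : Commute (prodUp q k) (p k) := prodUp_commute fun a ha => h a k ha (by omega)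
    rw [prodUp_succ, prodUp_succ, prodUp_succ, ← ih fun a b hab hb => h a b hab (by omega)]
    rw [mul_assoc, ← mul_assoc (p k), ← hc.eq]
    simp only [mul_assoc]

/-- Factors in different rows and different columns of the grid commute, so the product can be read
by columns or by rows. One reading suits the fusion relation for `U`, the other the one for `V`. -/
theorem prodDown_prodUp_swap {f : ℕ → ℕ → M} {m n : ℕ}
    (h : ∀ a a' b b', a < m → a' < m → b < n → b' < n → a ≠ a' → b ≠ b' →
      Commute (f a b) (f a' b')) :
    prodDown (fun b => prodUp (fun a => f a b) m) n
      = prodUp (fun a => prodDown (fun b => f a b) n) m := by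
  induction n with
  | zero =>
    simp only [prodDown_zero]
    induction m with
    | zero => rfl
    | succ m ih => rw [prodUp_succ, mul_one]; exact ih fun a a' b b' _ _ hb => by omega
  | succ n ih =>
    simp only [prodDown_succ]
    rw [ih fun a a' b b' ha ha' hb hb' => h a a' b b' ha ha' (by omega) (by omega), prodUp_mul]
    intro a a' ha ha'
    exact prodDown_commute fun b hb =>
      h a a' b n (by omega) ha' (by omega) (by omega) (by omega) (by omega)

end Corner

/-! ### Commuting traces -/

section Trace

variable {Z M A : Type*} [CommRing Z] [Ring M] [Algebra Z M] [AddCommGroup A] [Module Z A]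

/-- Elements over which the trace is cyclic. -/
def Cyclic (tr : M →ₗ[Z] A) (C : M) : Prop := ∀ Y, tr (Y * C) = tr (C * Y)

theorem Cyclic.mul {tr : M →ₗ[Z] A} {C D : M} (hC : Cyclic tr C) (hD : Cyclic tr D) :
    Cyclic tr (C * D) := fun Y => by
  rw [← mul_assoc, hD, ← mul_assoc, hC, mul_assoc]

theorem Cyclic.sub {tr : M →ₗ[Z] A} {C D : M} (hC : Cyclic tr C) (hD : Cyclic tr D) :
    Cyclic tr (C - D) := fun Y => by
  rw [mul_sub, sub_mul, map_sub, map_sub, hC, hD]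

theorem Cyclic.smul {tr : M →ₗ[Z] A} {C : M} (hC : Cyclic tr C) (z : Z) :
    Cyclic tr (z • C) := fun Y => by
  rw [mul_smul_comm, smul_mul_assoc, map_smul, map_smul, hC]

theorem Cyclic.one (tr : M →ₗ[Z] A) : Cyclic tr 1 := fun Y => by rw [mul_one, one_mul]

theorem Cyclic.prodUp {tr : M →ₗ[Z] A} {f : ℕ → M} {k : ℕ} (h : ∀ a < k, Cyclic tr (f a)) :
    Cyclic tr (prodUp f k) := by
  induction k with
  | zero => exact Cyclic.one tr
  | succ k ih => exact (ih fun a ha => h a (by omega)).mul (h k (by omega))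

theorem Cyclic.prodDown {tr : M →ₗ[Z] A} {f : ℕ → M} {k : ℕ} (h : ∀ a < k, Cyclic tr (f a)) :
    Cyclic tr (prodDown f k) := by
  induction k with
  | zero => exact Cyclic.one tr
  | succ k ih => exact (h k (by omega)).mul (ih fun a ha => h a (by omega))

/-- The idea is `T T' = R⁻¹ T' T R` followed by a cyclic move. The entries of `T` and `T'` do not
commute, so only `E R` may be moved around the trace; the corner conditions create the copies of `E`
that isolate it. -/
theorem trace_mul_comm_of_intertwine {tr : M →ₗ[Z] A} {E R S T T' : M} {s : Z}
    (hs : ∀ y : A, s • y = 0 → y = 0) (hE : E * E = E) (hcyc : Cyclic tr (E * R))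
    (hRS : R * S = s • 1) (hSR : S * R = s • 1) (hR : Corner E R) (hS : Corner E S)
    (hT : Corner E T) (hT' : Corner E T') (h : R * T * T' = T' * T * R) :
    tr (E * (T * T')) = tr (E * (T' * T)) := by
  have hR' : E * R * E = E * R := hR
  have hS' : E * S * E = E * S := hS
  have hZ : E * (T' * T) * E = E * (T' * T) := hT'.mul hT
  rw [← sub_eq_zero]
  refine hs _ ?_
  rw [smul_sub, sub_eq_zero, ← map_smul, ← map_smul]
  have h1 : s • (E * (T * T')) = E * S * (T' * T) * E * (E * R) := by
    calc s • (E * (T * T')) = E * ((S * R) * (T * T')) := by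
          rw [hSR, smul_mul_assoc, one_mul, mul_smul_comm]
      _ = E * S * (R * T * T') := by noncomm_ring
      _ = E * S * E * (T' * T) * R := by rw [h, hS']; noncomm_ring
      _ = E * S * (E * (T' * T) * E) * R := by rw [hZ]; noncomm_ring
      _ = E * S * E * (T' * T) * (E * E) * R := by rw [hE]; noncomm_ring
      _ = _ := by rw [hS']; noncomm_ring
  have h2 : s • (E * (T' * T)) = E * R * (E * S * (T' * T) * E) := by
    calc s • (E * (T' * T)) = E * (R * S) * (E * (T' * T)) := by
          rw [hRS, mul_smul_comm, mul_one, smul_mul_assoc, ← mul_assoc E E, hE]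
      _ = E * R * E * S * E * (T' * T) * E := by rw [← hZ, hR']; noncomm_ring
      _ = E * R * (E * S * E) * (T' * T) * E := by noncomm_ring
      _ = _ := by rw [hS']; noncomm_ring
  rw [h1, h2, hcyc]

/-- The commutativity of two fused traces. The element `z a b - h * Q a b` is the Yang `R`-matrix
that intertwines `T a` and `T' b`. -/
theorem trace_fused_comm {tr : M →ₗ[Z] A} {m n : ℕ} {EU EV : M} {T T' : ℕ → M} {Q : ℕ → ℕ → M}
    {z : ℕ → ℕ → Z} {h : Z}
    (hA : ∀ a b, a < m → b < n → ∀ y : A, (h * h - z a b * z a b) • y = 0 → y = 0)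
    (hM : ∀ a b, a < m → b < n → ∀ y : M, (h * h - z a b * z a b) • y = 0 → y = 0)
    (hEU : EU * EU = EU) (hEV : EV * EV = EV) (hEUV : Commute EU EV)
    (cU : Cyclic tr EU) (cV : Cyclic tr EV) (cQ : ∀ a b, a < m → b < n → Cyclic tr (Q a b))
    (hQ : ∀ a b, a < m → b < n → Q a b * Q a b = 1)
    (hQQ : ∀ a a' b b', a < m → a' < m → b < n → b' < n → a ≠ a' → b ≠ b' →
      Commute (Q a b) (Q a' b'))
    (hQT : ∀ a a' b, a < m → a' < m → b < n → a ≠ a' → Commute (Q a b) (T a'))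
    (hQT' : ∀ a b b', a < m → b < n → b' < n → b ≠ b' → Commute (Q a b) (T' b'))
    (hUT : ∀ b < n, Commute EU (T' b)) (hVT : ∀ a < m, Commute EV (T a))
    (hRTT : ∀ a b, a < m → b < n →
      (z a b • 1 - h • Q a b) * T a * T' b = T' b * T a * (z a b • 1 - h • Q a b))
    (fT : EU * prodUp T m = prodDown T m * EU) (fT' : EV * prodUp T' n = prodDown T' n * EV)
    (fU : ∀ b < n, EU * prodUp (fun a => z a b • 1 - h • Q a b) m
      = prodDown (fun a => z a b • 1 - h • Q a b) m * EU)
    (fV : ∀ a < m, EV * prodUp (fun b => -z a b • 1 - h • Q a b) n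
      = prodDown (fun b => -z a b • 1 - h • Q a b) n * EV) :
    tr (EU * EV * (prodUp T m * prodUp T' n)) = tr (EU * EV * (prodUp T' n * prodUp T m)) := by
  set R : ℕ → ℕ → M := fun a b => z a b • 1 - h • Q a b with hR
  -- Unitarity of the Yang `R`-matrix: since `Q² = 1`, `(z - hQ)(-z - hQ) = h² - z²`.
  set S : ℕ → ℕ → M := fun a b => -z a b • 1 - h • Q a b with hS
  set s : ℕ → ℕ → Z := fun a b => h * h - z a b * z a b with hs
  have hRS : ∀ a b, a < m → b < n → R a b * S a b = s a b • 1 := by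
    intro a b ha hb
    simp only [hR, hS, hs, mul_sub, sub_mul, smul_mul_assoc, mul_smul_comm, one_mul, mul_one,
      hQ a b ha hb]
    module
  have hSR : ∀ a b, a < m → b < n → S a b * R a b = s a b • 1 := by
    intro a b ha hb
    simp only [hR, hS, hs, mul_sub, sub_mul, smul_mul_assoc, mul_smul_comm, one_mul, mul_one,
      hQ a b ha hb]
    module
  have comR : ∀ a b (y : M), Commute (Q a b) y → Commute (R a b) y := fun a b y hy =>
    ((Commute.one_left y).smul_left _).sub_left (hy.smul_left _)
  have comS : ∀ a b (y : M), Commute (Q a b) y → Commute (S a b) y := fun a b y hy =>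
    ((Commute.one_left y).smul_left _).sub_left (hy.smul_left _)
  have comRR : ∀ a a' b b', a < m → a' < m → b < n → b' < n → a ≠ a' → b ≠ b' →
      Commute (R a b) (R a' b') := fun a a' b b' ha ha' hb hb' h1 h2 =>
    comR _ _ _ (comR _ _ _ (hQQ a a' b b' ha ha' hb hb' h1 h2).symm).symm
  have comSS : ∀ a a' b b', a < m → a' < m → b < n → b' < n → a ≠ a' → b ≠ b' →
      Commute (S a b) (S a' b') := fun a a' b b' ha ha' hb hb' h1 h2 =>
    comS _ _ _ (comS _ _ _ (hQQ a a' b b' ha ha' hb hb' h1 h2).symm).symm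
  have regA : ∀ (I J : Finset ℕ), (∀ a ∈ I, a < m) → (∀ b ∈ J, b < n) → ∀ y : A,
      (∏ b ∈ J, ∏ a ∈ I, s a b) • y = 0 → y = 0 := by
    intro I J hI hJ
    refine Finset.prod_induction _ (fun c : Z => ∀ y : A, c • y = 0 → y = 0)
      (fun c d hc hd y hy => hd y (hc _ (by rwa [smul_smul]))) (fun y hy => by simpa using hy) ?_
    intro b hb
    refine Finset.prod_induction _ (fun c : Z => ∀ y : A, c • y = 0 → y = 0)
      (fun c d hc hd y hy => hd y (hc _ (by rwa [smul_smul]))) (fun y hy => by simpa using hy) ?_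
    exact fun a ha => hA a b (hI a ha) (hJ b hb)
  have regM : ∀ (K : Finset ℕ) (f : ℕ → Z), (∀ a ∈ K, ∀ y : M, f a • y = 0 → y = 0) →
      ∀ y : M, (∏ a ∈ K, f a) • y = 0 → y = 0 := by
    intro K f hf
    exact Finset.prod_induction _ (fun c : Z => ∀ y : M, c • y = 0 → y = 0)
      (fun c d hc hd y hy => hd y (hc _ (by rwa [smul_smul]))) (fun y hy => by simpa using hy) hf
  -- The columns appear in decreasing order of `b` so that the last one, on the far left, can move
  -- past the earlier `T' b` and reach the newest; within a column `a` increases, as in `fU`.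
  set 𝓡 := prodDown (fun b => prodUp (fun a => R a b) m) n with h𝓡
  set 𝓢 := prodUp (fun b => prodDown (fun a => S a b) m) n with h𝓢
  have h𝓡' : 𝓡 = prodUp (fun a => prodDown (fun b => R a b) n) m := prodDown_prodUp_swap comRR
  have h𝓢' : 𝓢 = prodDown (fun a => prodUp (fun b => S a b) n) m :=
    (prodDown_prodUp_swap (f := fun b a => S a b) fun b b' a a' hb hb' ha ha' h1 h2 =>
      comSS a a' b b' ha ha' hb hb' h2 h1).symm
  have e1 : 𝓡 * 𝓢 = (∏ b ∈ Finset.range n, ∏ a ∈ Finset.range m, s a b) • (1 : M) :=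
    prodDown_mul_prodUp fun b hb => prodUp_mul_prodDown fun a ha => hRS a b ha hb
  have e2 : 𝓢 * 𝓡 = (∏ b ∈ Finset.range n, ∏ a ∈ Finset.range m, s a b) • (1 : M) :=
    prodUp_mul_prodDown fun b hb => prodDown_mul_prodUp fun a ha => hSR a b ha hb
  have kUR : Corner EU 𝓡 := Corner.prodDown hEU fun b hb => Corner.of_intertwine hEU (fU b hb)
  have kUS : Corner EU 𝓢 := Corner.prodUp hEU fun b hb => by
    refine Corner.of_intertwine hEU (intertwine_inverse (regM (Finset.range m) (fun a => s a b) ?_)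
      (fU b hb) (prodUp_mul_prodDown fun a ha => hRS a b ha hb)
      (prodUp_mul_prodDown fun a ha => hSR a b ha hb))
    exact fun a ha => hM a b (Finset.mem_range.1 ha) hb
  -- For the second tableau the spectral difference has the opposite sign, so fusion applies
  -- directly to the factors of `𝓢`, read by rows. The statement for `𝓡` follows by inversion; for
  -- the first tableau the roles are reversed.
  have kVS : Corner EV 𝓢 := by
    rw [h𝓢']
    exact Corner.prodDown hEV fun a ha => Corner.of_intertwine hEV (fV a ha)
  have kVR : Corner EV 𝓡 := by
    rw [h𝓡']
    refine Corner.prodUp hEV fun a ha => ?_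
    refine Corner.of_intertwine hEV (intertwine_inverse (regM (Finset.range n) (fun b => s a b) ?_)
      (fV a ha) (prodUp_mul_prodDown fun b hb => hSR a b ha hb)
      (prodUp_mul_prodDown fun b hb => hRS a b ha hb))
    exact fun b hb => hM a b ha (Finset.mem_range.1 hb)
  have hRTT' : ∀ a b, a < m → b < n → R a b * T a * T' b = T' b * T a * R a b := hRTT
  -- A single `T' b` is carried past all the `T a`; `all` then repeats this for every `b`.
  have col : ∀ b < n, ∀ k ≤ m, prodUp (fun a => R a b) k * prodUp T k * T' b
      = T' b * prodUp T k * prodUp (fun a => R a b) k := by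
    intro b hb k
    induction k with
    | zero => intro _; simp [prodUp_zero]
    | succ k ih =>
      intro hk
      have ih := ih (by omega)
      have c1 : Commute (R k b) (prodUp T k) := comR _ _ _ (prodUp_commute fun a ha =>
        (hQT k a b (by omega) (by omega) hb (by omega)).symm).symm
      have c2 : Commute (prodUp (fun a => R a b) k) (T k) := prodUp_commute fun a ha =>
        comR _ _ _ (hQT a k b (by omega) (by omega) hb (by omega))
      rw [prodUp_succ, prodUp_succ]
      calc _ = prodUp (fun a => R a b) k * (R k b * prodUp T k) * T k * T' b := by noncomm_ring
        _ = prodUp (fun a => R a b) k * prodUp T k * (R k b * T k * T' b) := by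
          rw [c1.eq]; noncomm_ring
        _ = prodUp (fun a => R a b) k * prodUp T k * T' b * T k * R k b := by
          rw [hRTT' k b (by omega) hb]; simp only [mul_assoc]
        _ = T' b * prodUp T k * (prodUp (fun a => R a b) k * T k) * R k b := by
          rw [ih]; noncomm_ring
        _ = _ := by rw [c2.eq]; noncomm_ring
  have all : ∀ k ≤ n, prodDown (fun b => prodUp (fun a => R a b) m) k * prodUp T m * prodUp T' k
      = prodUp T' k * prodUp T m * prodDown (fun b => prodUp (fun a => R a b) m) k := by
    intro k
    induction k with
    | zero => intro _; simp [prodUp_zero, prodDown_zero]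
    | succ k ih =>
      intro hk
      have ih := ih (by omega)
      have c1 : Commute (prodUp (fun a => R a k) m) (prodUp T' k) := prodUp_commute fun a ha =>
        (prodUp_commute fun b hb => (comR _ _ _ (hQT' a k b ha (by omega) (by omega)
          (by omega))).symm).symm
      have c2 : Commute (prodDown (fun b => prodUp (fun a => R a b) m) k) (T' k) :=
        prodDown_commute fun b hb => prodUp_commute fun a ha =>
          comR _ _ _ (hQT' a b k ha (by omega) (by omega) (by omega))
      have c3 := col k (by omega) m le_rfl
      rw [prodUp_succ, prodDown_succ]
      set D := prodDown (fun b => prodUp (fun a => R a b) m) k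
      set F := prodUp (fun a => R a k) m
      calc _ = F * (D * prodUp T m * prodUp T' k) * T' k := by noncomm_ring
        _ = (F * prodUp T' k) * prodUp T m * (D * T' k) := by rw [ih]; noncomm_ring
        _ = prodUp T' k * (F * prodUp T m * T' k) * D := by rw [c1.eq, c2.eq]; noncomm_ring
        _ = _ := by rw [c3]; noncomm_ring
  have cR : Cyclic tr 𝓡 := Cyclic.prodDown fun b hb => Cyclic.prodUp fun a ha =>
    ((Cyclic.one tr).smul _).sub ((cQ a b ha hb).smul _)
  refine trace_mul_comm_of_intertwine
    (regA (Finset.range m) (Finset.range n) (fun a => Finset.mem_range.1)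
      fun b => Finset.mem_range.1) ?_ ((cU.mul cV).mul cR) e1 e2
    (kUR.mul_left hEUV kVR) (kUS.mul_left hEUV kVS) ?_ ?_ (all n le_rfl)
  · rw [mul_assoc, ← mul_assoc EV, ← hEUV.eq, mul_assoc EU EV, hEV, ← mul_assoc, hEU]
  · exact (Corner.of_intertwine hEU fT).mul_left hEUV
      (Corner.of_commute hEV (prodUp_commute fun a ha => (hVT a ha).symm).symm)
  · exact (Corner.of_commute hEU (prodUp_commute fun b hb => (hUT b hb).symm).symm).mul_left hEUV
      (Corner.of_intertwine hEV fT')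

/-- The Yang–Baxter equation for the matrices `x + h w - h Q` and `w - c - P`. -/
theorem yang_baxter {P Q Q' : M} (h1 : Q' * P = P * Q) (h2 : Q * P = P * Q') (h3 : Q' * Q = P * Q')
    (h4 : Q * Q' = P * Q) (x h w c : Z) :
    ((x + h * c) • 1 - h • Q) * ((x + h * w) • 1 - h • Q') * ((w - c) • 1 - P)
      = ((w - c) • 1 - P) * ((x + h * w) • 1 - h • Q') * ((x + h * c) • 1 - h • Q) := by
  have e1 : Q * (Q' * P) = P * (Q' * Q) := by rw [h1, ← mul_assoc, h2, mul_assoc]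
  simp only [mul_sub, sub_mul, smul_mul_assoc, mul_smul_comm, one_mul, mul_one, mul_assoc, h1, h2]
  have e2 : Q * (P * Q) = P * (Q' * Q) := by rw [← mul_assoc, h2, mul_assoc]
  simp only [e2, h3, h4]
  module

end Trace

/-! ### The shift `u ↦ u + h x` -/

section Shift

variable {B : Type*} [Ring B]

/-- The coefficients of `u * f(u)`. -/
def pre (f : ℕ → B) : ℕ → B
  | 0 => 0
  | k + 1 => f k

/-- The coefficients of the constant series `1`. -/
def unitCoeff (B : Type*) [Ring B] (k : ℕ) : B := if k = 0 then 1 else 0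

/-- The coefficients of `f(u + z)` where `z ^ n = 0`. -/
def shift (z : B) (n : ℕ) (f : ℕ → B) (k : ℕ) : B :=
  ∑ d ∈ Finset.range n, ((k + d).choose k : B) * z ^ d * f (k + d)

variable {z : B} {n : ℕ}

theorem shift_add (f f' : ℕ → B) (k : ℕ) :
    shift z n (fun r => f r + f' r) k = shift z n f k + shift z n f' k := by
  simp only [shift, mul_add, Finset.sum_add_distrib]

theorem shift_sub (f f' : ℕ → B) (k : ℕ) :
    shift z n (fun r => f r - f' r) k = shift z n f k - shift z n f' k := by
  simp only [shift, mul_sub, Finset.sum_sub_distrib]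

theorem shift_mul_right (f : ℕ → B) (b : B) (k : ℕ) :
    shift z n (fun r => f r * b) k = shift z n f k * b := by
  simp only [shift, Finset.sum_mul, mul_assoc]

theorem shift_mul_left (hz : ∀ y, Commute z y) (f : ℕ → B) (b : B) (k : ℕ) :
    shift z n (fun r => b * f r) k = b * shift z n f k := by
  simp only [shift, Finset.mul_sum, ← mul_assoc]
  refine Finset.sum_congr rfl fun d _ => ?_
  congr 1
  rw [((Nat.cast_commute _ b).mul_left ((hz b).pow_left d)).eq, mul_assoc]

theorem shift_unitCoeff (hn : 0 < n) (k : ℕ) : shift z n (unitCoeff B) k = unitCoeff B k := by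
  rw [shift, Finset.sum_eq_single_of_mem 0 (Finset.mem_range.2 hn)]
  · simp
  · intro d _ hd
    rw [unitCoeff, if_neg (by omega), mul_zero]

/-- Substituting `u + z` into `u f(u)` gives `(u + z) f(u + z)`; on coefficients this is Pascal's
rule, and the truncation at `n` loses nothing because `z ^ n = 0`. -/
theorem shift_pre (hz : z ^ n = 0) (f : ℕ → B) (k : ℕ) :
    shift z n (pre f) k = pre (shift z n f) k + z * shift z n f k := by
  have h0 : ∀ a : ℕ → B, ∑ d ∈ Finset.range n, a d * z ^ (d + 1) * f (k + d)
      = a 0 * 0 + ∑ d ∈ Finset.range n, a d * z ^ (d + 1) * f (k + d) := by simp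
  have hzs : z * shift z n f k
      = ∑ d ∈ Finset.range n, ((k + d).choose k : B) * z ^ (d + 1) * f (k + d) := by
    rw [shift, Finset.mul_sum]
    refine Finset.sum_congr rfl fun d _ => ?_
    rw [pow_succ', ← mul_assoc, ← mul_assoc, ← mul_assoc, (Nat.cast_commute _ z).eq]
  have key : ∀ e : ℕ → B, (∑ d ∈ Finset.range n, e d * z ^ (d + 1) * f (k + d))
      = ∑ d ∈ Finset.range (n - 1), e d * z ^ (d + 1) * f (k + d) := by
    intro e
    cases n with
    | zero => rfl
    | succ n => rw [Finset.sum_range_succ, hz, Nat.add_sub_cancel]; simp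
  rw [hzs, key]
  cases n with
  | zero => cases k <;> simp [shift, pre]
  | succ n =>
    rw [Nat.add_sub_cancel]
    cases k with
    | zero =>
      rw [shift, Finset.sum_range_succ']
      simp [pre]
    | succ k =>
      have : ∀ d, ((k + 1 + d).choose (k + 1) : B) * z ^ d * pre f (k + 1 + d)
          = ((k + d).choose k : B) * z ^ d * f (k + d)
            + ((k + d).choose (k + 1) : B) * z ^ d * f (k + d) := by
        intro d
        rw [show k + 1 + d = k + d + 1 by omega, Nat.choose_succ_succ, pre, Nat.cast_add, add_mul,
          add_mul]
      rw [shift, Finset.sum_congr rfl fun d _ => this d, Finset.sum_add_distrib]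
      congr 1
      rw [Finset.sum_range_succ']
      simp only [add_zero, Nat.choose_succ_self, Nat.cast_zero, zero_mul]
      refine Finset.sum_congr rfl fun d _ => ?_
      rw [show k + (d + 1) = k + 1 + d by omega]

end Shift

/-! ### The `RTT` relation -/

section RTT

variable {B : Type*} [Ring B] {N : ℕ}

/-- The defining relations of the dual Yangian for the elements `τ i j r` of a ring with a central
element `h`. -/
def YangianRel (h : B) (τ : Fin N → Fin N → ℕ → B) : Prop :=
  ∀ i j k l r s, τ i j r * τ k l s - τ k l s * τ i j r
    = (if k = j then τ i l (r + s + 1) else 0) - (if i = l then τ k j (r + s + 1) else 0)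
      + h * ∑ a ∈ Finset.range (min r s + 1),
        (τ k j (r + s + 1 - a) * τ i l a - τ k j a * τ i l (r + s + 1 - a))

/-- The Kronecker symbol. -/
def delta (R : Type*) [Ring R] (i j : Fin N) : R := if i = j then 1 else 0

theorem delta_mul (i j : Fin N) (y : B) : delta B i j * y = if i = j then y else 0 := by
  rw [delta, ite_mul, one_mul, zero_mul]

/-- The coefficients of `(u - v) [τ_{ij}(u), τ_{kl}(v)]`. -/
theorem YangianRel.series {h : B} {τ : Fin N → Fin N → ℕ → B} (H : YangianRel h τ)
    (i j k l : Fin N) (r s : ℕ) :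
    (pre (τ i j) r * τ k l s - τ k l s * pre (τ i j) r)
        - (τ i j r * pre (τ k l) s - pre (τ k l) s * τ i j r)
      = delta B k j * (τ i l r * unitCoeff B s - unitCoeff B r * τ i l s)
        - delta B i l * (τ k j r * unitCoeff B s - unitCoeff B r * τ k j s)
        + h * (τ k j r * τ i l s - τ k j s * τ i l r) := by
  rw [delta_mul, delta_mul]
  cases r with
  | zero =>
    cases s with
    | zero => simp [pre, unitCoeff]
    | succ s =>
      have := H i j k l 0 s
      simp only [pre, unitCoeff, this]
      simp only [zero_mul, mul_zero, sub_self, zero_sub, Nat.zero_min, Finset.sum_range_one,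
        Nat.zero_add, Nat.sub_zero, if_true, Nat.succ_ne_zero, if_false, one_mul]
      split_ifs <;> noncomm_ring
  | succ r =>
    cases s with
    | zero =>
      have := H i j k l r 0
      simp only [pre, unitCoeff, this]
      simp only [zero_mul, mul_zero, sub_self, sub_zero, Nat.min_zero, Finset.sum_range_one,
        Nat.zero_add, Nat.sub_zero, if_true, Nat.succ_ne_zero, if_false, mul_one, Nat.add_zero]
    | succ s =>
      have h1 := H i j k l r (s + 1)
      have h2 := H i j k l (r + 1) s
      simp only [pre, unitCoeff, h1, h2]
      rw [show r + (s + 1) + 1 = r + s + 2 by omega, show r + 1 + s + 1 = r + s + 2 by omega]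
      simp only [Nat.succ_ne_zero, if_false, mul_zero, zero_mul, sub_self, ite_self, zero_add]
      -- The two commutators have the same total degree and hence the same summands. Their ranges
      -- differ by one term if `r ≠ s`, and that term is the right-hand side; for `r = s` everything
      -- cancels.
      rcases lt_trichotomy r s with hrs | rfl | hrs
      · rw [show min r (s + 1) = r by omega, show min (r + 1) s = r + 1 by omega,
          Finset.sum_range_succ _ (r + 1), show r + s + 2 - (r + 1) = s + 1 by omega]
        noncomm_ring
      · rw [show min r (r + 1) = r by omega, show min (r + 1) r = r by omega]
        noncomm_ring
      · rw [show min r (s + 1) = s + 1 by omega, show min (r + 1) s = s by omega,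
          Finset.sum_range_succ _ (s + 1), show r + s + 2 - (s + 1) = r + 1 by omega]
        noncomm_ring

variable {h x y : B} {τ : Fin N → Fin N → ℕ → B} {n : ℕ}

/-- The coefficients of `(u - v + h (x - y)) [τ_{ij}(u + h x), τ_{kl}(v + h y)]`. -/
theorem YangianRel.translate (H : YangianRel h τ) (hh : ∀ b, Commute h b) (hx : ∀ b, Commute x b)
    (hy : ∀ b, Commute y b) (hn : 0 < n) (hnil : h ^ n = 0) (i j k l : Fin N) (r s : ℕ) :
    ((pre (shift (h * x) n (τ i j)) r + h * x * shift (h * x) n (τ i j) r)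
          * shift (h * y) n (τ k l) s
        - shift (h * y) n (τ k l) s
          * (pre (shift (h * x) n (τ i j)) r + h * x * shift (h * x) n (τ i j) r))
        - (shift (h * x) n (τ i j) r
            * (pre (shift (h * y) n (τ k l)) s + h * y * shift (h * y) n (τ k l) s)
          - (pre (shift (h * y) n (τ k l)) s + h * y * shift (h * y) n (τ k l) s)
            * shift (h * x) n (τ i j) r)
      = delta B k j * (shift (h * x) n (τ i l) r * unitCoeff B s
          - unitCoeff B r * shift (h * y) n (τ i l) s)
        - delta B i l * (shift (h * x) n (τ k j) r * unitCoeff B s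
          - unitCoeff B r * shift (h * y) n (τ k j) s)
        + h * (shift (h * x) n (τ k j) r * shift (h * y) n (τ i l) s
          - shift (h * y) n (τ k j) s * shift (h * x) n (τ i l) r) := by
  have hzx : (h * x) ^ n = 0 := by rw [(hh x).mul_pow, hnil, zero_mul]
  have hzy : (h * y) ^ n = 0 := by rw [(hh y).mul_pow, hnil, zero_mul]
  have cx : ∀ b, Commute (h * x) b := fun b => (hh b).mul_left (hx b)
  have cy : ∀ b, Commute (h * y) b := fun b => (hh b).mul_left (hy b)
  have := congrArg (fun F : ℕ → ℕ → B => shift (h * x) n (fun r => shift (h * y) n (F r) s) r)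
    (funext fun r => funext fun s => H.series i j k l r s)
  simp only [shift_add, shift_sub, shift_mul_right, shift_mul_left cx, shift_mul_left cy,
    shift_unitCoeff hn, shift_pre hzx, shift_pre hzy] at this
  exact this

/-- The series `t_{ij}(u + h x) = δ_{ij} - h ∑_r τ_{ij}(r) (u + h x)^r`. -/
def tSeries (h x : B) (n : ℕ) (τ : Fin N → Fin N → ℕ → B) (i j : Fin N) : PowerSeries B :=
  delta _ i j - PowerSeries.C h * PowerSeries.mk (shift (h * x) n (τ i j))

/-- At equal `u` the spectral difference is `h z`, so a factor `h` is already divided out in the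
conclusion. This is essential: `h` is nilpotent and could not be cancelled later. For a general
difference `z`, as in `rtt_two`, that factor stays. -/
theorem rtt_one {K A : Type*} [CommRing K] [Ring A] [Algebra K A] {z h dij dkl dkj dil : K}
    {Xij Xil Xkj Ykl Yil Ykj : A}
    (H : (h * z) • (Xij * Ykl - Ykl * Xij)
      = dkj • (Xil - Yil) - dil • (Xkj - Ykj) + h • (Xkj * Yil - Ykj * Xil)) :
    z • ((dij • 1 - h • Xij) * (dkl • 1 - h • Ykl) - (dkl • 1 - h • Ykl) * (dij • 1 - h • Xij))
      = (dkj • 1 - h • Xkj) * (dil • 1 - h • Yil) - (dkj • 1 - h • Ykj) * (dil • 1 - h • Xil) := by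
  simp only [mul_sub, sub_mul, smul_mul_assoc, mul_smul_comm, one_mul, mul_one] at H ⊢
  linear_combination (norm := module) h • H

theorem rtt_two {K A : Type*} [CommRing K] [Ring A] [Algebra K A] {z h dij dkl dkj dil : K}
    {Xij Xil Xkj Ykl Yil Ykj : A}
    (H : z • (Xij * Ykl - Ykl * Xij)
      = dkj • (Xil - Yil) - dil • (Xkj - Ykj) + h • (Xkj * Yil - Ykj * Xil)) :
    z • ((dij • 1 - h • Xij) * (dkl • 1 - h • Ykl) - (dkl • 1 - h • Ykl) * (dij • 1 - h • Xij))
      = h • ((dkj • 1 - h • Xkj) * (dil • 1 - h • Yil)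
        - (dkj • 1 - h • Ykj) * (dil • 1 - h • Xil)) := by
  simp only [mul_sub, sub_mul, smul_mul_assoc, mul_smul_comm, one_mul, mul_one] at H ⊢
  linear_combination (norm := module) (h * h) • H

theorem commute_C {b : B} (hb : ∀ y, Commute b y) (f : PowerSeries B) :
    Commute (PowerSeries.C b) f := by
  ext k
  rw [PowerSeries.coeff_C_mul, PowerSeries.coeff_mul_C, (hb _).eq]

theorem coeff_mk_mul_mk (f f' : ℕ → B) (k : ℕ) :
    PowerSeries.coeff k (PowerSeries.mk f * PowerSeries.mk f')
      = ∑ p ∈ Finset.HasAntidiagonal.antidiagonal k, f p.1 * f' p.2 := by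
  rw [PowerSeries.coeff_mul]; simp

/-- Once `v = u`, multiplication by `u` and by `v` agree, so the contribution of `u - v` disappears.
-/
theorem sum_antidiagonal_pre (G : ℕ → ℕ → B) (k : ℕ) :
    ∑ p ∈ Finset.HasAntidiagonal.antidiagonal k, pre (fun r => G r p.2) p.1
      = ∑ p ∈ Finset.HasAntidiagonal.antidiagonal k, pre (fun s => G p.1 s) p.2 := by
  cases k with
  | zero => simp [pre]
  | succ k =>
    rw [Finset.Nat.sum_antidiagonal_succ, Finset.Nat.sum_antidiagonal_succ']
    simp [pre]

theorem pre_mul (f : ℕ → B) (b : B) (r : ℕ) : pre f r * b = pre (fun r => f r * b) r := by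
  cases r <;> simp [pre]

theorem mul_pre (f : ℕ → B) (b : B) (r : ℕ) : b * pre f r = pre (fun r => b * f r) r := by
  cases r <;> simp [pre]

theorem pre_sub (f f' : ℕ → B) (r : ℕ) :
    pre f r - pre f' r = pre (fun r => f r - f' r) r := by
  cases r <;> simp [pre]

theorem sum_antidiagonal_mul_unitCoeff (f : ℕ → B) (k : ℕ) :
    ∑ p ∈ Finset.HasAntidiagonal.antidiagonal k, f p.1 * unitCoeff B p.2 = f k := by
  rw [Finset.sum_eq_single_of_mem (k, 0) (by simp)]
  · simp [unitCoeff]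
  · rintro ⟨a, b⟩ hab hne
    rw [unitCoeff, if_neg, mul_zero]
    rintro rfl
    simp at hab hne
    exact hne hab

theorem sum_antidiagonal_unitCoeff_mul (f : ℕ → B) (k : ℕ) :
    ∑ p ∈ Finset.HasAntidiagonal.antidiagonal k, unitCoeff B p.1 * f p.2 = f k := by
  rw [Finset.sum_eq_single_of_mem (0, k) (by simp)]
  · simp [unitCoeff]
  · rintro ⟨a, b⟩ hab hne
    rw [unitCoeff, if_neg, zero_mul]
    rintro rfl
    simp at hab hne
    exact hne hab

theorem commutator_translate (hh : ∀ b, Commute h b) (hx : ∀ b, Commute x b)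
    (hy : ∀ b, Commute y b) (a a' b b' : B) :
    (a' + h * x * a) * b - b * (a' + h * x * a) - (a * (b' + h * y * b) - (b' + h * y * b) * a)
      = (a' * b - b * a') - (a * b' - b' * a) + h * (x - y) * (a * b - b * a) := by
  have hxy : h * x * a * b - b * (h * x * a) - (a * (h * y * b) - h * y * b * a)
      = h * (x - y) * (a * b - b * a) := by
    have c1 : b * (h * x * a) = h * x * (b * a) := by
      rw [← mul_assoc, ← ((hh b).mul_left (hx b)).eq]; simp only [mul_assoc]
    have c2 : a * (h * y * b) = h * y * (a * b) := by
      rw [← mul_assoc, ← ((hh a).mul_left (hy a)).eq]; simp only [mul_assoc]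
    rw [c1, c2]
    noncomm_ring
  rw [← hxy]
  noncomm_ring

/-- The relation between `T(u + h x)` and `T(u + h y)`. -/
theorem YangianRel.tSeries_one (H : YangianRel h τ) (hh : ∀ b, Commute h b)
    (hx : ∀ b, Commute x b) (hy : ∀ b, Commute y b) (hn : 0 < n) (hnil : h ^ n = 0)
    (i j k l : Fin N) :
    PowerSeries.C (x - y) * (tSeries h x n τ i j * tSeries h y n τ k l
        - tSeries h y n τ k l * tSeries h x n τ i j)
      = tSeries h x n τ k j * tSeries h y n τ i l - tSeries h y n τ k j * tSeries h x n τ i l := by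
  -- Central elements are made into honest scalars, so that the identity becomes one of modules over
  -- a commutative ring.
  let K := Subring.center (PowerSeries B)
  have mem : ∀ {b : B}, (∀ y, Commute b y) → PowerSeries.C b ∈ K := fun hb =>
    Subring.mem_center_iff.2 fun f => (commute_C hb f).symm.eq
  let hK : K := ⟨PowerSeries.C h, mem hh⟩
  let zK : K := ⟨PowerSeries.C (x - y), mem fun b => (hx b).sub_left (hy b)⟩
  have hd : ∀ (i j : Fin N), (delta (PowerSeries B) i j) = delta K i j • (1 : PowerSeries B) := by
    intro i j
    simp only [delta]
    split_ifs <;> simp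
  have hts : ∀ (w : B) (i j : Fin N), tSeries h w n τ i j = delta K i j • (1 : PowerSeries B)
      - hK • PowerSeries.mk (shift (h * w) n (τ i j)) := by
    intro w i j
    rw [← hd]
    rfl
  simp only [hts]
  refine rtt_one (z := zK) ?_
  change (PowerSeries.C h * PowerSeries.C (x - y)) * _
    = (delta K k j : PowerSeries B) * _ - (delta K i l : PowerSeries B) * _ + PowerSeries.C h * _
  have hd' : ∀ (i j : Fin N), (delta K i j : PowerSeries B) = PowerSeries.C (delta B i j) := by
    intro i j
    simp only [delta]
    split_ifs <;> simp
  ext K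
  rw [hd', hd', ← map_mul]
  simp only [map_add, map_sub, PowerSeries.coeff_C_mul, coeff_mk_mul_mk, PowerSeries.coeff_mk]
  -- Setting `v = u` in the two-variable identity means summing its coefficients over an
  -- antidiagonal.
  have key := Finset.sum_congr rfl fun (p : ℕ × ℕ) (_ : p ∈ Finset.HasAntidiagonal.antidiagonal K) =>
    H.translate hh hx hy hn hnil i j k l p.1 p.2
  have lhs := fun a a' b b' : B => commutator_translate hh hx hy a a' b b'
  simp only [lhs, pre_mul, mul_pre, pre_sub] at key
  simp only [Finset.sum_add_distrib, Finset.sum_sub_distrib, ← Finset.mul_sum,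
    sum_antidiagonal_mul_unitCoeff, sum_antidiagonal_unitCoeff_mul] at key
  rw [sum_antidiagonal_pre (fun r s => shift (h * x) n (τ i j) r
    * shift (h * y) n (τ k l) s - shift (h * y) n (τ k l) s
    * shift (h * x) n (τ i j) r), sub_self, zero_add] at key
  have flip : ∀ f f' : ℕ → B, ∑ p ∈ Finset.HasAntidiagonal.antidiagonal K, f p.1 * f' p.2
      = ∑ p ∈ Finset.HasAntidiagonal.antidiagonal K, f p.2 * f' p.1 := fun f f' => by
    rw [← Finset.Nat.sum_antidiagonal_swap]; rfl
  rw [flip (shift (h * y) n (τ k l)), flip (shift (h * y) n (τ k j))]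
  exact key

/-- The relation between `T(u + h x)` and `T(v + h y)`. -/
theorem YangianRel.tSeries_two (H : YangianRel h τ) (hh : ∀ b, Commute h b)
    (hx : ∀ b, Commute x b) (hy : ∀ b, Commute y b) (hn : 0 < n) (hnil : h ^ n = 0)
    (i j k l : Fin N) {z h' : Subring.center (PowerSeries (PowerSeries B))}
    (hz : (z : PowerSeries (PowerSeries B)) = PowerSeries.C PowerSeries.X - PowerSeries.X
      + PowerSeries.C (PowerSeries.C (h * (x - y))))
    (hh' : (h' : PowerSeries (PowerSeries B)) = PowerSeries.C (PowerSeries.C h))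
    (tu tv : Fin N → Fin N → PowerSeries (PowerSeries B))
    (htu : ∀ i j, tu i j = PowerSeries.C (tSeries h x n τ i j))
    (htv : ∀ i j, tv i j = PowerSeries.map PowerSeries.C (tSeries h y n τ i j)) :
    z • (tu i j * tv k l - tv k l * tu i j) = h' • (tu k j * tv i l - tv k j * tu i l) := by
  let K := Subring.center (PowerSeries (PowerSeries B))
  have hts : ∀ (i j : Fin N), tu i j = delta K i j • (1 : PowerSeries (PowerSeries B))
      - h' • PowerSeries.C (PowerSeries.mk (shift (h * x) n (τ i j))) := by
    intro i j
    rw [htu, tSeries, map_sub, map_mul, ← hh']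
    congr 1
    simp only [delta]
    split_ifs <;> simp
  have htv : ∀ (i j : Fin N), tv i j = delta K i j • (1 : PowerSeries (PowerSeries B))
      - h' • PowerSeries.map PowerSeries.C
        (PowerSeries.mk (shift (h * y) n (τ i j))) := by
    intro i j
    rw [htv, tSeries, map_sub, map_mul, PowerSeries.map_C, ← hh']
    congr 1
    simp only [delta]
    split_ifs <;> simp
  simp only [hts, htv]
  refine rtt_two ?_
  change (z : PowerSeries (PowerSeries B)) * _ = (delta K k j : PowerSeries (PowerSeries B)) * _
    - (delta K i l : PowerSeries (PowerSeries B)) * _ + (h' : PowerSeries (PowerSeries B)) * _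
  have hd' : ∀ (i j : Fin N), (delta K i j : PowerSeries (PowerSeries B))
      = PowerSeries.C (PowerSeries.C (delta B i j)) := by
    intro i j
    simp only [delta]
    split_ifs <;> simp
  have c1 : ∀ (b : B) (f : PowerSeries (PowerSeries B)) (r s : ℕ),
      PowerSeries.coeff r (PowerSeries.coeff s (PowerSeries.C (PowerSeries.C b) * f))
        = b * PowerSeries.coeff r (PowerSeries.coeff s f) := by
    intro b f r s
    rw [PowerSeries.coeff_C_mul, PowerSeries.coeff_C_mul]
  have c2 : ∀ (f : PowerSeries (PowerSeries B)) (r s : ℕ),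
      PowerSeries.coeff r (PowerSeries.coeff s (PowerSeries.X * f))
        = pre (fun s => PowerSeries.coeff r (PowerSeries.coeff s f)) s := by
    intro f r s
    cases s with
    | zero => simp [pre]
    | succ s => rw [PowerSeries.coeff_succ_X_mul]; rfl
  have c3 : ∀ (f : PowerSeries (PowerSeries B)) (r s : ℕ),
      PowerSeries.coeff r (PowerSeries.coeff s (PowerSeries.C PowerSeries.X * f))
        = pre (fun r => PowerSeries.coeff r (PowerSeries.coeff s f)) r := by
    intro f r s
    rw [PowerSeries.coeff_C_mul]
    cases r with
    | zero => simp [pre]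
    | succ r => rw [PowerSeries.coeff_succ_X_mul]; rfl
  have c4 : ∀ (f f' : ℕ → B) (r s : ℕ),
      PowerSeries.coeff r (PowerSeries.coeff s (PowerSeries.C (PowerSeries.mk f)
        * PowerSeries.map PowerSeries.C (PowerSeries.mk f'))) = f r * f' s := by
    intro f f' r s
    rw [PowerSeries.coeff_C_mul, PowerSeries.coeff_map, PowerSeries.coeff_mul_C,
      PowerSeries.coeff_mk, PowerSeries.coeff_mk]
  have c5 : ∀ (f f' : ℕ → B) (r s : ℕ),
      PowerSeries.coeff r (PowerSeries.coeff s (PowerSeries.map PowerSeries.C (PowerSeries.mk f')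
        * PowerSeries.C (PowerSeries.mk f))) = f' s * f r := by
    intro f f' r s
    rw [PowerSeries.coeff_mul_C, PowerSeries.coeff_map, PowerSeries.coeff_C_mul,
      PowerSeries.coeff_mk, PowerSeries.coeff_mk]
  have c6 : ∀ (f : ℕ → B) (r s : ℕ),
      PowerSeries.coeff r (PowerSeries.coeff s (PowerSeries.C (PowerSeries.mk f)))
        = f r * unitCoeff B s := by
    intro f r s
    rw [PowerSeries.coeff_C, unitCoeff]
    split_ifs <;> simp
  have c7 : ∀ (f : ℕ → B) (r s : ℕ),
      PowerSeries.coeff r (PowerSeries.coeff s (PowerSeries.map PowerSeries.C (PowerSeries.mk f)))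
        = unitCoeff B r * f s := by
    intro f r s
    rw [PowerSeries.coeff_map, PowerSeries.coeff_C, PowerSeries.coeff_mk, unitCoeff]
    split_ifs <;> simp
  ext s r
  rw [hd', hd', hz, hh']
  have key := H.translate hh hx hy hn hnil i j k l r s
  have lhs := fun a a' b b' : B => commutator_translate hh hx hy a a' b b'
  rw [lhs] at key
  simp only [pre_mul, mul_pre, pre_sub] at key
  rw [add_mul, sub_mul]
  simp only [map_add, map_sub, c1, c2, c3, c4, c5, c6, c7]
  exact key

end RTT

/-! ### Matrices on tensor powers -/

/-- Tensor factors labelled by a set `ι` that is identified with the disjoint union of two sets. -/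
def splitIndex {ι κ κ' : Type*} (N : ℕ) (q : κ ⊕ κ' ≃ ι) : (ι → Fin N) ≃ (κ → Fin N) × (κ' → Fin N) :=
  (q.arrowCongr (Equiv.refl (Fin N))).symm.trans (Equiv.sumArrowEquivProdArrow κ κ' (Fin N))

theorem splitIndex_fst {N : ℕ} {ι κ κ' : Type*} (q : κ ⊕ κ' ≃ ι) (I : ι → Fin N) (a : κ) :
    (splitIndex N q I).1 a = I (q (Sum.inl a)) := rfl

theorem splitIndex_snd {N : ℕ} {ι κ κ' : Type*} (q : κ ⊕ κ' ≃ ι) (I : ι → Fin N) (b : κ') :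
    (splitIndex N q I).2 b = I (q (Sum.inr b)) := rfl

section TensorMatrices

variable {N : ℕ} {ι : Type*} [Fintype ι] [DecidableEq ι] {R R' : Type*} [Ring R] [Ring R']

/-- The matrix `X` placed in the tensor factor `a`. -/
def copy (a : ι) (X : Matrix (Fin N) (Fin N) R) : Matrix (ι → Fin N) (ι → Fin N) R :=
  Matrix.of fun I J => if ∀ b, b ≠ a → I b = J b then X (I a) (J a) else 0

theorem copy_apply (a : ι) (X : Matrix (Fin N) (Fin N) R) (I J : ι → Fin N) :
    copy a X I J = if ∀ b, b ≠ a → I b = J b then X (I a) (J a) else 0 := rfl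

theorem map_copy (f : R →+* R') (a : ι) (X : Matrix (Fin N) (Fin N) R) :
    f.mapMatrix (copy a X) = copy a (f.mapMatrix X) := by
  ext I J
  simp only [RingHom.mapMatrix_apply, Matrix.map_apply, copy_apply, apply_ite f, map_zero]

variable (N R) in
/-- The permutation matrix on the tensor power. -/
def permMat : Equiv.Perm ι →* Matrix (ι → Fin N) (ι → Fin N) R where
  toFun s := Matrix.of fun I J => if I = J ∘ ⇑s⁻¹ then 1 else 0
  map_one' := by
    ext I J
    simp [Matrix.one_apply]
  map_mul' s t := by
    ext I J
    rw [Matrix.mul_apply, Finset.sum_eq_single (J ∘ ⇑t⁻¹)]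
    · simp [mul_inv_rev, Function.comp_assoc]
    · intro K _ hK
      simp only [Matrix.of_apply]
      rw [if_neg hK, mul_zero]
    · simp

theorem permMat_apply (s : Equiv.Perm ι) (I J : ι → Fin N) :
    permMat N R s I J = if I = J ∘ ⇑s⁻¹ then 1 else 0 := rfl

theorem map_permMat (f : R →+* R') (s : Equiv.Perm ι) :
    f.mapMatrix (permMat N R s) = permMat N R' s := by
  ext I J
  simp only [RingHom.mapMatrix_apply, Matrix.map_apply, permMat_apply, apply_ite f, map_zero,
    map_one]

theorem permMat_mul_apply (s : Equiv.Perm ι) (A : Matrix (ι → Fin N) (ι → Fin N) R)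
    (I J : ι → Fin N) : (permMat N R s * A) I J = A (I ∘ s) J := by
  rw [Matrix.mul_apply, Finset.sum_eq_single (I ∘ s)]
  · rw [permMat_apply, if_pos (by ext b; simp), one_mul]
  · intro K _ hK
    rw [permMat_apply, if_neg, zero_mul]
    rintro rfl
    exact hK (by ext b; simp)
  · simp

theorem mul_permMat_apply (s : Equiv.Perm ι) (A : Matrix (ι → Fin N) (ι → Fin N) R)
    (I J : ι → Fin N) : (A * permMat N R s) I J = A I (J ∘ ⇑s⁻¹) := by
  rw [Matrix.mul_apply, Finset.sum_eq_single (J ∘ ⇑s⁻¹)]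
  · simp [permMat_apply]
  · intro K _ hK
    rw [permMat_apply, if_neg hK, mul_zero]
  · simp

theorem permMat_mul_copy (s : Equiv.Perm ι) (a : ι) (X : Matrix (Fin N) (Fin N) R) :
    permMat N R s * copy a X = copy (s a) X * permMat N R s := by
  ext I J
  rw [permMat_mul_apply, mul_permMat_apply, copy_apply, copy_apply]
  have : (∀ b, b ≠ a → (I ∘ s) b = J b) ↔ (∀ b, b ≠ s a → I b = (J ∘ ⇑s⁻¹) b) := by
    constructor
    · intro h b hb
      have := h (s⁻¹ b) (by rintro rfl; simp at hb)
      simpa using this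
    · intro h b hb
      have := h (s b) (by simpa using hb)
      simpa using this
  rw [if_congr this rfl rfl, Function.comp_apply, Function.comp_apply,
    show s⁻¹ (s a) = a from s.symm_apply_apply a]

theorem permMat_swap_commute_copy {a b c : ι} (ha : c ≠ a) (hb : c ≠ b)
    (X : Matrix (Fin N) (Fin N) R) : Commute (permMat N R (Equiv.swap a b)) (copy c X) := by
  have := permMat_mul_copy (Equiv.swap a b) c X
  rwa [Equiv.swap_apply_of_ne_of_ne ha hb] at this

theorem copy_mul_copy {a b : ι} (hab : a ≠ b) (X Y : Matrix (Fin N) (Fin N) R) (I J : ι → Fin N) :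
    (copy a X * copy b Y) I J
      = if ∀ c, c ≠ a → c ≠ b → I c = J c then X (I a) (J a) * Y (I b) (J b) else 0 := by
  rw [Matrix.mul_apply, Finset.sum_eq_single (Function.update I a (J a))]
  · rw [copy_apply, if_pos fun c hc => by simp [hc], copy_apply]
    simp only [Function.update_self, Function.update_of_ne hab.symm]
    have : (∀ c, c ≠ b → Function.update I a (J a) c = J c) ↔ ∀ c, c ≠ a → c ≠ b → I c = J c := by
      constructor
      · intro h c hca hcb
        have := h c hcb
        rwa [Function.update_of_ne hca] at this
      · intro h c hc
        rcases eq_or_ne c a with rfl | hca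
        · simp
        · rw [Function.update_of_ne hca, h c hca hc]
    simp only [this]
    split_ifs <;> simp
  · intro K _ hK
    rw [copy_apply, copy_apply]
    by_cases h1 : ∀ c, c ≠ a → I c = K c
    · rw [if_neg (c := ∀ c, c ≠ b → K c = J c), mul_zero]
      intro h2
      refine hK (funext fun c => ?_)
      rcases eq_or_ne c a with rfl | hca
      · rw [Function.update_self, h2 c hab]
      · rw [Function.update_of_ne hca, h1 c hca]
    · rw [if_neg h1, zero_mul]
  · simp

variable {Z : Type*} [CommRing Z] [Algebra Z R]

/-- All tensor factors other than `a` and `b` contribute the same Kronecker symbols to each term, so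
each matrix entry reduces to `H` for the four remaining indices. -/
theorem rtt_copy {a b : ι} (hab : a ≠ b) {X Y : Matrix (Fin N) (Fin N) R} {z h : Z}
    (H : ∀ i j k l, z • (X i j * Y k l - Y k l * X i j) = h • (X k j * Y i l - Y k j * X i l)) :
    (z • 1 - h • permMat N R (Equiv.swap a b)) * copy a X * copy b Y
      = copy b Y * copy a X * (z • 1 - h • permMat N R (Equiv.swap a b)) := by
  ext I J
  simp only [mul_assoc, sub_mul, mul_sub, smul_mul_assoc, mul_smul_comm, one_mul, mul_one]
  rw [← mul_assoc (copy b Y) (copy a X) (permMat N R _)]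
  simp only [Matrix.sub_apply, Matrix.smul_apply, permMat_mul_apply, mul_permMat_apply,
    copy_mul_copy hab, copy_mul_copy hab.symm]
  have c1 : (∀ c, c ≠ a → c ≠ b → (I ∘ ⇑(Equiv.swap a b)) c = J c)
      ↔ ∀ c, c ≠ a → c ≠ b → I c = J c := by
    refine forall_congr' fun c => forall_congr' fun ha => forall_congr' fun hb => ?_
    rw [Function.comp_apply, Equiv.swap_apply_of_ne_of_ne ha hb]
  have c2 : (∀ c, c ≠ b → c ≠ a → I c = (J ∘ ⇑(Equiv.swap a b)⁻¹) c)
      ↔ ∀ c, c ≠ a → c ≠ b → I c = J c := by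
    refine forall_congr' fun c => ⟨fun h ha hb => ?_, fun h hb ha => ?_⟩
    · have := h hb ha
      rwa [Equiv.swap_inv, Function.comp_apply, Equiv.swap_apply_of_ne_of_ne ha hb] at this
    · rw [Equiv.swap_inv, Function.comp_apply, Equiv.swap_apply_of_ne_of_ne ha hb, h ha hb]
  have c3 : (∀ c, c ≠ b → c ≠ a → I c = J c) ↔ ∀ c, c ≠ a → c ≠ b → I c = J c :=
    forall_congr' fun c => ⟨fun h ha hb => h hb ha, fun h hb ha => h ha hb⟩
  simp only [c1, c2, c3]
  split_ifs
  · have := H (I a) (J a) (I b) (J b)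
    simp only [Function.comp_apply, Equiv.swap_inv, Equiv.swap_apply_left, Equiv.swap_apply_right]
    rw [smul_sub, smul_sub] at this
    rw [sub_eq_sub_iff_sub_eq_sub]
    exact this
  · simp

/-- The form with the `R`-matrix on the right of `X_a Y_b`, as required by `FusionData.rel`. -/
theorem rtt_copy' {a b : ι} (hab : a ≠ b) {X Y : Matrix (Fin N) (Fin N) R} {z : Z}
    (H : ∀ i j k l, z • (X i j * Y k l - Y k l * X i j) = X i l * Y k j - Y i l * X k j) :
    copy a X * copy b Y * (z • 1 - permMat N R (Equiv.swap a b))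
      = (z • 1 - permMat N R (Equiv.swap a b)) * copy b Y * copy a X := by
  ext I J
  simp only [sub_mul, mul_sub, smul_mul_assoc, mul_smul_comm, one_mul, mul_one]
  rw [mul_assoc (permMat N R _) (copy b Y) (copy a X)]
  simp only [Matrix.sub_apply, Matrix.smul_apply, permMat_mul_apply, mul_permMat_apply,
    copy_mul_copy hab, copy_mul_copy hab.symm]
  have c1 : (∀ c, c ≠ b → c ≠ a → (I ∘ ⇑(Equiv.swap a b)) c = J c)
      ↔ ∀ c, c ≠ a → c ≠ b → I c = J c := by
    refine forall_congr' fun c => ⟨fun h ha hb => ?_, fun h hb ha => ?_⟩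
    · have := h hb ha
      rwa [Function.comp_apply, Equiv.swap_apply_of_ne_of_ne ha hb] at this
    · rw [Function.comp_apply, Equiv.swap_apply_of_ne_of_ne ha hb, h ha hb]
  have c2 : (∀ c, c ≠ a → c ≠ b → I c = (J ∘ ⇑(Equiv.swap a b)⁻¹) c)
      ↔ ∀ c, c ≠ a → c ≠ b → I c = J c := by
    refine forall_congr' fun c => forall_congr' fun ha => forall_congr' fun hb => ?_
    rw [Equiv.swap_inv, Function.comp_apply, Equiv.swap_apply_of_ne_of_ne ha hb]
  have c3 : (∀ c, c ≠ b → c ≠ a → I c = J c) ↔ ∀ c, c ≠ a → c ≠ b → I c = J c :=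
    forall_congr' fun c => ⟨fun h ha hb => h hb ha, fun h hb ha => h ha hb⟩
  simp only [c1, c2, c3]
  split_ifs
  · have := H (I a) (J a) (I b) (J b)
    simp only [Function.comp_apply, Equiv.swap_inv, Equiv.swap_apply_left, Equiv.swap_apply_right]
    rw [smul_sub] at this
    rw [sub_eq_sub_iff_sub_eq_sub]
    exact this
  · simp

/-! ### The action of the group algebra -/

variable {m : ℕ}

variable (N) in
/-- The action of the group algebra by permutations of some of the tensor factors. -/
def permHom (σ : ℂ →+* R) (hσ : ∀ z y, Commute (σ z) y) (φ : Equiv.Perm (Fin m) →* Equiv.Perm ι) :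
    MonoidAlgebra ℂ (Equiv.Perm (Fin m)) →+* Matrix (ι → Fin N) (ι → Fin N) R :=
  MonoidAlgebra.liftNCRingHom ((Matrix.scalar (ι → Fin N)).comp σ) ((permMat N R).comp φ)
    fun z _ => Matrix.scalar_commute _ (hσ z) _

variable {σ : ℂ →+* R} (hσ : ∀ z y, Commute (σ z) y) {φ : Equiv.Perm (Fin m) →* Equiv.Perm ι}

theorem permHom_single (s : Equiv.Perm (Fin m)) (z : ℂ) :
    permHom N σ hσ φ (MonoidAlgebra.single s z)
      = Matrix.scalar (ι → Fin N) (σ z) * permMat N R (φ s) := by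
  simp [permHom]

theorem permHom_of (s : Equiv.Perm (Fin m)) :
    permHom N σ hσ φ (MonoidAlgebra.of ℂ _ s) = permMat N R (φ s) := by
  rw [MonoidAlgebra.of_apply, permHom_single, map_one, map_one, one_mul]

theorem permHom_algebraMap (z : ℂ) :
    permHom N σ hσ φ (algebraMap ℂ _ z) = Matrix.scalar (ι → Fin N) (σ z) := by
  have := permHom_single (N := N) hσ (φ := φ) 1 z
  rw [map_one, map_one, mul_one] at this
  exact this

theorem permHom_algebraMap_commute (z : ℂ) (y : Matrix (ι → Fin N) (ι → Fin N) R) :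
    Commute (permHom N σ hσ φ (algebraMap ℂ _ z)) y := by
  rw [permHom_algebraMap]
  exact Matrix.scalar_commute _ (hσ z) _

theorem map_permHom (f : R →+* R') {σ' : ℂ →+* R'} (hσ' : ∀ z y, Commute (σ' z) y)
    (h : ∀ z, f (σ z) = σ' z) (x : MonoidAlgebra ℂ (Equiv.Perm (Fin m))) :
    f.mapMatrix (permHom N σ hσ φ x) = permHom N σ' hσ' φ x := by
  induction x using MonoidAlgebra.induction_linear with
  | zero => rw [map_zero, map_zero, map_zero]
  | add x y hx hy => rw [map_add, map_add, map_add, hx, hy]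
  | single s z =>
    rw [permHom_single, permHom_single, map_mul, map_permMat, ← h]
    congr 1
    ext I J
    simp [Matrix.diagonal_apply, apply_ite f]

theorem permHom_apply {σ : ℂ →+* R} (hσ : ∀ z y, Commute (σ z) y)
    (x : MonoidAlgebra ℂ (Equiv.Perm (Fin m))) :
    permHom N σ hσ (MonoidHom.id (Equiv.Perm (Fin m))) x = σ.mapMatrix (permOperator N x) := by
  induction x using MonoidAlgebra.induction_linear with
  | zero =>
    rw [map_zero]
    ext I J
    simp [permOperator]
  | add x y hx hy =>
    rw [map_add, hx, hy, ← map_add]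
    congr 1
    ext I J
    simp only [permOperator, Matrix.add_apply, Matrix.of_apply, MonoidAlgebra.coeff_add,
      Finsupp.add_apply, ← Finset.sum_add_distrib]
    refine Finset.sum_congr rfl fun s _ => ?_
    split_ifs <;> simp
  | single s z =>
    rw [permHom_single]
    ext I J
    simp only [permOperator, RingHom.mapMatrix_apply, Matrix.map_apply, Matrix.of_apply,
      MonoidAlgebra.coeff_single, MonoidHom.id_apply]
    rw [Finset.sum_eq_single s]
    · simp only [Matrix.scalar_apply, Matrix.diagonal_mul, permMat_apply]
      split_ifs <;> simp
    · intro t _ ht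
      simp [ht.symm]
    · simp

/-! ### Cyclicity of the trace -/

/-- Over a noncommutative ring the trace is cyclic only for factors whose entries are central. -/
theorem cyclic_of_commute {α : Type*} [Fintype α] [DecidableEq α] {C : Matrix α α R}
    (h : ∀ i j y, Commute (C i j) y) :
    Cyclic (Matrix.traceLinearMap α Z R) C := by
  intro Y
  simp only [Matrix.traceLinearMap_apply, Matrix.trace, Matrix.diag, Matrix.mul_apply]
  rw [Finset.sum_comm]
  exact Finset.sum_congr rfl fun i _ => Finset.sum_congr rfl fun j _ => ((h i j _).eq).symm

theorem cyclic_permMat (s : Equiv.Perm ι) :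
    Cyclic (Matrix.traceLinearMap (ι → Fin N) Z R) (permMat N R s) :=
  cyclic_of_commute fun i j y => by
    rw [permMat_apply]
    split_ifs
    · exact Commute.one_left y
    · exact Commute.zero_left y

theorem cyclic_permHom (x : MonoidAlgebra ℂ (Equiv.Perm (Fin m))) :
    Cyclic (Matrix.traceLinearMap (ι → Fin N) Z R) (permHom N σ hσ φ x) := by
  induction x using MonoidAlgebra.induction_linear with
  | zero => intro Y; simp
  | add x y hx hy => intro Y; rw [map_add, mul_add, add_mul, map_add, map_add, hx, hy]
  | single s z =>
    rw [permHom_single]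
    refine Cyclic.mul (cyclic_of_commute fun i j y => ?_) (cyclic_permMat _)
    rw [Matrix.scalar_apply, Matrix.diagonal_apply]
    split_ifs
    · exact hσ z y
    · exact Commute.zero_left y

/-! ### Matrices on tensor products -/

section Product

variable {α β γ : Type*} [Fintype α] [Fintype β] [Fintype γ] [DecidableEq α] [DecidableEq β]
  [DecidableEq γ]

/-- The matrix `X ⊗ 1`. -/
def leftFactor (R : Type*) [Ring R] (p : γ ≃ α × β) : Matrix α α R →+* Matrix γ γ R where
  toFun X := Matrix.of fun i j => if (p i).2 = (p j).2 then X (p i).1 (p j).1 else 0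
  map_one' := by
    ext i j
    simp only [Matrix.of_apply, Matrix.one_apply, ← ite_and]
    have : ((p i).2 = (p j).2 ∧ (p i).1 = (p j).1) ↔ i = j := by
      rw [and_comm, ← Prod.ext_iff, p.apply_eq_iff_eq]
    simp [this]
  map_zero' := by
    ext i j
    simp
  map_add' X Y := by
    ext i j
    simp only [Matrix.of_apply, Matrix.add_apply]
    split_ifs <;> simp
  map_mul' X Y := by
    ext i j
    simp only [Matrix.of_apply, Matrix.mul_apply]
    rw [Fintype.sum_equiv p _ (fun q => (if (p i).2 = q.2 then X (p i).1 q.1 else 0)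
      * (if q.2 = (p j).2 then Y q.1 (p j).1 else 0)) fun k => rfl, Fintype.sum_prod_type]
    split_ifs with h
    · refine Finset.sum_congr rfl fun a _ => ?_
      rw [Finset.sum_eq_single (p i).2] <;> simp +contextual [h, eq_comm]
    · refine (Finset.sum_eq_zero fun a _ => Finset.sum_eq_zero fun b _ => ?_).symm
      by_cases h1 : (p i).2 = b
      · subst h1; simp [h]
      · simp [h1]

theorem leftFactor_apply (p : γ ≃ α × β) (X : Matrix α α R) (i j : γ) :
    leftFactor R p X i j = if (p i).2 = (p j).2 then X (p i).1 (p j).1 else 0 := rfl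

/-- The diagonal entries of `(X ⊗ 1)(1 ⊗ Y)` are products of diagonal entries in this order, so no
commutation between `X` and `Y` is needed. -/
theorem trace_leftFactor_mul (p : γ ≃ α × β) (X : Matrix α α R) (Y : Matrix β β R) :
    (leftFactor R p X * leftFactor R (p.trans (Equiv.prodComm α β)) Y).trace
      = X.trace * Y.trace := by
  have h : ∀ i, (leftFactor R p X * leftFactor R (p.trans (Equiv.prodComm α β)) Y) i i
      = X (p i).1 (p i).1 * Y (p i).2 (p i).2 := by
    intro i
    rw [Matrix.mul_apply, Finset.sum_eq_single i]
    · simp [leftFactor_apply]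
    · intro k _ hk
      simp only [leftFactor_apply, Equiv.trans_apply, Equiv.prodComm_apply, Prod.fst_swap,
        Prod.snd_swap]
      by_cases h1 : (p i).2 = (p k).2
      · have h2 : (p k).1 ≠ (p i).1 := fun h2 => hk (p.injective (Prod.ext h2 h1.symm))
        simp [h2]
      · rw [if_neg h1, zero_mul]
    · simp
  simp only [Matrix.trace, Matrix.diag, h]
  rw [Fintype.sum_equiv p _ (fun q : α × β => X q.1 q.1 * Y q.2 q.2) fun k => rfl,
    Fintype.sum_prod_type, Finset.sum_mul_sum]

theorem leftFactor_scalar (p : γ ≃ α × β) (z : R) :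
    leftFactor R p (Matrix.scalar α z) = Matrix.scalar γ z := by
  ext i j
  simp only [leftFactor_apply, Matrix.scalar_apply, Matrix.diagonal_apply, ← ite_and]
  have : ((p i).2 = (p j).2 ∧ (p i).1 = (p j).1) ↔ i = j := by
    rw [and_comm, ← Prod.ext_iff, p.apply_eq_iff_eq]
  simp [this]

end Product

section SumIndex

variable {κ κ' : Type*} [Fintype κ] [Fintype κ'] [DecidableEq κ] [DecidableEq κ']

theorem leftFactor_copy (q : κ ⊕ κ' ≃ ι) (a : κ) (X : Matrix (Fin N) (Fin N) R) :
    leftFactor R (splitIndex N q) (copy a X) = copy (q (Sum.inl a)) X := by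
  ext I J
  rw [leftFactor_apply, copy_apply, copy_apply, ← ite_and]
  have : ((splitIndex N q I).2 = (splitIndex N q J).2
      ∧ ∀ b, b ≠ a → (splitIndex N q I).1 b = (splitIndex N q J).1 b)
      ↔ ∀ b, b ≠ q (Sum.inl a) → I b = J b := by
    rw [funext_iff, ← q.forall_congr_right, Sum.forall, and_comm]
    simp [splitIndex_fst, splitIndex_snd]
  exact if_congr this rfl rfl

theorem leftFactor_permMat (q : κ ⊕ κ' ≃ ι) (s : Equiv.Perm κ) (t : Equiv.Perm ι)
    (h1 : ∀ a, t (q (Sum.inl a)) = q (Sum.inl (s a))) (h2 : ∀ b, t (q (Sum.inr b)) = q (Sum.inr b)) :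
    leftFactor R (splitIndex N q) (permMat N R s) = permMat N R t := by
  ext I J
  rw [leftFactor_apply, permMat_apply, permMat_apply, ← ite_and]
  have e1 : ∀ a, t⁻¹ (q (Sum.inl a)) = q (Sum.inl (s⁻¹ a)) := fun a => by
    rw [Equiv.Perm.inv_eq_iff_eq, h1]; simp
  have e2 : ∀ b, t⁻¹ (q (Sum.inr b)) = q (Sum.inr b) := fun b => by
    rw [Equiv.Perm.inv_eq_iff_eq, h2]
  have : ((splitIndex N q I).2 = (splitIndex N q J).2
      ∧ (splitIndex N q I).1 = (splitIndex N q J).1 ∘ ⇑s⁻¹) ↔ I = J ∘ ⇑t⁻¹ := by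
    rw [funext_iff, funext_iff, funext_iff (g := J ∘ ⇑t⁻¹),
      ← q.forall_congr_right (q := fun a => I a = (J ∘ ⇑t⁻¹) a), Sum.forall, and_comm]
    simp only [splitIndex_fst, splitIndex_snd, Function.comp_apply, e1, e2]
  simp only [this]

theorem leftFactor_permHom (q : Fin m ⊕ κ' ≃ ι)
    (h1 : ∀ s a, φ s (q (Sum.inl a)) = q (Sum.inl (s a)))
    (h2 : ∀ s b, φ s (q (Sum.inr b)) = q (Sum.inr b))
    (x : MonoidAlgebra ℂ (Equiv.Perm (Fin m))) :
    leftFactor R (splitIndex N q) (permHom N σ hσ (MonoidHom.id _) x) = permHom N σ hσ φ x := by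
  induction x using MonoidAlgebra.induction_linear with
  | zero => rw [map_zero, map_zero, map_zero]
  | add x y hx hy => rw [map_add, map_add, map_add, hx, hy]
  | single s z =>
    rw [permHom_single, permHom_single, map_mul, leftFactor_scalar,
      MonoidHom.id_apply, leftFactor_permMat q s (φ s) (h1 s) (h2 s)]

end SumIndex

end TensorMatrices

section

open Polynomial

/-! ### Power series in `u` and `v` -/

section TwoVariables

variable {B B' : Type*} [Ring B] [Ring B']

/-- Power series in two variables `u` (inner) and `v` (outer). -/
abbrev Two (B : Type*) [Ring B] : Type _ := PowerSeries (PowerSeries B)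

/-- Constant power series in two variables. -/
def twoC (B : Type*) [Ring B] : B →+* Two B :=
  (PowerSeries.C (R := PowerSeries B)).comp (PowerSeries.C (R := B))

/-- The coefficientwise map of power series in two variables. -/
def twoMap (f : B →+* B') : Two B →+* Two B' := PowerSeries.map (PowerSeries.map f)

theorem twoMap_twoC (f : B →+* B') (b : B) : twoMap f (twoC B b) = twoC B' (f b) := by
  simp [twoMap, twoC]

theorem twoC_commute {b : B} (hb : ∀ y, Commute b y) (f : Two B) : Commute (twoC B b) f :=
  commute_C (commute_C hb) f

theorem twoC_mem_center {b : B} (hb : ∀ y, Commute b y) : twoC B b ∈ Subring.center (Two B) :=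
  Subring.mem_center_iff.2 fun f => (twoC_commute hb f).symm.eq

/-- The element `u - v`. -/
def diffUV (B : Type*) [Ring B] : Subring.center (Two B) :=
  ⟨PowerSeries.C PowerSeries.X - PowerSeries.X, sub_mem
    (Subring.mem_center_iff.2 fun f =>
      (commute_C (fun g => (PowerSeries.commute_X g).symm) f).symm.eq)
    (Subring.mem_center_iff.2 fun f => PowerSeries.commute_X f)⟩

theorem twoMap_diffUV (f : B →+* B') :
    twoMap f (diffUV B : Two B) = (diffUV B' : Two B') := by
  simp [twoMap, diffUV]

/-- Comparing coefficients of powers of `v` in increasing order, each coefficient of `y` is killed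
by `u`. -/
theorem diffUV_regular (y : Two B) (h : diffUV B • y = 0) : y = 0 := by
  change (PowerSeries.C PowerSeries.X - PowerSeries.X) * y = 0 at h
  rw [sub_mul, sub_eq_zero] at h
  ext s : 1
  rw [map_zero]
  induction s with
  | zero =>
    have := congrArg (PowerSeries.coeff 0) h
    rw [PowerSeries.coeff_C_mul, PowerSeries.coeff_zero_X_mul] at this
    exact PowerSeries.X_mul_cancel (this.trans (mul_zero _).symm)
  | succ s ih =>
    have := congrArg (PowerSeries.coeff (s + 1)) h
    rw [PowerSeries.coeff_C_mul, PowerSeries.coeff_succ_X_mul, ih] at this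
    exact PowerSeries.X_mul_cancel (this.trans (mul_zero _).symm)

/-- On an element killed by `d + ν`, `d` acts as `-ν`; a power of `d` then kills it, and `d` is
regular. -/
theorem regular_add_nilpotent {Z A : Type*} [CommRing Z] [AddCommGroup A] [Module Z A] {d ν : Z}
    (hd : ∀ y : A, d • y = 0 → y = 0) (hν : IsNilpotent ν) (y : A) (h : (d + ν) • y = 0) :
    y = 0 := by
  obtain ⟨k, hk⟩ := hν
  have h1 : ∀ j : ℕ, d ^ j • y = (-ν) ^ j • y := by
    intro j
    induction j with
    | zero => simp
    | succ j ih =>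
      have : d • y = (-ν) • y := by
        rw [add_smul] at h
        rw [neg_smul]
        exact eq_neg_of_add_eq_zero_left h
      rw [pow_succ', mul_smul, ih, smul_comm, this, smul_smul, ← pow_succ]
  have h2 : d ^ k • y = 0 := by rw [h1, neg_pow, hk, mul_zero, zero_smul]
  clear h1 hk
  induction k with
  | zero => simpa using h2
  | succ k ih =>
    rw [pow_succ', mul_smul] at h2
    exact ih (hd _ h2)

/-- The parameter `c ∈ ℤ` is substituted for the polynomial variable. -/
def evPoly (B : Type*) [Ring B] (c : ℤ) : B[X] →+* B :=
  eval₂RingHom' (RingHom.id B) (c : B) fun a => (Int.cast_commute c a).symm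

theorem evPoly_C (c : ℤ) (b : B) : evPoly B c (C b) = b := eval₂_C _ _

theorem evPoly_X (c : ℤ) : evPoly B c X = c := eval₂_X _ _

theorem twoMap_ev_C (c : ℤ) (y : Two B) : twoMap (evPoly B c) (twoMap C y) = y := by
  ext s r
  simp [twoMap, evPoly_C]

theorem polyC_commute {b : B} (hb : ∀ y, Commute b y) (y : B[X]) : Commute (C b) y := by
  ext k
  rw [coeff_C_mul, coeff_mul_C, (hb _).eq]

theorem polyX_commute (y : B[X]) : Commute (X : B[X]) y := (commute_X y)

/-- The formal parameter of the family of matrices. -/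
def param (B : Type*) [Ring B] : Subring.center (Two B[X]) :=
  ⟨twoC B[X] X, twoC_mem_center polyX_commute⟩

theorem param_sub_int_smul (c : ℤ) (y : Two B[X]) :
    (param B - c) • y = twoC B[X] (X - C (c : B)) * y := by
  have : ((param B - c : Subring.center (Two B[X])) : Two B[X]) = twoC B[X] (X - C (c : B)) := by
    simp [param]
  rw [← this]
  rfl

theorem param_sub_int_regular (c : ℤ) (y : Two B[X]) (h : (param B - c) • y = 0) : y = 0 := by
  rw [param_sub_int_smul] at h
  ext s r : 2
  have := congrArg (fun f => PowerSeries.coeff r (PowerSeries.coeff s f)) h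
  simp only [twoC, RingHom.comp_apply, PowerSeries.coeff_C_mul, map_zero] at this
  rw [(monic_X_sub_C _).mul_right_eq_zero_iff] at this
  simpa using this

end TwoVariables

/-! ### Fusion for the Yangian -/

section Yangian

variable {B : Type*} [Ring B] [Algebra ℂ B]

/-- The scalars in power series in two variables. -/
def twoScalar (B : Type*) [Ring B] [Algebra ℂ B] : ℂ →+* Two B := (twoC B).comp (algebraMap ℂ B)

theorem twoScalar_commute (z : ℂ) (y : Two B) : Commute (twoScalar B z) y :=
  twoC_commute (fun b => Algebra.commutes z b) y

theorem twoMap_C_twoScalar (z : ℂ) : twoMap C (twoScalar B z) = twoScalar B[X] z := by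
  rw [twoScalar, RingHom.comp_apply, twoMap_twoC]
  rfl

variable {N m : ℕ} {g : ℕ → Fin m} {ι : Type*} [Fintype ι] [DecidableEq ι]

/-- The action of the group algebra on matrices over power series in two variables. -/
abbrev twoPerm (N : ℕ) (B : Type*) [Ring B] [Algebra ℂ B]
    (φ : Equiv.Perm (Fin m) →* Equiv.Perm ι) :
    MonoidAlgebra ℂ (Equiv.Perm (Fin m)) →+* Matrix (ι → Fin N) (ι → Fin N) (Two B) :=
  permHom N (twoScalar B) twoScalar_commute φ

variable {φ : Equiv.Perm (Fin m) →* Equiv.Perm ι} {e : Fin m → ι}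

theorem twoPerm_swapElt (hφ : ∀ x y, φ (Equiv.swap x y) = Equiv.swap (e x) (e y)) (a b : ℕ) :
    twoPerm N B φ (swapElt g a b) = permMat N (Two B) (Equiv.swap (e (g a)) (e (g b))) := by
  rw [swapElt, permHom_of, hφ]

theorem int_smul_regular {α : Type*} (c : ℤ) (y : Matrix α α (Two B)) (hc : c ≠ 0)
    (h : c • y = 0) : y = 0 := by
  ext i j s r
  have := congrArg (fun f => PowerSeries.coeff r (PowerSeries.coeff s (f i j))) h
  simp only [Matrix.smul_apply, map_zsmul, Matrix.zero_apply, map_zero] at this ⊢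
  rw [← Int.cast_smul_eq_zsmul ℂ] at this
  exact (smul_eq_zero.1 this).resolve_left (by exact_mod_cast hc)

theorem matrix_smul_regular {α Z A : Type*} [CommRing Z] [Ring A] [Algebra Z A] {z : Z}
    (hz : ∀ y : A, z • y = 0 → y = 0) (y : Matrix α α A) (h : z • y = 0) : y = 0 := by
  ext i j
  exact hz _ (congrFun (congrFun h i) j)

/-- The fusion data of a family of matrices on a tensor power. -/
def matrixFusionData (hφ : ∀ x y, φ (Equiv.swap x y) = Equiv.swap (e x) (e y))
    (T : ℕ → Matrix (ι → Fin N) (ι → Fin N) (Two B[X]))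
    (comm : ∀ a b d, a < m → b < m → d < m → a ≠ b → a ≠ d → b ≠ d →
      Commute (permMat N (Two B[X]) (Equiv.swap (e (g a)) (e (g b)))) (T d))
    (rel : ∀ a b, a < b → b < m → ∀ c : ℤ,
      (twoMap C).mapMatrix ((twoMap (evPoly B c)).mapMatrix (T a)) * T b
          * ((param B - c) • 1 - permMat N (Two B[X]) (Equiv.swap (e (g a)) (e (g b))))
        = ((param B - c) • 1 - permMat N (Two B[X]) (Equiv.swap (e (g a)) (e (g b)))) * T b
          * (twoMap C).mapMatrix ((twoMap (evPoly B c)).mapMatrix (T a))) :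
    FusionData g (Subring.center (Two B[X])) (Matrix (ι → Fin N) (ι → Fin N) (Two B))
      (Matrix (ι → Fin N) (ι → Fin N) (Two B[X])) where
  perm := twoPerm N B φ
  perm' := twoPerm N B[X] φ
  const := (twoMap C).mapMatrix
  ev c := (twoMap (evPoly B c)).mapMatrix
  w := param B
  const_perm := map_permHom _ _ _ twoMap_C_twoScalar
  ev_const c y := by
    ext i j : 1
    exact twoMap_ev_C c _
  ev_w c := by
    ext I J : 1
    rw [RingHom.mapMatrix_apply, Matrix.map_apply, Matrix.algebraMap_matrix_apply,
      Matrix.intCast_apply, apply_ite (twoMap (evPoly B c)), map_zero]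
    split_ifs
    · change twoMap (evPoly B c) (twoC B[X] X) = _
      rw [twoMap_twoC, evPoly_X, map_intCast]
    · simp
  reg c := matrix_smul_regular (param_sub_int_regular c)
  reg_int := int_smul_regular
  perm_scalar := permHom_algebraMap_commute _
  T := T
  comm a b d ha hb hd hab had hbd := by
    rw [twoPerm_swapElt hφ]
    exact comm a b d ha hb hd hab had hbd
  rel a b hab hb c := by
    rw [twoPerm_swapElt hφ]
    exact rel a b hab hb c

theorem map_tSeries {B B' : Type*} [Ring B] [Ring B'] (f : B →+* B') (h x : B) (n : ℕ)
    (τ : Fin N → Fin N → ℕ → B) (i j : Fin N) :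
    PowerSeries.map f (tSeries h x n τ i j)
      = tSeries (f h) (f x) n (fun i j r => f (τ i j r)) i j := by
  ext k
  simp only [tSeries, map_sub, map_mul, PowerSeries.map_C, PowerSeries.coeff_C_mul,
    PowerSeries.coeff_map, PowerSeries.coeff_mk, shift, map_sum, map_pow, map_natCast]
  congr 2
  simp only [delta]
  split_ifs <;> simp

theorem YangianRel.map {B B' : Type*} [Ring B] [Ring B'] (f : B →+* B') {h : B}
    {τ : Fin N → Fin N → ℕ → B} (H : YangianRel h τ) :
    YangianRel (f h) (fun i j r => f (τ i j r)) := by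
  intro i j k l r s
  have := congrArg f (H i j k l r s)
  simpa only [map_sub, map_mul, map_add, map_sum, apply_ite f, map_zero] using this

variable {n : ℕ} {h : B} {τ : Fin N → Fin N → ℕ → B}

/-- The fusion theorem for the generating series of the dual Yangian. -/
theorem fusion_tSeries (hg : ∀ a < m, (g a).val = a) (he : Function.Injective e)
    (hφ : ∀ x y, φ (Equiv.swap x y) = Equiv.swap (e x) (e y)) (H : YangianRel h τ)
    (hh : ∀ b, Commute h b) (hn : 0 < n) (hnil : h ^ n = 0)
    (emb : PowerSeries B →+* Two B) (emb' : PowerSeries B[X] →+* Two B[X])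
    (hemb : ∀ x, twoMap C (emb x) = emb' (PowerSeries.map C x))
    (hemb' : ∀ c x, twoMap (evPoly B c) (emb' x) = emb (PowerSeries.map (evPoly B c) x))
    (hC : ∀ b, emb' (PowerSeries.C b) = twoC B[X] b) (c : ℕ → ℤ) :
    twoPerm N B φ (jointProj g c m)
        * prodUp (fun a => copy (e (g a)) (Matrix.of fun i j => emb (tSeries h (c a) n τ i j))) m
      = prodDown (fun a => copy (e (g a)) (Matrix.of fun i j => emb (tSeries h (c a) n τ i j))) m
        * twoPerm N B φ (jointProj g c m) := by
  -- The content is replaced by the variable of `B[X]`; evaluating it at an integer recovers the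
  -- matrix wanted. The embedding `emb` allows the spectral variable to be either `u` or `v`.
  set T : ℕ → Matrix (ι → Fin N) (ι → Fin N) (Two B[X]) := fun a => copy (e (g a))
    (Matrix.of fun i j => emb' (tSeries (C h) X n (fun i j r => C (τ i j r)) i j)) with hT
  have hev : ∀ a (c : ℤ), (twoMap (evPoly B c)).mapMatrix (T a)
      = copy (e (g a)) (Matrix.of fun i j => emb (tSeries h (c : B) n τ i j)) := by
    intro a c
    rw [hT, map_copy]
    congr 1
    ext i j : 1
    simp only [RingHom.mapMatrix_apply, Matrix.map_apply, Matrix.of_apply, hemb', map_tSeries,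
      evPoly_C, evPoly_X]
  have hne : ∀ {a b}, a < m → b < m → a ≠ b → e (g a) ≠ e (g b) := fun ha hb hab h =>
    label_ne hg ha hb hab (he h)
  have comm : ∀ a b d, a < m → b < m → d < m → a ≠ b → a ≠ d → b ≠ d →
      Commute (permMat N (Two B[X]) (Equiv.swap (e (g a)) (e (g b)))) (T d) :=
    fun a b d ha hb hd hab had hbd => permMat_swap_commute_copy (hne hd ha had.symm)
      (hne hd hb hbd.symm) _
  have rel : ∀ a b, a < b → b < m → ∀ c : ℤ,
      (twoMap C).mapMatrix ((twoMap (evPoly B c)).mapMatrix (T a)) * T b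
          * ((param B - c) • 1 - permMat N (Two B[X]) (Equiv.swap (e (g a)) (e (g b))))
        = ((param B - c) • 1 - permMat N (Two B[X]) (Equiv.swap (e (g a)) (e (g b)))) * T b
          * (twoMap C).mapMatrix ((twoMap (evPoly B c)).mapMatrix (T a)) := by
    intro a b hab hb c
    rw [hev, map_copy]
    refine rtt_copy' (hne (by omega) hb (by omega)) fun i j k l => ?_
    simp only [RingHom.mapMatrix_apply, Matrix.map_apply, Matrix.of_apply, hemb, map_tSeries,
      map_intCast]
    -- The series with indices `k l` carries the free parameter and the one with `i j` the integer
    -- `c`; the goal is the negative of this relation.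
    have key := congrArg emb' ((H.map C).tSeries_one (polyC_commute hh) polyX_commute
      (fun b => Int.cast_commute c b) hn (by rw [← map_pow, hnil, map_zero]) k l i j)
    simp only [map_mul, map_sub, hC] at key
    rw [param_sub_int_smul, map_intCast, map_sub, ← neg_inj, ← mul_neg, neg_sub, neg_sub]
    exact key
  have := (matrixFusionData hφ T comm rel).fusion hg c
  have e1 : ∀ a, (matrixFusionData hφ T comm rel).ev (c a)
      ((matrixFusionData hφ T comm rel).T a)
      = copy (e (g a)) (Matrix.of fun i j => emb (tSeries h (c a) n τ i j)) := fun a => hev a (c a)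
  simp only [e1] at this
  exact this

theorem mapMatrix_center_smul {α A A' : Type*} [Fintype α] [DecidableEq α] [Ring A] [Ring A']
    (f : A →+* A') {z : Subring.center A} {z' : Subring.center A'} (hz : f z = z')
    (M : Matrix α α A) : f.mapMatrix (z • M) = z' • f.mapMatrix M := by
  ext I J
  change f ((z : A) * M I J) = (z' : A') * f (M I J)
  rw [map_mul, hz]

theorem swap_mul_swap_of_ne {ι : Type*} [DecidableEq ι] {x y p : ι} (hx : x ≠ p) (hy : y ≠ p) (hxy : x ≠ y) :
    Equiv.swap y p * Equiv.swap x y = Equiv.swap x y * Equiv.swap x p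
      ∧ Equiv.swap y p * Equiv.swap x p = Equiv.swap x y * Equiv.swap y p := by
  constructor
  · rw [Equiv.mul_swap_eq_swap_mul (Equiv.swap x y) x p, Equiv.swap_apply_left,
      Equiv.swap_apply_of_ne_of_ne hx.symm hy.symm]
  · rw [Equiv.mul_swap_eq_swap_mul (Equiv.swap y p) x p, Equiv.swap_apply_right,
      Equiv.swap_apply_of_ne_of_ne hxy hx]

/-- The fusion theorem for the Yang `R`-matrices. -/
theorem fusion_yang (hg : ∀ a < m, (g a).val = a) (he : Function.Injective e)
    (hφ : ∀ x y, φ (Equiv.swap x y) = Equiv.swap (e x) (e y)) {p : ι} (hp : ∀ a, e a ≠ p)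
    {x h : Subring.center (Two B)} {x' h' : Subring.center (Two B[X])}
    (hx : twoMap C (x : Two B) = x') (hh : twoMap C (h : Two B) = h') (c : ℕ → ℤ) :
    twoPerm N B φ (jointProj g c m) * prodUp (fun a => (x + h * c a) • 1
        - h • permMat N (Two B) (Equiv.swap (e (g a)) p)) m
      = prodDown (fun a => (x + h * c a) • 1 - h • permMat N (Two B) (Equiv.swap (e (g a)) p)) m
        * twoPerm N B φ (jointProj g c m) := by
  -- The `R`-matrices between the factor `a` and the fixed factor `p` play the part of `T a`; their
  -- exchange relation is the Yang–Baxter equation.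
  set T : ℕ → Matrix (ι → Fin N) (ι → Fin N) (Two B[X]) := fun a =>
    (x' + h' * param B) • 1 - h' • permMat N (Two B[X]) (Equiv.swap (e (g a)) p) with hT
  have hx2 : ∀ c : ℤ, twoMap (evPoly B c) x' = x := fun c => by rw [← hx, twoMap_ev_C]
  have hh2 : ∀ c : ℤ, twoMap (evPoly B c) h' = h := fun c => by rw [← hh, twoMap_ev_C]
  have hev : ∀ a (c : ℤ), (twoMap (evPoly B c)).mapMatrix (T a)
      = (x + h * (c : Subring.center (Two B))) • 1 - h • permMat N (Two B) (Equiv.swap (e (g a)) p) := by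
    intro a c
    rw [hT]
    simp only [map_sub]
    rw [mapMatrix_center_smul _ (z' := x + h * (c : Subring.center (Two B))) ?_,
      mapMatrix_center_smul _ (hh2 c), map_one, map_permMat]
    simp only [Subring.coe_add, Subring.coe_mul, map_add, map_mul, hx2, hh2, Subring.coe_intCast]
    congr 2
    change twoMap (evPoly B c) (twoC B[X] X) = _
    rw [twoMap_twoC, evPoly_X, map_intCast]
  have hconst : ∀ a (c : ℤ), (twoMap C).mapMatrix ((twoMap (evPoly B c)).mapMatrix (T a))
      = (x' + h' * (c : Subring.center (Two B[X]))) • 1 - h' • permMat N (Two B[X]) (Equiv.swap (e (g a)) p) := by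
    intro a c
    rw [hev, map_sub, mapMatrix_center_smul _ (z' := x' + h' * (c : Subring.center (Two B[X]))) ?_,
      mapMatrix_center_smul _ hh, map_one, map_permMat]
    simp only [Subring.coe_add, Subring.coe_mul, map_add, map_mul, hx, hh, Subring.coe_intCast,
      map_intCast]
  have hne : ∀ {a b}, a < m → b < m → a ≠ b → e (g a) ≠ e (g b) := fun ha hb hab h =>
    label_ne hg ha hb hab (he h)
  have comm : ∀ a b d, a < m → b < m → d < m → a ≠ b → a ≠ d → b ≠ d →
      Commute (permMat N (Two B[X]) (Equiv.swap (e (g a)) (e (g b)))) (T d) := by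
    intro a b d ha hb hd hab had hbd
    refine ((Commute.one_right _).smul_right _).sub_right (Commute.smul_right ?_ _)
    refine Commute.map (f := permMat N (Two B[X])) ?_
    rw [Commute, SemiconjBy, Equiv.mul_swap_eq_swap_mul,
      Equiv.swap_apply_of_ne_of_ne (hne hd ha had.symm) (hne hd hb hbd.symm),
      Equiv.swap_apply_of_ne_of_ne (hp _).symm (hp _).symm]
  have rel : ∀ a b, a < b → b < m → ∀ c : ℤ,
      (twoMap C).mapMatrix ((twoMap (evPoly B c)).mapMatrix (T a)) * T b
          * ((param B - c) • 1 - permMat N (Two B[X]) (Equiv.swap (e (g a)) (e (g b))))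
        = ((param B - c) • 1 - permMat N (Two B[X]) (Equiv.swap (e (g a)) (e (g b)))) * T b
          * (twoMap C).mapMatrix ((twoMap (evPoly B c)).mapMatrix (T a)) := by
    intro a b hab hb c
    rw [hconst]
    have h1 := hne (show a < m by omega) hb (by omega)
    have h2 := hp (g a)
    have h3 := hp (g b)
    refine yang_baxter ?_ ?_ ?_ ?_ x' h' (param B) (c : Subring.center (Two B[X]))
    · rw [← map_mul, ← map_mul, (swap_mul_swap_of_ne h2 h3 h1).1]
    · rw [← map_mul, ← map_mul, Equiv.swap_comm (e (g a)) (e (g b)),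
        (swap_mul_swap_of_ne h3 h2 h1.symm).1]
    · rw [← map_mul, ← map_mul, (swap_mul_swap_of_ne h2 h3 h1).2]
    · rw [← map_mul, ← map_mul, Equiv.swap_comm (e (g a)) (e (g b)),
        (swap_mul_swap_of_ne h3 h2 h1.symm).2]
  have := (matrixFusionData hφ T comm rel).fusion hg c
  have e1 : ∀ a, (matrixFusionData hφ T comm rel).ev (c a)
      ((matrixFusionData hφ T comm rel).T a)
      = (x + h * c a) • 1 - h • permMat N (Two B) (Equiv.swap (e (g a)) p) := fun a => hev a (c a)
  simp only [e1] at this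
  exact this

end Yangian

end

section

open Polynomial

/-! ### Regularity of the unitarity scalars, and the embeddings of series in `u` and in `v` -/

section TwoVariables

variable {B : Type*} [Ring B] {n : ℕ}

theorem isNilpotent_center_twoC {h : B} (hh : ∀ b, Commute h b) (hnil : h ^ n = 0) :
    IsNilpotent (⟨twoC B h, twoC_mem_center hh⟩ : Subring.center (Two B)) := by
  refine ⟨n, Subtype.ext ?_⟩
  rw [Subring.coe_pow]
  change twoC B h ^ n = 0
  rw [← map_pow, hnil, map_zero]

/-- The scalar is `-(u - v)²` plus a multiple of the nilpotent `ν`. -/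
theorem yang_unitarity_regular {ν : Subring.center (Two B)} (hν : IsNilpotent ν)
    (w : Subring.center (Two B)) (y : Two B)
    (hy : (ν * ν - (diffUV B + ν * w) * (diffUV B + ν * w)) • y = 0) : y = 0 := by
  have e : ν * ν - (diffUV B + ν * w) * (diffUV B + ν * w) = -(diffUV B * diffUV B)
      + ν * (ν - 2 * diffUV B * w - ν * w ^ 2) := by ring
  rw [e] at hy
  refine regular_add_nilpotent (fun y hy => ?_) ((Commute.all _ _).isNilpotent_mul_right hν) y hy
  rw [neg_smul, neg_eq_zero, mul_smul] at hy
  exact diffUV_regular _ (diffUV_regular _ hy)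

theorem map_C_comp_C (b : B) : PowerSeries.map (PowerSeries.C (R := B)) (PowerSeries.C b)
    = twoC B b := by
  simp [twoC]

theorem twoMap_map_C {B' : Type*} [Ring B'] (f : B →+* B') (x : PowerSeries B) :
    twoMap f (PowerSeries.map PowerSeries.C x)
      = PowerSeries.map PowerSeries.C (PowerSeries.map f x) := by
  ext s r
  simp [twoMap, PowerSeries.coeff_C]

theorem twoMap_C {B' : Type*} [Ring B'] (f : B →+* B') (x : PowerSeries B) :
    twoMap f (PowerSeries.C x) = PowerSeries.C (PowerSeries.map f x) :=
  PowerSeries.map_C _ _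

theorem coeff_C_mul_map_C (F F' : PowerSeries B) (k k' : ℕ) :
    PowerSeries.coeff k (PowerSeries.coeff k'
      (PowerSeries.C F * PowerSeries.map PowerSeries.C F'))
      = PowerSeries.coeff k F * PowerSeries.coeff k' F' := by
  rw [PowerSeries.coeff_C_mul, PowerSeries.coeff_map, PowerSeries.coeff_mul_C]

theorem coeff_map_C_mul_C (F F' : PowerSeries B) (k k' : ℕ) :
    PowerSeries.coeff k (PowerSeries.coeff k'
      (PowerSeries.map PowerSeries.C F' * PowerSeries.C F))
      = PowerSeries.coeff k' F' * PowerSeries.coeff k F := by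
  rw [PowerSeries.coeff_mul_C, PowerSeries.coeff_map, PowerSeries.coeff_C_mul]

end TwoVariables

/-! ### Commutativity of fused traces with nilpotent `h` -/

section FusedTraces

variable {N : ℕ} {B : Type*} [Ring B] [Algebra ℂ B] {n : ℕ} {h : B} {τ : Fin N → Fin N → ℕ → B}

/-- The scalars in power series. -/
def oneScalar (B : Type*) [Ring B] [Algebra ℂ B] : ℂ →+* PowerSeries B :=
  (PowerSeries.C).comp (algebraMap ℂ B)

theorem oneScalar_commute (z : ℂ) (y : PowerSeries B) : Commute (oneScalar B z) y :=
  commute_C (fun b => Algebra.commutes z b) y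

variable {m m' : ℕ}

/-- The permutations of the left labels. -/
def inlPerm (m m' : ℕ) : Equiv.Perm (Fin m) →* Equiv.Perm (Fin m ⊕ Fin m') :=
  (Equiv.Perm.sumCongrHom _ _).comp (MonoidHom.inl _ _)

/-- The permutations of the right labels. -/
def inrPerm (m m' : ℕ) : Equiv.Perm (Fin m') →* Equiv.Perm (Fin m ⊕ Fin m') :=
  (Equiv.Perm.sumCongrHom _ _).comp (MonoidHom.inr _ _)

theorem inlPerm_swap (x y : Fin m) :
    inlPerm m m' (Equiv.swap x y) = Equiv.swap (Sum.inl x) (Sum.inl y) :=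
  Equiv.Perm.sumCongr_swap_one _ _

theorem inrPerm_swap (x y : Fin m') :
    inrPerm m m' (Equiv.swap x y) = Equiv.swap (Sum.inr x) (Sum.inr y) :=
  Equiv.Perm.sumCongr_one_swap _ _

variable {g : ℕ → Fin m} {g' : ℕ → Fin m'}

theorem twoPerm_jointProj_commute_copy {ι : Type*} [Fintype ι] [DecidableEq ι]
    {φ : Equiv.Perm (Fin m) →* Equiv.Perm ι} {e : Fin m → ι}
    (hφ : ∀ x y, φ (Equiv.swap x y) = Equiv.swap (e x) (e y)) (c : ℕ → ℤ) {p : ι}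
    (hp : ∀ a, p ≠ e a) (X : Matrix (Fin N) (Fin N) (Two B)) :
    Commute (twoPerm N B φ (jointProj g c m)) (copy p X) := by
  refine map_jointProj_commute _ (permHom_algebraMap_commute _) c fun a a' _ _ => ?_
  rw [twoPerm_swapElt hφ]
  exact permMat_swap_commute_copy (hp _) (hp _) _

theorem twoPerm_jointProj_commute {ι : Type*} [Fintype ι] [DecidableEq ι]
    {φ : Equiv.Perm (Fin m) →* Equiv.Perm ι} {e : Fin m → ι}
    {φ' : Equiv.Perm (Fin m') →* Equiv.Perm ι} {e' : Fin m' → ι}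
    (hφ : ∀ x y, φ (Equiv.swap x y) = Equiv.swap (e x) (e y))
    (hφ' : ∀ x y, φ' (Equiv.swap x y) = Equiv.swap (e' x) (e' y)) (hne : ∀ a b, e a ≠ e' b)
    (c c' : ℕ → ℤ) : Commute (twoPerm N B φ (jointProj g c m))
      (twoPerm N B φ' (jointProj g' c' m')) := by
  refine map_jointProj_commute _ (permHom_algebraMap_commute _) c fun a a' _ _ => Commute.symm ?_
  refine map_jointProj_commute _ (permHom_algebraMap_commute _) c' fun b b' _ _ => ?_
  rw [twoPerm_swapElt hφ, twoPerm_swapElt hφ']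
  refine Commute.map (f := permMat N (Two B)) ?_
  rw [Commute, SemiconjBy, Equiv.mul_swap_eq_swap_mul,
    Equiv.swap_apply_of_ne_of_ne (hne _ _) (hne _ _),
    Equiv.swap_apply_of_ne_of_ne (hne _ _) (hne _ _)]

/-- The setting of `trace_fused_comm`: left labels carry the variable `u`, right labels the variable
`v`. -/
theorem fused_trace_comm (hg : ∀ a < m, (g a).val = a) (hg' : ∀ a < m', (g' a).val = a)
    (H : YangianRel h τ) (hh : ∀ b, Commute h b) (hn : 0 < n) (hnil : h ^ n = 0) (c c' : ℕ → ℤ)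
    {EU EV : Matrix (Fin m ⊕ Fin m' → Fin N) (Fin m ⊕ Fin m' → Fin N) (Two B)}
    (hEU : EU = twoPerm N B (inlPerm m m') (jointProj g c m))
    (hEV : EV = twoPerm N B (inrPerm m m') (jointProj g' c' m'))
    {T T' : ℕ → Matrix (Fin m ⊕ Fin m' → Fin N) (Fin m ⊕ Fin m' → Fin N) (Two B)}
    (hT : T = fun a => copy (Sum.inl (g a))
      (Matrix.of fun i j => PowerSeries.C (tSeries h (c a) n τ i j)))
    (hT' : T' = fun b => copy (Sum.inr (g' b))
      (Matrix.of fun i j => PowerSeries.map PowerSeries.C (tSeries h (c' b) n τ i j))) :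
    (EU * prodUp T m * (EV * prodUp T' m')).trace = (EV * prodUp T' m' * (EU * prodUp T m)).trace := by
  set hZ : Subring.center (Two B) := ⟨twoC B h, twoC_mem_center hh⟩ with hZdef
  set hZ' : Subring.center (Two B[X]) :=
    ⟨twoC B[X] (C h), twoC_mem_center (polyC_commute hh)⟩ with hZdef'
  set Q : ℕ → ℕ → Matrix (Fin m ⊕ Fin m' → Fin N) (Fin m ⊕ Fin m' → Fin N) (Two B) :=
    fun a b => permMat N (Two B) (Equiv.swap (Sum.inl (g a)) (Sum.inr (g' b))) with hQdef
  -- The spectral difference `(u + h c_a) - (v + h c'_b)`.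
  set z : ℕ → ℕ → Subring.center (Two B) := fun a b =>
    diffUV B + hZ * ((c a - c' b : ℤ) : Subring.center (Two B)) with hz
  have hreg : ∀ a b, ∀ y : Two B, (hZ * hZ - z a b * z a b) • y = 0 → y = 0 := fun a b =>
    yang_unitarity_regular (isNilpotent_center_twoC hh hnil) _
  have inl_ne : ∀ {a a'}, a < m → a' < m → a ≠ a' →
      (Sum.inl (g a) : Fin m ⊕ Fin m') ≠ Sum.inl (g a') := fun ha ha' hne he =>
    label_ne hg ha ha' hne (Sum.inl_injective he)
  have inr_ne : ∀ {b b'}, b < m' → b' < m' → b ≠ b' →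
      (Sum.inr (g' b) : Fin m ⊕ Fin m') ≠ Sum.inr (g' b') := fun hb hb' hne he =>
    label_ne hg' hb hb' hne (Sum.inr_injective he)
  have hUT : ∀ b < m', Commute EU (T' b) := by
    intro b _
    rw [hEU, hT']
    exact twoPerm_jointProj_commute_copy inlPerm_swap c (fun _ => Sum.inr_ne_inl) _
  have hVT : ∀ a < m, Commute EV (T a) := by
    intro a _
    rw [hEV, hT]
    exact twoPerm_jointProj_commute_copy inrPerm_swap c' (fun _ => Sum.inl_ne_inr) _
  have hEUV : Commute EU EV := by
    rw [hEU, hEV]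
    exact twoPerm_jointProj_commute inlPerm_swap inrPerm_swap (fun _ _ => Sum.inl_ne_inr) c c'
  have hRTT : ∀ a b, a < m → b < m' →
      (z a b • 1 - hZ • Q a b) * T a * T' b = T' b * T a * (z a b • 1 - hZ • Q a b) := by
    intro a b _ _
    rw [hT, hT']
    refine rtt_copy Sum.inl_ne_inr fun i j k l => ?_
    refine H.tSeries_two hh (fun b => Int.cast_commute (c a) b)
      (fun y => Int.cast_commute (c' b) y) hn hnil i j k l ?_ rfl _ _ (fun i j => rfl)
      (fun i j => rfl)
    change PowerSeries.C PowerSeries.X - PowerSeries.X + twoC B h * _ = _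
    congr 1
    simp [twoC]
  have hfT : EU * prodUp T m = prodDown T m * EU := by
    rw [hEU, hT]
    exact fusion_tSeries hg Sum.inl_injective inlPerm_swap H hh hn hnil PowerSeries.C
      PowerSeries.C (twoMap_C _) (fun c => twoMap_C _) (fun b => rfl) c
  have hfT' : EV * prodUp T' m' = prodDown T' m' * EV := by
    rw [hEV, hT']
    exact fusion_tSeries hg' Sum.inr_injective inrPerm_swap H hh hn hnil
      (PowerSeries.map PowerSeries.C) (PowerSeries.map PowerSeries.C) (twoMap_map_C _)
      (fun c => twoMap_map_C _) map_C_comp_C c'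
  have hfU : ∀ b < m', EU * prodUp (fun a => z a b • 1 - hZ • Q a b) m
      = prodDown (fun a => z a b • 1 - hZ • Q a b) m * EU := by
    intro b _
    have := fusion_yang (x := diffUV B - hZ * ((c' b : ℤ) : Subring.center (Two B)))
      (x' := diffUV B[X] - hZ' * ((c' b : ℤ) : Subring.center (Two B[X]))) (h := hZ) (h' := hZ')
      (N := N) hg Sum.inl_injective (inlPerm_swap (m' := m')) (p := Sum.inr (g' b))
      (fun _ => Sum.inl_ne_inr) (by simp [twoMap_diffUV, hZdef, hZdef', twoMap_twoC])
      (twoMap_twoC _ _) c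
    have e : ∀ a, z a b = diffUV B - hZ * ((c' b : ℤ) : Subring.center (Two B))
        + hZ * ((c a : ℤ) : Subring.center (Two B)) := by
      intro a; simp only [hz]; push_cast; ring
    simp only [e, hEU]
    exact this
  have hfV : ∀ a < m, EV * prodUp (fun b => -z a b • 1 - hZ • Q a b) m'
      = prodDown (fun b => -z a b • 1 - hZ • Q a b) m' * EV := by
    intro a _
    -- Here the right labels are fused and the left label `a` is the fixed space, so the relevant
    -- parameter is `v - u - h c_a`.
    have := fusion_yang (x := -diffUV B - hZ * ((c a : ℤ) : Subring.center (Two B)))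
      (x' := -diffUV B[X] - hZ' * ((c a : ℤ) : Subring.center (Two B[X]))) (h := hZ) (h' := hZ')
      (N := N) hg' Sum.inr_injective (inrPerm_swap (m := m)) (p := Sum.inl (g a))
      (fun _ => Sum.inr_ne_inl) (by simp [twoMap_diffUV, hZdef, hZdef', twoMap_twoC])
      (twoMap_twoC _ _) c'
    have e : ∀ b, -z a b = -diffUV B - hZ * ((c a : ℤ) : Subring.center (Two B))
        + hZ * ((c' b : ℤ) : Subring.center (Two B)) := by
      intro b; simp only [hz]; push_cast; ring
    simp only [e, hEV, hQdef, Equiv.swap_comm (Sum.inl (g a))]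
    exact this
  have hQQ : ∀ a a' b b', a < m → a' < m → b < m' → b' < m' → a ≠ a' → b ≠ b' →
      Commute (Q a b) (Q a' b') := by
    intro a a' b b' ha ha' hb hb' h1 h2
    refine Commute.map (f := permMat N (Two B)) ?_
    rw [Commute, SemiconjBy, Equiv.mul_swap_eq_swap_mul,
      Equiv.swap_apply_of_ne_of_ne (inl_ne ha' ha h1.symm) Sum.inl_ne_inr,
      Equiv.swap_apply_of_ne_of_ne Sum.inr_ne_inl (inr_ne hb' hb h2.symm)]
  have hQT : ∀ a a' b, a < m → a' < m → b < m' → a ≠ a' → Commute (Q a b) (T a') := by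
    intro a a' b ha ha' hb h1
    rw [hT]
    exact permMat_swap_commute_copy (inl_ne ha' ha h1.symm) Sum.inl_ne_inr _
  have hQT' : ∀ a b b', a < m → b < m' → b' < m' → b ≠ b' → Commute (Q a b) (T' b') := by
    intro a b b' ha hb hb' h1
    rw [hT']
    exact permMat_swap_commute_copy Sum.inr_ne_inl (inr_ne hb' hb h1.symm) _
  have hQ2 : ∀ a b, a < m → b < m' → Q a b * Q a b = 1 := fun a b _ _ => by
    rw [hQdef, ← map_mul, Equiv.swap_mul_self, map_one]
  have hUU : EU * EU = EU := by rw [hEU, ← map_mul, jointProj_mul_self hg c le_rfl]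
  have hVV : EV * EV = EV := by rw [hEV, ← map_mul, jointProj_mul_self hg' c' le_rfl]
  have key := trace_fused_comm (tr := Matrix.traceLinearMap (Fin m ⊕ Fin m' → Fin N)
      (Subring.center (Two B)) (Two B)) (fun a b _ _ => hreg a b)
    (fun a b _ _ => matrix_smul_regular (hreg a b)) hUU hVV hEUV
    (hEU ▸ cyclic_permHom _ _) (hEV ▸ cyclic_permHom _ _)
    (fun a b _ _ => cyclic_permMat _) hQ2 hQQ hQT hQT' hUT hVT hRTT hfT hfT' hfU hfV
  simp only [Matrix.traceLinearMap_apply] at key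
  have c1 : Commute EV (prodUp T m) := (prodUp_commute fun a ha => (hVT a ha).symm).symm
  have c2 : Commute EU (prodUp T' m') := (prodUp_commute fun a ha => (hUT a ha).symm).symm
  rw [show EU * prodUp T m * (EV * prodUp T' m') = EU * EV * (prodUp T m * prodUp T' m') by
      rw [mul_assoc, ← mul_assoc _ EV, ← c1.eq]; noncomm_ring, key, hEUV.eq]
  rw [show EV * prodUp T' m' * (EU * prodUp T m) = EV * EU * (prodUp T' m' * prodUp T m) by
      rw [mul_assoc, ← mul_assoc _ EU, ← c2.eq]; noncomm_ring]

/-- The fused trace for the labels `g` and the contents `c`. -/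
def fusedTrace (h : B) (n : ℕ) (τ : Fin N → Fin N → ℕ → B) (g : ℕ → Fin m) (c : ℕ → ℤ) :
    PowerSeries B :=
  (permHom N (oneScalar B) oneScalar_commute (MonoidHom.id _) (jointProj g c m)
    * prodUp (fun a => copy (g a) (Matrix.of fun i j => tSeries h (c a : B) n τ i j)) m).trace

theorem map_fusedTrace (emb : PowerSeries B →+* Two B) (hemb : ∀ z, emb (oneScalar B z) = twoScalar B z)
    (c : ℕ → ℤ) : emb (fusedTrace h n τ g c)
      = (twoPerm N B (MonoidHom.id _) (jointProj g c m) * prodUp (fun a => copy (g a)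
        (Matrix.of fun i j => emb (tSeries h (c a : B) n τ i j))) m).trace := by
  have : ∀ M : Matrix (Fin m → Fin N) (Fin m → Fin N) (PowerSeries B),
      emb M.trace = (emb.mapMatrix M).trace := fun M => AddMonoidHom.map_trace emb.toAddMonoidHom M
  rw [fusedTrace, this, map_mul, map_permHom _ emb twoScalar_commute hemb, map_prodUp]
  simp only [map_copy]
  rfl

/-- The two coefficients are extracted from one series in `u` and one in `v`; each product of traces
is rewritten as a single trace over the joint tensor space. -/
theorem fusedTrace_coeff_commute (hg : ∀ a < m, (g a).val = a) (hg' : ∀ a < m', (g' a).val = a)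
    (H : YangianRel h τ) (hh : ∀ b, Commute h b) (hn : 0 < n) (hnil : h ^ n = 0) (c c' : ℕ → ℤ)
    (k k' : ℕ) :
    Commute (PowerSeries.coeff k (fusedTrace h n τ g c))
      (PowerSeries.coeff k' (fusedTrace h n τ g' c')) := by
  rw [Commute, SemiconjBy, ← coeff_C_mul_map_C, ← coeff_map_C_mul_C]
  congr 2
  rw [map_fusedTrace _ (fun z => rfl), map_fusedTrace _ (fun z => by
    simp [oneScalar, twoScalar, twoC])]
  -- `p` and `p'` split the same tensor space with its two parts listed in opposite orders, one for
  -- each order of the traces.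
  set p := splitIndex N (Equiv.refl (Fin m ⊕ Fin m'))
  set p' := splitIndex N (Equiv.sumComm (Fin m') (Fin m))
  have hp : p' = p.trans (Equiv.prodComm _ _) := by
    ext I <;> rfl
  have hp' : p = p'.trans (Equiv.prodComm _ _) := by
    ext I <;> rfl
  rw [← trace_leftFactor_mul p, ← trace_leftFactor_mul p', ← hp, ← hp', map_mul, map_mul,
    leftFactor_permHom (φ := inlPerm m m') _ _ (fun s a => rfl) (fun s b => rfl),
    leftFactor_permHom (φ := inrPerm m m') _ _ (fun s a => rfl) (fun s b => rfl),
    map_prodUp, map_prodUp]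
  simp only [p, p', leftFactor_copy]
  exact fused_trace_comm hg hg' H hh hn hnil c c' rfl rfl rfl rfl

end FusedTraces

end

/-! ### Fused series with factors labelled by `Fin m`, including the empty case -/

section FusedSeries

variable {N : ℕ} {B : Type} [Ring B] [Algebra ℂ B] {n : ℕ} {h : B} {τ : Fin N → Fin N → ℕ → B}
  {m m' : ℕ}

/-- The joint spectral projection of the Jucys–Murphy elements for the eigenvalues `c`. -/
def contentIdempotent (c : Fin m → ℤ) : MonoidAlgebra ℂ (Equiv.Perm (Fin m)) :=
  (List.ofFn fun a : Fin m => Polynomial.aeval (jucysMurphy a)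
    (Lagrange.basis (Finset.Ioo (-(m : ℤ)) (m : ℤ)) (fun c : ℤ => (c : ℂ)) (c a))).prod

/-- The fused trace for the contents `c`. -/
def fusedSeries (h : B) (n : ℕ) (τ : Fin N → Fin N → ℕ → B) (c : Fin m → ℤ) : PowerSeries B :=
  Matrix.trace ((oneScalar B).mapMatrix (permOperator N (contentIdempotent c))
    * (List.ofFn fun a : Fin m =>
        tensorCopy a (Matrix.of fun i j => tSeries h (c a : B) n τ i j)).prod)

theorem jucysMurphy_eq_jm {g : ℕ → Fin m} (hg : ∀ a < m, (g a).val = a) (a : Fin m) :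
    jucysMurphy a = jm g a := by
  rw [jucysMurphy, jm, swapSum]
  refine Finset.sum_bij (fun b _ => b.val) (fun b hb => ?_) (fun _ _ _ _ h => Fin.ext h)
    (fun b hb => ⟨g b, ?_, ?_⟩) (fun b hb => ?_)
  · simpa using hb
  · have hb' : b < a := by simpa using hb
    rw [Finset.mem_Iio, Fin.lt_def, hg b (hb'.trans a.2)]
    exact hb'
  · exact hg b ((Finset.mem_range.1 hb).trans a.2)
  · rw [swapElt, Fin.ext (hg b b.2), Fin.ext (hg a a.2)]

theorem tensorCopy_eq_copy {R : Type} [Ring R] (a : Fin m) (X : Matrix (Fin N) (Fin N) R) :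
    tensorCopy a X = copy a X := by
  ext I J
  simp only [tensorCopy, copy_apply, Matrix.of_apply]
  congr

/-- The labelling of `Fin (m + 1)` by natural numbers needs a nonempty target, which is why the case
of no boxes is separate; there the series is a scalar. -/
theorem fusedSeries_succ (c : Fin (m + 1) → ℤ) :
    fusedSeries h n τ c = fusedTrace h n τ (Fin.ofNat (m + 1)) fun a => c (Fin.ofNat (m + 1) a) := by
  have hg : ∀ a < m + 1, (Fin.ofNat (m + 1) a).val = a := fun a ha => Nat.mod_eq_of_lt ha
  have hg' : ∀ a : Fin (m + 1), Fin.ofNat (m + 1) a.val = a := fun a => Fin.ext (hg _ a.2)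
  rw [fusedSeries, fusedTrace, permHom_apply, contentIdempotent, jointProj,
    prod_ofFn_eq_prodUp _ (fun a => proj (Finset.Ioo (-((m + 1 : ℕ) : ℤ)) (m + 1 : ℕ))
      (jm (Fin.ofNat (m + 1)) a) (c (Fin.ofNat (m + 1) a))),
    prod_ofFn_eq_prodUp _ (fun a => copy (Fin.ofNat (m + 1) a)
      (Matrix.of fun i j => tSeries h (c (Fin.ofNat (m + 1) a) : B) n τ i j))]
  · intro a
    rw [tensorCopy_eq_copy, hg']
  · intro a
    rw [jucysMurphy_eq_jm hg, hg', proj]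

theorem fusedSeries_zero (c : Fin 0 → ℤ) :
    ∃ z, fusedSeries h n τ c = oneScalar B z := by
  refine ⟨(permOperator N (contentIdempotent c)).trace, ?_⟩
  rw [fusedSeries, List.ofFn_zero, List.prod_nil, mul_one]
  exact (AddMonoidHom.map_trace (oneScalar B).toAddMonoidHom _).symm

theorem coeff_oneScalar_commute (z : ℂ) (k : ℕ) (y : B) :
    Commute (PowerSeries.coeff k (oneScalar B z)) y := by
  rw [oneScalar, RingHom.comp_apply, PowerSeries.coeff_C]
  split_ifs
  · exact Algebra.commutes z y
  · exact Commute.zero_left y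

theorem fusedSeries_coeff_commute (H : YangianRel h τ) (hh : ∀ b, Commute h b) (hn : 0 < n)
    (hnil : h ^ n = 0) (c : Fin m → ℤ) (c' : Fin m' → ℤ) (k k' : ℕ) :
    Commute (PowerSeries.coeff k (fusedSeries h n τ c))
      (PowerSeries.coeff k' (fusedSeries h n τ c')) := by
  cases m with
  | zero =>
    obtain ⟨z, hz⟩ := fusedSeries_zero (h := h) (n := n) (τ := τ) c
    rw [hz]
    exact coeff_oneScalar_commute z k _
  | succ m =>
    cases m' with
    | zero =>
      obtain ⟨z, hz⟩ := fusedSeries_zero (h := h) (n := n) (τ := τ) c'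
      rw [hz]
      exact (coeff_oneScalar_commute z k' _).symm
    | succ m' =>
      rw [fusedSeries_succ, fusedSeries_succ]
      exact fusedTrace_coeff_commute (fun a ha => Nat.mod_eq_of_lt ha)
        (fun a ha => Nat.mod_eq_of_lt ha) H hh hn hnil _ _ k k'

end FusedSeries

/-! ### Reduction of the completed dual Yangian modulo powers of `h` -/

section DualYangian

variable {N : ℕ}

theorem yangianRel_t {B : Type} [Ring B] [Algebra ℂ⟦X⟧ B] (ρ : DualYangian N →ₐ[ℂ⟦X⟧] B) :
    YangianRel (algebraMap ℂ⟦X⟧ B PowerSeries.X) fun i j r => ρ (DualYangian.t i j r) := by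
  intro i j k l r s
  have := congrArg ρ (RingQuot.mkAlgHom_rel ℂ⟦X⟧ (DualYangianRel.comm (N := N) i j k l r s))
  simp only [map_sub, map_add, map_mul, map_smul, map_sum, apply_ite ρ,
    apply_ite (RingQuot.mkAlgHom ℂ⟦X⟧ (DualYangianRel N)), map_zero] at this
  rwa [Algebra.smul_def] at this

/-- Under a homomorphism that truncates `h`-adic sums at `n`, the expansion of `t⁺(u + hc)` becomes
the finite `shift`; the remaining ingredients are scalars or permutation matrices and are preserved.
-/
theorem map_TSeries {B : Type} [Ring B] [Algebra ℂ⟦X⟧ B] [Algebra ℂ B] {n : ℕ}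
    (hC : ∀ z, algebraMap ℂ⟦X⟧ B (PowerSeries.C z) = algebraMap ℂ B z)
    (π : HAdicCompletion (DualYangian N) →ₐ[ℂ⟦X⟧] B) (ρ : DualYangian N →ₐ[ℂ⟦X⟧] B)
    (hπ : ∀ f : ℕ → DualYangian N,
      π (hSeries f) = ∑ d ∈ Finset.range n, ((PowerSeries.X : ℂ⟦X⟧) ^ d) • ρ (f d))
    {μ : YoungDiagram} (U : StandardTableau μ) :
    PowerSeries.map (π : HAdicCompletion (DualYangian N) →+* B) (DualYangian.TSeries N U)
      = fusedSeries (algebraMap ℂ⟦X⟧ B PowerSeries.X) n (fun i j r => ρ (DualYangian.t i j r))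
        U.content := by
  set F := PowerSeries.map (π : HAdicCompletion (DualYangian N) →+* B) with hF
  have h1 : ∀ M : Matrix (Fin μ.card → Fin N) (Fin μ.card → Fin N)
      (PowerSeries (HAdicCompletion (DualYangian N))), F M.trace = (F.mapMatrix M).trace :=
    fun M => AddMonoidHom.map_trace F.toAddMonoidHom M
  rw [DualYangian.TSeries, h1, map_mul, map_list_prod, List.map_ofFn, fusedSeries]
  congr 2
  · ext I J : 1
    simp only [RingHom.mapMatrix_apply, Matrix.map_apply, hF, PowerSeries.map_C, oneScalar,
      RingHom.comp_apply, RingHom.coe_coe, AlgHom.commutes, hC]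
    rfl
  · congr 2
    funext a
    rw [Function.comp_apply, tensorCopy_eq_copy, tensorCopy_eq_copy, map_copy]
    congr 1
    ext i j k
    rw [RingHom.mapMatrix_apply, Matrix.map_apply, hF, PowerSeries.coeff_map, DualYangian.T,
      Matrix.of_apply, PowerSeries.coeff_mk, Matrix.of_apply, tSeries, RingHom.coe_coe,
      map_sub π, map_smul π, hπ, apply_ite π, map_one π, map_zero π, Algebra.smul_def]
    simp only [map_sub, PowerSeries.coeff_C_mul, PowerSeries.coeff_mk, shift]
    congr 2
    · simp only [delta]
      by_cases hij : i = j <;> simp [hij, PowerSeries.coeff_one]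
    · refine Finset.sum_congr rfl fun d _ => ?_
      rw [map_smul, Algebra.smul_def, Algebra.smul_def, hC, map_pow]
      have hc : Commute (algebraMap ℂ⟦X⟧ B PowerSeries.X) (U.content a : B) :=
        Algebra.commutes _ _
      rw [hc.mul_pow]
      simp only [map_mul, map_pow, map_natCast, map_intCast]
      have h2 : ∀ y : B, Commute (algebraMap ℂ⟦X⟧ B PowerSeries.X ^ d) y := fun y =>
        (Algebra.commute_algebraMap_left _ y).pow_left d
      rw [← mul_assoc, ← mul_assoc, ← mul_assoc, (h2 _).eq, mul_assoc _ _ (_ ^ d), (h2 _).eq,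
        ← mul_assoc]

theorem map_coeff_TSeries_commute {B : Type} [Ring B] [Algebra ℂ⟦X⟧ B] {n : ℕ}
    (hnil : algebraMap ℂ⟦X⟧ B PowerSeries.X ^ n = 0)
    (π : HAdicCompletion (DualYangian N) →ₐ[ℂ⟦X⟧] B) (ρ : DualYangian N →ₐ[ℂ⟦X⟧] B)
    (hπ : ∀ f : ℕ → DualYangian N,
      π (hSeries f) = ∑ d ∈ Finset.range n, ((PowerSeries.X : ℂ⟦X⟧) ^ d) • ρ (f d))
    {μ μ' : YoungDiagram} (U : StandardTableau μ) (U' : StandardTableau μ') (k k' : ℕ) :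
    Commute (π (PowerSeries.coeff k (DualYangian.TSeries N U)))
      (π (PowerSeries.coeff k' (DualYangian.TSeries N U'))) := by
  -- For `n = 0` the hypothesis says `1 = 0`, so the target is the zero ring.
  rcases Nat.eq_zero_or_pos n with rfl | hn
  · rw [pow_zero] at hnil
    exact (subsingleton_of_zero_eq_one hnil.symm).elim _ _
  -- The complex structure is the one induced by constant series in `h`, so that the scalars of the
  -- two definitions agree.
  let _ : Algebra ℂ B := Algebra.compHom B (PowerSeries.C : ℂ →+* ℂ⟦X⟧)
  have hC : ∀ z, algebraMap ℂ⟦X⟧ B (PowerSeries.C z) = algebraMap ℂ B z := fun _ => rfl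
  have := fusedSeries_coeff_commute (yangianRel_t ρ)
    (fun b => Algebra.commutes PowerSeries.X b) hn hnil U.content U'.content k k'
  rwa [← map_TSeries hC π ρ hπ, ← map_TSeries hC π ρ hπ, PowerSeries.coeff_map,
    PowerSeries.coeff_map] at this

/-- Elements of the inverse limit are equal when all their components are, and in the component `n`
the image of `h` has vanishing `n`-th power. -/
theorem coeff_TSeries_commute {μ μ' : YoungDiagram} (U : StandardTableau μ)
    (U' : StandardTableau μ') (k k' : ℕ) :
    Commute (PowerSeries.coeff k (DualYangian.TSeries N U))
      (PowerSeries.coeff k' (DualYangian.TSeries N U')) := by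
  refine Subtype.ext (funext fun n => ?_)
  have hnil : algebraMap ℂ⟦X⟧ (DualYangian N ⧸ hIdeal (DualYangian N) n) PowerSeries.X ^ n = 0 := by
    rw [← map_pow]
    exact Ideal.Quotient.eq_zero_iff_mem.2 (Ideal.mem_span_singleton_self _)
  exact map_coeff_TSeries_commute hnil
    ((Pi.evalAlgHom ℂ⟦X⟧ (fun n => DualYangian N ⧸ hIdeal (DualYangian N) n) n).comp
      (HAdicCompletion (DualYangian N)).val)
    (Ideal.Quotient.mkₐ ℂ⟦X⟧ (hIdeal (DualYangian N) n))
    (fun f => by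
      change Ideal.Quotient.mkₐ ℂ⟦X⟧ (hIdeal (DualYangian N) n) _ = _
      rw [map_sum]
      simp only [map_smul]) U U' k k'

end DualYangian

end YangianFusion

end

theorem corollary4p5 (N : ℕ) :
    ∀ x ∈ Algebra.adjoin ℂ⟦X⟧ (DualYangian.TCoefficients N),
      ∀ y ∈ Algebra.adjoin ℂ⟦X⟧ (DualYangian.TCoefficients N), x * y = y * x := by
  intro x hx y hy
  refine Algebra.commute_of_mem_adjoin_of_forall_mem_commute hy fun b hb => ?_
  refine (Algebra.commute_of_mem_adjoin_of_forall_mem_commute hx fun a ha => ?_).symm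
  obtain ⟨μ, -, U, k, rfl⟩ := ha
  obtain ⟨μ', -, U', k', rfl⟩ := hb
  exact YangianFusion.coeff_TSeries_commute U' U k' k
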